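/- There exist a smooth Riemannian metric $g$ on $S^2$ and a smooth $1$-form $\psi$ on $S^2$ with the following properties. Let $H:T^*S^2\to\mathbb{R}$, $H(q,p)=\tfrac12|p|_g^2$, let $\omega=dp\wedge dq+\pi^*(d\psi)$, where $\pi:T^*S^2\to S^2$ is the projection, and let $X_H$ be the symplectic gradient, $\omega(X_H,\cdot)=-dH$, with flow $\phi_t$. 1. The Mañé critical value $c=\inf_{\theta}\sup_{q\in S^2}H(q,\theta_q)$, where the infimum is over all smooth $1$-forms $\theta$ on $S^2$ with $d\theta=d\psi$, satisfies $c<\tfrac12$. 2. There is a closed orbit $y:\mathbb{R}/T\mathbb{Z}\to H^{-1}(\tfrac12)$ of $X_H$, $T>0$, which is strongly non-degenerate, i.e. $\dim\ker(d_{y(0)}\phi_T-\mathbb{1})=1$, and whose correction term is $\chi(y)=-1$. Here an orbit cylinder about $y$ is a smooth family $(y_e)$, $|e-\tfrac12|<\varepsilon$, of closed orbits of $X_H$ of energy $e$ and of period $T(e)$, depending smoothly on $e$, with $y_{1/2}=y$ and $T(\tfrac12)=T$; it is non-degenerate if $T'(\tfrac12)\neq0$, and then $\chi(y)=\operatorname{sign}(-T'(\tfrac12))$.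 That is, $y$ admits an orbit cylinder, and every orbit cylinder about $y$ has $T'(\tfrac12)>0$. Moreover, with $q(t)=\pi(y(Tt))$, the pair $(q,T)$ is a critical point of the free time action functional $$\mathcal{S}_{1/2}(q,T)=T\int_0^1\Bigl(L\bigl(q,\tfrac{\dot q}{T}\bigr)+\tfrac12\Bigr)dt+\int_{0}^1 \psi_q(\dot q)\,dt$$ on $W^{1,2}(S^1,S^2)\times\mathbb{R}^+$, where $L$ is the Fenchel dual of $H$, and its Morse index $i(q,T)$ and the Morse index $i_T(q)$ of $q$ as a critical point of the fixed period functional $\mathcal{S}_{1/2}(\cdot,T)$ are finite and satisfy $i(q,T)=i_T(q)+1$. 3. The energy level $H^{-1}(\tfrac12)$ also carries a strongly non-degenerate closed orbit $z$ of $X_H$ with correction term $\chi(z)=+1$ (it admits an orbit cylinder, and every orbit cylinder about it is non-degenerate with $\operatorname{sign}(-T'(\tfrac12))=+1$). -/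

import Mathlib

open Set Filter Topology MeasureTheory
open scoped ContDiff InnerProductSpace

noncomputable section

namespace MagneticSphere

/-! ### The sphere, Riemannian metrics and one-forms

`S²` is the unit sphere of `ℝ³`, with `T_q S² = {v | ⟪q, v⟫ = 0}`. As `S²` is a closed submanifold
of `ℝ³`, every smooth tensor on it is the restriction of a smooth tensor on `ℝ³`, and tensors on
`S²` are represented in that way; every definition below only uses their values at points of `S²`
on vectors tangent to `S²`. -/

/-- Euclidean three-space. -/
abbrev E3 : Type := EuclideanSpace ℝ (Fin 3)

/-- Covectors on `ℝ³`. -/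
abbrev Covec : Type := E3 →L[ℝ] ℝ

/-- The two-sphere. -/
def S2 : Set E3 := Metric.sphere 0 1

/-- The tangent plane `T_q S²`. -/
def tangentPlane (q : E3) : Submodule ℝ E3 where
  carrier := {v | ⟪q, v⟫_ℝ = 0}
  add_mem' := by
    intro u v hu hv
    change ⟪q, u⟫_ℝ = 0 at hu
    change ⟪q, v⟫_ℝ = 0 at hv
    change ⟪q, u + v⟫_ℝ = 0
    rw [inner_add_right, hu, hv, add_zero]
  zero_mem' := by simp
  smul_mem' := by
    intro c v hv
    change ⟪q, v⟫_ℝ = 0 at hv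
    change ⟪q, c • v⟫_ℝ = 0
    rw [inner_smul_right, hv, mul_zero]

/-- A smooth Riemannian metric on `S²`. -/
structure SphereMetric where
  /-- The bilinear form `g_q`. -/
  form : E3 → E3 →L[ℝ] E3 →L[ℝ] ℝ
  smooth : ContDiff ℝ ∞ form
  symm : ∀ q ∈ S2, ∀ u ∈ tangentPlane q, ∀ v ∈ tangentPlane q, form q u v = form q v u
  pos : ∀ q ∈ S2, ∀ v ∈ tangentPlane q, v ≠ 0 → 0 < form q v v

/-- A smooth one-form on `S²`. -/
structure SphereOneForm where
  /-- The covector `ψ_q`. -/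
  form : E3 → Covec
  smooth : ContDiff ℝ ∞ form

/-- The exterior derivative `dψ_q(u, v)` of a one-form. (On `u, v ∈ T_q S²` this is the exterior
derivative of the restriction of `ψ` to `S²`, because pull-backs commute with `d`.) -/
def SphereOneForm.d (ψ : SphereOneForm) (q u v : E3) : ℝ :=
  fderiv ℝ ψ.form q u v - fderiv ℝ ψ.form q v u

/-! ### The twisted cotangent bundle and the Hamiltonian flow -/

/-- The ambient space `T*ℝ³` of `T*S²`; its elements are pairs `(q, p)`. -/
abbrev Phase : Type := E3 × Covec

/-- The cotangent bundle `T*S²`. A covector of the plane `T_q S² = q^⊥` is represented by its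
extension to `ℝ³` that vanishes on the normal vector `q`. -/
def cotangentBundle : Set Phase := {x | x.1 ∈ S2 ∧ x.2 x.1 = 0}

/-- The tangent space of `T*S²` at `x = (q, p)`: the pairs `(u, a)` that satisfy the linearized
constraints `⟪q, u⟫ = 0` and `a(q) + p(u) = 0`. -/
def phaseTangent (x : Phase) : Submodule ℝ Phase where
  carrier := {ξ | ξ.1 ∈ tangentPlane x.1 ∧ ξ.2 x.1 + x.2 ξ.1 = 0}
  add_mem' := by
    rintro ξ η ⟨h₁, h₂⟩ ⟨k₁, k₂⟩
    refine ⟨(tangentPlane x.1).add_mem h₁ k₁, ?_⟩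
    change (ξ.2 x.1 + η.2 x.1) + x.2 (ξ.1 + η.1) = 0
    rw [map_add]
    linarith
  zero_mem' := ⟨(tangentPlane x.1).zero_mem, by simp⟩
  smul_mem' := by
    rintro c ξ ⟨h₁, h₂⟩
    refine ⟨(tangentPlane x.1).smul_mem c h₁, ?_⟩
    change c * ξ.2 x.1 + x.2 (c • ξ.1) = 0
    rw [map_smul, smul_eq_mul, ← mul_add, h₂, mul_zero]

/-- The norm `|p|_g` of the restriction of the covector `p` to `T_q S²`. -/
def SphereMetric.conorm (g : SphereMetric) (q : E3) (p : Covec) : ℝ :=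
  sSup {a | ∃ v ∈ tangentPlane q, g.form q v v ≤ 1 ∧ a = p v}

/-- The mechanical (kinetic) Hamiltonian `H(q, p) = ½ |p|_g²`. -/
def SphereMetric.hamiltonian (g : SphereMetric) (q : E3) (p : Covec) : ℝ :=
  1 / 2 * g.conorm q p ^ 2

/-- The twisted symplectic form `ω = dp ∧ dq + π^*dψ` at `x = (q, p)`. -/
def twistedForm (ψ : SphereOneForm) (x ξ η : Phase) : ℝ :=
  (ξ.2 η.1 - η.2 ξ.1) + ψ.d x.1 ξ.1 η.1

/-- `X` is the value at `x` of the symplectic gradient `X_H` of `H` with respect to `ω`: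
it is tangent to `T*S²` and `ω(X, ξ) = -dH(ξ)` for all `ξ ∈ T_x T*S²`. (With this sign and
`ω = dp ∧ dq` one gets `q' = ∂H/∂p`, `p' = -∂H/∂q`.) Here `dH` is the derivative of `H` along the
submanifold `T*S²`; it is determined by `H|_{T*S²}` on tangent vectors. -/
def IsSymplecticGradientAt (g : SphereMetric) (ψ : SphereOneForm) (x X : Phase) : Prop :=
  X ∈ phaseTangent x ∧
    ∃ dH : Phase →L[ℝ] ℝ,
      HasFDerivWithinAt (fun z : Phase => g.hamiltonian z.1 z.2) dH cotangentBundle x ∧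
      ∀ ξ ∈ phaseTangent x, twistedForm ψ x X ξ = -dH ξ

/-- `c` is an integral curve of `X_H` in `T*S²` on the set of times `I`. -/
def IsIntegralCurveOn (g : SphereMetric) (ψ : SphereOneForm) (c : ℝ → Phase) (I : Set ℝ) : Prop :=
  ∀ t ∈ I, c t ∈ cotangentBundle ∧
    ∃ X, IsSymplecticGradientAt g ψ (c t) X ∧ HasDerivWithinAt c X I t

/-- `y : ℝ/Tℤ → H⁻¹(k)` is a closed orbit of `X_H`. -/
structure IsClosedOrbit (g : SphereMetric) (ψ : SphereOneForm) (k T : ℝ) (y : ℝ → Phase) :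
    Prop where
  period_pos : 0 < T
  periodic : Function.Periodic y T
  integral : IsIntegralCurveOn g ψ y univ
  energy : ∀ t, g.hamiltonian (y t).1 (y t).2 = k

/-- `Φ` is the time-`T` map `φ_T` of the flow of `X_H` on a neighbourhood of `x₀` in `T*S²`. -/
def IsTimeMapNear (g : SphereMetric) (ψ : SphereOneForm) (T : ℝ) (x₀ : Phase)
    (Φ : Phase → Phase) : Prop :=
  ∀ᶠ x in 𝓝[cotangentBundle] x₀,
    ∃ c : ℝ → Phase, IsIntegralCurveOn g ψ c (Icc 0 T) ∧ c 0 = x ∧ c T = Φ x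

/-- The `T`-periodic orbit `y` is strongly non-degenerate:
`dim ker (d_{y(0)} φ_T - 1) = 1` on `T_{y(0)} T*S²`. -/
def StronglyNondegenerate (g : SphereMetric) (ψ : SphereOneForm) (T : ℝ) (y : ℝ → Phase) : Prop :=
  ∃ (Φ : Phase → Phase) (D : Phase →L[ℝ] Phase),
    IsTimeMapNear g ψ T (y 0) Φ ∧
    HasFDerivWithinAt Φ D cotangentBundle (y 0) ∧
    Module.finrank ℝ
      ↥(phaseTangent (y 0) ⊓ LinearMap.ker (D.toLinearMap - LinearMap.id)) = 1

/-! ### Orbit cylinders and the correction term -/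

/-- An orbit cylinder about the `T`-periodic orbit `y` of energy `k`: a smooth family of closed
orbits `y_e` of energy `e ∈ (k - ε, k + ε)` and period `T(e)` with `y_k = y`, `T(k) = T`. -/
structure OrbitCylinder (g : SphereMetric) (ψ : SphereOneForm) (k T : ℝ) (y : ℝ → Phase) where
  /-- The size of the energy interval. -/
  ε : ℝ
  ε_pos : 0 < ε
  /-- The orbit of energy `e`. -/
  orbit : ℝ → ℝ → Phase
  /-- The period of the orbit of energy `e`. -/
  period : ℝ → ℝ
  smooth_orbit :
    ContDiffOn ℝ ∞ (fun z : ℝ × ℝ => orbit z.1 z.2) (Ioo (k - ε) (k + ε) ×ˢ univ)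
  smooth_period : ContDiffOn ℝ ∞ period (Ioo (k - ε) (k + ε))
  closed : ∀ e ∈ Ioo (k - ε) (k + ε), IsClosedOrbit g ψ e (period e) (orbit e)
  orbit_center : orbit k = y
  period_center : period k = T

/-- The orbit cylinder is non-degenerate if `T'(k) ≠ 0`. -/
def OrbitCylinder.Nondegenerate {g : SphereMetric} {ψ : SphereOneForm} {k T : ℝ} {y : ℝ → Phase}
    (O : OrbitCylinder g ψ k T y) : Prop :=
  deriv O.period k ≠ 0

/-- The sign of `-T'(k)`. -/
def OrbitCylinder.chi {g : SphereMetric} {ψ : SphereOneForm} {k T : ℝ} {y : ℝ → Phase}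
    (O : OrbitCylinder g ψ k T y) : SignType :=
  SignType.sign (-deriv O.period k)

/-- The orbit `y` admits an orbit cylinder, every orbit cylinder about it is non-degenerate, and
its correction term, computed in any of them, is `χ`. -/
def HasCorrectionTerm (g : SphereMetric) (ψ : SphereOneForm) (k T : ℝ) (y : ℝ → Phase)
    (χ : SignType) : Prop :=
  Nonempty (OrbitCylinder g ψ k T y) ∧
    ∀ O : OrbitCylinder g ψ k T y, O.Nondegenerate ∧ O.chi = χ

/-! ### The Mañé critical value -/

/-- The Mañé critical value `c = inf_θ sup_q H(q, θ_q)`, over all one-forms `θ` on `S²` with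
`dθ = dψ`. (The sphere is its own universal cover, so that `c = c₀`.) -/
def maneCriticalValue (g : SphereMetric) (ψ : SphereOneForm) : EReal :=
  ⨅ (θ : SphereOneForm)
    (_ : ∀ q ∈ S2, ∀ u ∈ tangentPlane q, ∀ v ∈ tangentPlane q, θ.d q u v = ψ.d q u v),
    ⨆ q ∈ S2, ((g.hamiltonian q (θ.form q) : ℝ) : EReal)

/-! ### The free time action functional and its Morse indices -/

/-- The Fenchel dual Lagrangian `L(q, v) = max_{p ∈ T_q^* S²} (p(v) - H(q, p))`. -/
def SphereMetric.lagrangian (g : SphereMetric) (q v : E3) : ℝ :=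
  sSup {a | ∃ p : Covec, p q = 0 ∧ a = p v - g.hamiltonian q p}

/-- The free time action `S_k(q, T) = T ∫ (L(q, q'/T) + k) dt + ∫ q^*ψ` of a loop `q : ℝ/ℤ → S²`.
(All loops in `S²` are contractible; by Stokes, `∫ q^*ψ` is the integral of `dψ` over a homotopy
from `q` to a constant reference loop.) -/
def action (g : SphereMetric) (ψ : SphereOneForm) (k : ℝ) (q : ℝ → E3) (T : ℝ) : ℝ :=
  T * (∫ t in (0 : ℝ)..1, (g.lagrangian (q t) (T⁻¹ • deriv q t) + k)) +
    ∫ t in (0 : ℝ)..1, ψ.form (q t) (deriv q t)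

/-- `ζ : ℝ/ℤ → ℝ³` is of Sobolev class `W^{1,2}` (continuous representative): on `[0, 1]` it is a
primitive of a square integrable function. -/
def IsSobolevLoop (ζ : ℝ → E3) : Prop :=
  Function.Periodic ζ 1 ∧
    ∃ w : ℝ → E3, MemLp w 2 (volume.restrict (Ioc (0 : ℝ) 1)) ∧
      ∀ t ∈ Icc (0 : ℝ) 1, ζ t = ζ 0 + ∫ s in (0 : ℝ)..t, w s

theorem intervalIntegrable_of_memLp {w : ℝ → E3}
    (hw : MemLp w 2 (volume.restrict (Ioc (0 : ℝ) 1))) {t : ℝ} (ht : t ∈ Icc (0 : ℝ) 1) :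
    IntervalIntegrable w volume 0 t := by
  have h : IntegrableOn w (Ioc 0 1) volume := hw.integrable (by norm_num)
  rw [intervalIntegrable_iff_integrableOn_Ioc_of_le ht.1]
  exact h.mono_set (Ioc_subset_Ioc_right ht.2)

/-- The space `W^{1,2}(S¹, q^*TS²)` of Sobolev vector fields along the loop `q`, which is the
tangent space at `q` of the Hilbert manifold `ΛS²` of Sobolev loops in `S²`. -/
def loopTangent (q : ℝ → E3) : Submodule ℝ (ℝ → E3) where
  carrier := {ζ | IsSobolevLoop ζ ∧ ∀ t, ζ t ∈ tangentPlane (q t)}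
  add_mem' := by
    rintro ζ η ⟨⟨hζ, w, hw, hζw⟩, hζt⟩ ⟨⟨hη, w', hw', hηw⟩, hηt⟩
    refine ⟨⟨hζ.add hη, w + w', hw.add hw', fun t ht => ?_⟩,
      fun t => (tangentPlane (q t)).add_mem (hζt t) (hηt t)⟩
    simp only [Pi.add_apply]
    rw [intervalIntegral.integral_add (intervalIntegrable_of_memLp hw ht)
      (intervalIntegrable_of_memLp hw' ht), hζw t ht, hηw t ht]
    abel
  zero_mem' := ⟨⟨fun _ => rfl, 0, MemLp.zero, by simp⟩, fun t => (tangentPlane (q t)).zero_mem⟩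
  smul_mem' := by
    rintro c ζ ⟨⟨hζ, w, hw, hζw⟩, hζt⟩
    refine ⟨⟨fun t => by simp [hζ t], c • w, hw.const_smul c, fun t ht => ?_⟩,
      fun t => (tangentPlane (q t)).smul_mem c (hζt t)⟩
    simp only [Pi.smul_apply]
    rw [intervalIntegral.integral_smul, hζw t ht, smul_add]

/-- The variation `s ↦ (q + s ζ) / |q + s ζ|` of the loop `q` in `S²`. For `ζ` tangent along `q`
it is a smooth curve in `ΛS²` through `q` with velocity `ζ`. -/
def variation (q ζ : ℝ → E3) (s : ℝ) : ℝ → E3 :=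
  fun t => ‖q t + s • ζ t‖⁻¹ • (q t + s • ζ t)

/-- `(q, T)` is a critical point of `S_k` on `ΛS² × ℝ⁺`. -/
def IsCriticalPoint (g : SphereMetric) (ψ : SphereOneForm) (k : ℝ) (q : ℝ → E3) (T : ℝ) : Prop :=
  ∀ ζ ∈ loopTangent q, ∀ b : ℝ,
    HasDerivAt (fun s : ℝ => action g ψ k (variation q ζ s) (T + s * b)) 0 0

/-- The quadratic form `d²S_k((ζ, b), (ζ, b))` of the Hessian of `S_k` at a critical point
`(q, T)`. -/
def freeHessian (g : SphereMetric) (ψ : SphereOneForm) (k : ℝ) (q : ℝ → E3) (T : ℝ)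
    (w : (ℝ → E3) × ℝ) : ℝ :=
  iteratedDeriv 2 (fun s : ℝ => action g ψ k (variation q w.1 s) (T + s * w.2)) 0

/-- The quadratic form `d²S_k^T(ζ, ζ)` of the Hessian, at a critical point `q`, of the fixed
period action functional `S_k^T = S_k(·, T)`. -/
def fixedHessian (g : SphereMetric) (ψ : SphereOneForm) (k : ℝ) (q : ℝ → E3) (T : ℝ)
    (ζ : ℝ → E3) : ℝ :=
  iteratedDeriv 2 (fun s : ℝ => action g ψ k (variation q ζ s) T) 0

/-- The maximal dimension of a subspace of `V` on which the quadratic form `Q` is negative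
definite. -/
def negativeIndex {F : Type} [AddCommGroup F] [Module ℝ F] (V : Submodule ℝ F) (Q : F → ℝ) : ℕ∞ :=
  ⨆ (W : Submodule ℝ F) (_ : W ≤ V) (_ : ∀ w ∈ W, w ≠ 0 → Q w < 0),
    Cardinal.toENat (Module.rank ℝ W)

/-- The Morse index `i(q, T)` of the critical point `(q, T)` of `S_k`. -/
def freeIndex (g : SphereMetric) (ψ : SphereOneForm) (k : ℝ) (q : ℝ → E3) (T : ℝ) : ℕ∞ :=
  negativeIndex ((loopTangent q).prod ⊤) (freeHessian g ψ k q T)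

/-- The Morse index `i_T(q)` of the critical point `q` of `S_k^T`. -/
def fixedIndex (g : SphereMetric) (ψ : SphereOneForm) (k : ℝ) (q : ℝ → E3) (T : ℝ) : ℕ∞ :=
  negativeIndex (loopTangent q) (fixedHessian g ψ k q T)

/-- The loop `q : ℝ/ℤ → S²`, `q(t) = π(y(T t))`, of a `T`-periodic orbit `y`. -/
def baseLoop (y : ℝ → Phase) (T : ℝ) : ℝ → E3 := fun t => (y (T * t)).1

end MagneticSphere

end

open MagneticSphere

noncomputable section

namespace MagneticSphere

/-! Take the round metric and a field invariant under rotation about the vertical axis, of strength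
β(h) = 2μh(2h² - 1) at height h. Magnetic geodesics solve q' = v, v' = β(q₂) q × v - |v|² q. A
circle of latitude of radius r and height u ≠ 0 is an orbit exactly when its angular velocity is Ω =
2μ(1 - 2r²). Its speed 2μr(1 - 2r²) increases with r while r² < 1/6, and so does its period 2π/Ω;
along these circles the period therefore grows with the energy, whence χ = -1. The field vanishes on
the equator, which is thus an orbit at every speed, with period 2π/√(2e) decreasing in e, whence χ =
+1. The potential itself, used as competitor, gives c ≤ 2μ²/27, which is about 1/4 when μ is chosen
so that unit speed occurs at a radius just below 1/√6.

To control every orbit cylinder, and the kernel of the return map, one linearizes. In the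
co-rotating frame the circle is an equilibrium, so the time T map has derivative exp(TA) there
(`isLittleO_flow`). The first integrals reduce the linear system to one oscillator y'' + κy = const
for the latitude, with κ = `normalFrequency`. If κT² < 1, its T-periodic solutions are constant
(`eq_zero_of_periodic_oscillator`). This yields the one-dimensional kernel
(`stronglyNondegenerate_circleOrbit`) and the identity r²κT' = T(u² - r²κ)
(`OrbitCylinder.deriv_period_eq`). At unit speed r²κ = u²(1 - 6r²)/(1 - 2r²) on the circles of
latitude, which lies strictly between 0 and u² for r² < 1/6, so that T' > 0; on the equator the
identity reads T' = -T.

For the Morse indices, let x and y be the longitudinal and latitudinal components of a vector field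
along the circle. The second variation is T⁻¹ ∫ (y'² - κT²y² + (x' - 2πuy - b)²)
(`hasJet_action_circleLoop`). Since x' has mean zero, the Poincaré inequality bounds it below by
T⁻¹((2πum + b)² - κT²m²), where m is the mean of y. With b = 0 this is nonnegative because r²κ ≤ u²,
so the fixed period index is 0. With b free it is nonnegative on the hyperplane m = 0, and the
choice y = 1, x = 0, b = -2πu makes the form negative, so the free index is 1. -/

/-! ### The round metric: conorm, Hamiltonian and Lagrangian -/

theorem inner_eq (x y : E3) : ⟪x, y⟫_ℝ = x 0 * y 0 + x 1 * y 1 + x 2 * y 2 := by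
  simp [PiLp.inner_apply, Fin.sum_univ_three, mul_comm]

/-- The musical isomorphism of Euclidean space. -/
def flat : E3 ≃L[ℝ] Covec :=
  LinearEquiv.toContinuousLinearEquiv
    { toFun := fun v => innerSL ℝ v
      invFun := fun p => (InnerProductSpace.toDual ℝ E3).symm p
      map_add' := fun v w => by simp
      map_smul' := fun c v => by simp
      left_inv := fun v => (InnerProductSpace.toDual ℝ E3).symm_apply_apply v
      right_inv := fun p => (InnerProductSpace.toDual ℝ E3).apply_symm_apply p }

@[simp] theorem flat_apply (v w : E3) : flat v w = ⟪v, w⟫_ℝ := rfl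

def roundMetric : SphereMetric where
  form := fun _ => innerSL ℝ
  smooth := contDiff_const
  symm := fun q _ u _ v _ => by
    rw [innerSL_apply_apply, innerSL_apply_apply, real_inner_comm]
  pos := fun q _ v _ hv => by
    rw [innerSL_apply_apply]; exact real_inner_self_pos.2 hv

@[simp] theorem roundMetric_form (q u v : E3) : roundMetric.form q u v = ⟪u, v⟫_ℝ :=
  innerSL_apply_apply ℝ u v

theorem mem_S2 {q : E3} : q ∈ S2 ↔ ⟪q, q⟫_ℝ = 1 := by
  rw [S2, mem_sphere_zero_iff_norm, real_inner_self_eq_norm_sq]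
  constructor
  · intro h; rw [h]; norm_num
  · intro h; nlinarith [norm_nonneg q]

theorem conorm_flat {q v : E3} (h : ⟪q, v⟫_ℝ = 0) :
    roundMetric.conorm q (flat v) = ‖v‖ := by
  unfold SphereMetric.conorm
  refine IsGreatest.csSup_eq ⟨?_, ?_⟩
  · rcases eq_or_ne v 0 with rfl | hv
    · exact ⟨0, (tangentPlane q).zero_mem, by simp [roundMetric], by simp⟩
    · have hn : ‖v‖ ≠ 0 := norm_ne_zero_iff.2 hv
      refine ⟨‖v‖⁻¹ • v, (tangentPlane q).smul_mem _ h, ?_, ?_⟩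
      · rw [roundMetric_form, real_inner_smul_left, real_inner_smul_right, real_inner_self_eq_norm_sq]
        apply le_of_eq; field_simp
      · rw [flat_apply, real_inner_smul_right, real_inner_self_eq_norm_sq]
        field_simp
  · rintro a ⟨w, -, hw, rfl⟩
    rw [roundMetric_form, real_inner_self_eq_norm_sq] at hw
    have h1 : ‖w‖ ≤ 1 := by nlinarith [norm_nonneg w]
    calc flat v w ≤ ‖v‖ * ‖w‖ := real_inner_le_norm v w
      _ ≤ ‖v‖ := mul_le_of_le_one_right (norm_nonneg v) h1

theorem hamiltonian_flat {q v : E3} (h : ⟪q, v⟫_ℝ = 0) :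
    roundMetric.hamiltonian q (flat v) = 1 / 2 * ⟪v, v⟫_ℝ := by
  rw [SphereMetric.hamiltonian, conorm_flat h, real_inner_self_eq_norm_sq]

/-- The maximum in the Fenchel dual is attained at the covector dual to v, and the defect at the
covector dual to w is ½|v - w|². -/
theorem lagrangian_eq {q v : E3} (h : ⟪q, v⟫_ℝ = 0) :
    roundMetric.lagrangian q v = 1 / 2 * ⟪v, v⟫_ℝ := by
  unfold SphereMetric.lagrangian
  refine IsGreatest.csSup_eq ⟨⟨flat v, ?_, ?_⟩, ?_⟩
  · rw [flat_apply, real_inner_comm, h]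
  · rw [hamiltonian_flat h, flat_apply]; ring
  · rintro a ⟨p, hp, rfl⟩
    obtain ⟨w, rfl⟩ := flat.surjective p
    rw [flat_apply, real_inner_comm] at hp
    rw [hamiltonian_flat hp, flat_apply]
    have := real_inner_self_nonneg (x := v - w)
    rw [inner_sub_left, inner_sub_right, inner_sub_right, real_inner_comm v w] at this
    linarith [real_inner_comm v w]

/-! ### The cotangent bundle as pairs of vectors -/

/-- The identification of pairs of vectors with points of phase space. -/
def toPhase : (E3 × E3) ≃L[ℝ] Phase := (ContinuousLinearEquiv.refl ℝ E3).prodCongr flat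

@[simp] theorem toPhase_apply (x : E3 × E3) : toPhase x = (x.1, flat x.2) := rfl

/-- The tangent bundle of the sphere. -/
def tangentBundle : Set (E3 × E3) := {x | ⟪x.1, x.1⟫_ℝ = 1 ∧ ⟪x.1, x.2⟫_ℝ = 0}

theorem toPhase_mem_cotangentBundle {x : E3 × E3} :
    toPhase x ∈ cotangentBundle ↔ x ∈ tangentBundle := by
  simp only [cotangentBundle, tangentBundle, toPhase_apply, mem_ofPred_eq, mem_S2, flat_apply,
    real_inner_comm]

theorem toPhase_mem_phaseTangent {x ξ : E3 × E3} :
    toPhase ξ ∈ phaseTangent (toPhase x) ↔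
      ⟪x.1, ξ.1⟫_ℝ = 0 ∧ ⟪x.1, ξ.2⟫_ℝ + ⟪ξ.1, x.2⟫_ℝ = 0 := by
  change (⟪x.1, ξ.1⟫_ℝ = 0 ∧ flat ξ.2 x.1 + flat x.2 ξ.1 = 0) ↔ _
  rw [flat_apply, flat_apply, real_inner_comm x.1 ξ.2, real_inner_comm ξ.1 x.2]

/-- The curve in the tangent bundle of the sphere through `x` in the direction of `ξ`. -/
theorem exists_curve {x ξ : E3 × E3} (hx : x ∈ tangentBundle) (h₁ : ⟪x.1, ξ.1⟫_ℝ = 0)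
    (h₂ : ⟪x.1, ξ.2⟫_ℝ + ⟪ξ.1, x.2⟫_ℝ = 0) :
    ∃ γ : ℝ → E3 × E3, γ 0 = x ∧ HasDerivAt γ ξ 0 ∧ ∀ s, γ s ∈ tangentBundle := by
  obtain ⟨q, v⟩ := x
  obtain ⟨u, b⟩ := ξ
  obtain ⟨hq, hv⟩ := hx
  simp only at hq hv h₁ h₂
  let c : ℝ → ℝ := fun s => (√(1 + s ^ 2 * ⟪u, u⟫_ℝ))⁻¹
  let n : ℝ → E3 := fun s => c s • (q + s • u)
  let p : ℝ → E3 := fun s => v + s • b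
  have hc : ∀ s, c s ^ 2 * (1 + s ^ 2 * ⟪u, u⟫_ℝ) = 1 := by
    intro s
    have : 0 < 1 + s ^ 2 * ⟪u, u⟫_ℝ := by
      have := real_inner_self_nonneg (x := u)
      positivity
    simp only [c]
    rw [inv_pow, Real.sq_sqrt this.le, inv_mul_cancel₀ this.ne']
  have hn : ∀ s, ⟪n s, n s⟫_ℝ = 1 := by
    intro s
    rw [← hc s]
    simp only [n, inner_add_left, inner_add_right, real_inner_smul_left, real_inner_smul_right,
      real_inner_comm q u, hq, h₁]
    ring
  have hc' : HasDerivAt c 0 0 := by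
    have h : HasDerivAt (fun s : ℝ => 1 + s ^ 2 * ⟪u, u⟫_ℝ) 0 0 := by
      simpa using ((hasDerivAt_pow 2 (0 : ℝ)).mul_const ⟪u, u⟫_ℝ).const_add 1
    have h' := (h.sqrt (by simp)).fun_inv (by simp)
    refine h'.congr_deriv (by simp)
  have hn' : HasDerivAt n u 0 := by
    have h : HasDerivAt (fun s : ℝ => q + s • u) u 0 := by
      simpa using ((hasDerivAt_id (0 : ℝ)).smul_const u).const_add q
    exact (hc'.fun_smul h).congr_deriv (by simp [c])
  have hp' : HasDerivAt p b 0 := by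
    exact (((hasDerivAt_id (0 : ℝ)).smul_const b).const_add v).congr_deriv (by simp)
  have hn0 : n 0 = q := by simp [n, c]
  have hp0 : p 0 = v := by simp [p]
  refine ⟨fun s => (n s, p s - ⟪n s, p s⟫_ℝ • n s), ?_, ?_, ?_⟩
  · simp [hn0, hp0, hv]
  · refine HasDerivAt.prodMk hn' ?_
    have h := hp'.fun_sub ((hn'.inner ℝ hp').fun_smul hn')
    exact h.congr_deriv (by simp [hn0, hp0, hv, h₂])
  · intro s
    refine ⟨hn s, ?_⟩
    simp only [inner_sub_right, real_inner_smul_right, hn s]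
    ring

/-- On the cotangent bundle H coincides with ½|·|² of the dual vector, which is smooth on the whole
ambient space; its ambient derivative serves as derivative along the submanifold. -/
theorem hasFDerivWithinAt_hamiltonian {x : E3 × E3} (hx : x ∈ tangentBundle) :
    HasFDerivWithinAt (fun z : Phase => roundMetric.hamiltonian z.1 z.2)
      ((innerSL ℝ x.2).comp ((flat.symm : Covec →L[ℝ] E3).comp (ContinuousLinearMap.snd ℝ E3 Covec)))
      cotangentBundle (toPhase x) := by
  have hL : HasFDerivAt (fun z : Phase => flat.symm z.2)
      ((flat.symm : Covec →L[ℝ] E3).comp (ContinuousLinearMap.snd ℝ E3 Covec)) (toPhase x) :=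
    ((flat.symm : Covec →L[ℝ] E3).comp (ContinuousLinearMap.snd ℝ E3 Covec)).hasFDerivAt
  have h := (hL.inner ℝ hL).const_mul (1 / 2)
  have h' : HasFDerivAt (fun z : Phase => 1 / 2 * ⟪flat.symm z.2, flat.symm z.2⟫_ℝ)
      ((innerSL ℝ x.2).comp
        ((flat.symm : Covec →L[ℝ] E3).comp (ContinuousLinearMap.snd ℝ E3 Covec)))
      (toPhase x) := by
    refine h.congr_fderiv ?_
    ext z
    · simp
    · simp [real_inner_comm, fderivInnerCLM_apply]
      ring
  have key : ∀ z ∈ cotangentBundle, roundMetric.hamiltonian z.1 z.2 =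
      1 / 2 * ⟪flat.symm z.2, flat.symm z.2⟫_ℝ := by
    intro z hz
    obtain ⟨y, rfl⟩ := toPhase.surjective z
    rw [toPhase_mem_cotangentBundle] at hz
    simp only [toPhase_apply, ContinuousLinearEquiv.symm_apply_apply]
    exact hamiltonian_flat hz.2
  exact h'.hasFDerivWithinAt.congr key (key _ (toPhase_mem_cotangentBundle.2 hx))

/-! ### The magnetic potential and its field -/

/-- The cross product of Euclidean three-space. -/
def cross (x y : E3) : E3 :=
  !₂[x 1 * y 2 - x 2 * y 1, x 2 * y 0 - x 0 * y 2, x 0 * y 1 - x 1 * y 0]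

@[simp] theorem cross_zero (x y : E3) : cross x y 0 = x 1 * y 2 - x 2 * y 1 := rfl
@[simp] theorem cross_one (x y : E3) : cross x y 1 = x 2 * y 0 - x 0 * y 2 := rfl
@[simp] theorem cross_two (x y : E3) : cross x y 2 = x 0 * y 1 - x 1 * y 0 := rfl

/-- The vector field dual to the magnetic potential. -/
def potentialVector (μ : ℝ) (q : E3) : E3 := !₂[μ * q 2 ^ 2 * q 1, -(μ * q 2 ^ 2 * q 0), 0]

theorem contDiff_potentialVector (μ : ℝ) : ContDiff ℝ ∞ (potentialVector μ) := by
  rw [contDiff_euclidean]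
  intro i
  fin_cases i
  · change ContDiff ℝ ∞ fun q : E3 => μ * q 2 ^ 2 * q 1
    fun_prop
  · change ContDiff ℝ ∞ fun q : E3 => -(μ * q 2 ^ 2 * q 0)
    fun_prop
  · exact contDiff_const

/-- The magnetic potential `-μ q₂² (q₀ dq₁ - q₁ dq₀)`. -/
def magneticPotential (μ : ℝ) : SphereOneForm where
  form := fun q => flat (potentialVector μ q)
  smooth := flat.contDiff.comp (contDiff_potentialVector μ)

theorem magneticPotential_apply (μ : ℝ) (q v : E3) :
    (magneticPotential μ).form q v = μ * q 2 ^ 2 * (q 1 * v 0 - q 0 * v 1) := by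
  change flat (potentialVector μ q) v = _
  rw [flat_apply, inner_eq]
  simp [potentialVector]
  ring

theorem hasDerivAt_line (q u : E3) : HasDerivAt (fun s : ℝ => q + s • u) u 0 :=
  (((hasDerivAt_id (0 : ℝ)).smul_const u).const_add q).congr_deriv (by simp)

theorem hasDerivAt_potential_line (μ a b c x y z v w : ℝ) :
    HasDerivAt (fun s : ℝ => μ * (c + s * z) ^ 2 * ((b + s * y) * v - (a + s * x) * w))
      (μ * (2 * c * z * (b * v - a * w) + c ^ 2 * (y * v - x * w))) 0 := by
  have e : ∀ a x : ℝ, HasDerivAt (fun s : ℝ => a + s * x) x 0 := fun a x =>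
    (((hasDerivAt_id (0 : ℝ)).mul_const x).const_add a).congr_deriv (by simp)
  refine ((((e c z).fun_pow 2).const_mul μ).fun_mul
    (((e b y).mul_const v).fun_sub ((e a x).mul_const w))).congr_deriv ?_
  simp
  ring

theorem fderiv_magneticPotential (μ : ℝ) (q u v : E3) :
    fderiv ℝ (magneticPotential μ).form q u v =
      μ * (2 * q 2 * u 2 * (q 1 * v 0 - q 0 * v 1) + q 2 ^ 2 * (u 1 * v 0 - u 0 * v 1)) := by
  have hd : HasFDerivAt (magneticPotential μ).form (fderiv ℝ (magneticPotential μ).form q)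
      (q + (0 : ℝ) • u) := by
    rw [zero_smul, add_zero]
    exact ((magneticPotential μ).smooth.differentiable (by simp) q).hasFDerivAt
  have h1 := (ContinuousLinearMap.apply ℝ ℝ v).hasFDerivAt.comp_hasDerivAt (0 : ℝ)
    (hd.comp_hasDerivAt (0 : ℝ) (hasDerivAt_line q u))
  refine h1.unique ((hasDerivAt_potential_line μ (q 0) (q 1) (q 2) (u 0) (u 1) (u 2) (v 0)
    (v 1)).congr_of_eventuallyEq (Eventually.of_forall fun s => ?_))
  exact magneticPotential_apply μ (q + s • u) v

/-- The strength of the magnetic field at height `h`. -/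
def fieldStrength (μ h : ℝ) : ℝ := 2 * μ * h * (2 * h ^ 2 - 1)

/-- For tangent u, v the vector v × u is the multiple ⟪q × v, u⟫ of q; `e0`, `e1`, `e2` are its
components. Substituting them in the ambient two-form and using |q| = 1 leaves a function of the
height times the area form. -/
theorem d_magneticPotential (μ : ℝ) {q u v : E3} (hq : ⟪q, q⟫_ℝ = 1) (hu : ⟪q, u⟫_ℝ = 0)
    (hv : ⟪q, v⟫_ℝ = 0) :
    (magneticPotential μ).d q v u = -(fieldStrength μ (q 2) * ⟪cross q v, u⟫_ℝ) := by
  rw [SphereOneForm.d, fderiv_magneticPotential, fderiv_magneticPotential]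
  rw [inner_eq] at *
  simp only [cross_zero, cross_one, cross_two, fieldStrength]
  have e0 : v 1 * u 2 - v 2 * u 1 = q 0 *
      ((q 1 * v 2 - q 2 * v 1) * u 0 + (q 2 * v 0 - q 0 * v 2) * u 1 +
        (q 0 * v 1 - q 1 * v 0) * u 2) := by
    linear_combination (-(v 1 * u 2 - v 2 * u 1)) * hq - (q 1 * v 2 - q 2 * v 1) * hu +
      (q 1 * u 2 - q 2 * u 1) * hv
  have e1 : v 2 * u 0 - v 0 * u 2 = q 1 *
      ((q 1 * v 2 - q 2 * v 1) * u 0 + (q 2 * v 0 - q 0 * v 2) * u 1 +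
        (q 0 * v 1 - q 1 * v 0) * u 2) := by
    linear_combination (-(v 2 * u 0 - v 0 * u 2)) * hq - (q 2 * v 0 - q 0 * v 2) * hu +
      (q 2 * u 0 - q 0 * u 2) * hv
  have e2 : v 0 * u 1 - v 1 * u 0 = q 2 *
      ((q 1 * v 2 - q 2 * v 1) * u 0 + (q 2 * v 0 - q 0 * v 2) * u 1 +
        (q 0 * v 1 - q 1 * v 0) * u 2) := by
    linear_combination (-(v 0 * u 1 - v 1 * u 0)) * hq - (q 0 * v 1 - q 1 * v 0) * hu +
      (q 0 * u 1 - q 1 * u 0) * hv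
  linear_combination (-2 * μ * q 2 ^ 2) * e2 + 2 * μ * q 2 * (q 0 * e0 + q 1 * e1) +
    2 * μ * q 2 * ((q 1 * v 2 - q 2 * v 1) * u 0 + (q 2 * v 0 - q 0 * v 2) * u 1 +
        (q 0 * v 1 - q 1 * v 0) * u 2) * hq

theorem inner_cross_left (q v : E3) : ⟪q, cross q v⟫_ℝ = 0 := by
  rw [inner_eq]
  simp only [cross_zero, cross_one, cross_two]
  ring

/-! ### The equations of motion -/

/-- The acceleration of a magnetic geodesic of the round sphere. -/
def acceleration (μ : ℝ) (x : E3 × E3) : E3 :=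
  fieldStrength μ (x.1 2) • cross x.1 x.2 - ⟪x.2, x.2⟫_ℝ • x.1

theorem d_magneticPotential_sub (μ : ℝ) (q u u' v : E3) :
    (magneticPotential μ).d q (u - u') v =
      (magneticPotential μ).d q u v - (magneticPotential μ).d q u' v := by
  simp only [SphereOneForm.d, map_sub, sub_apply]
  ring

theorem twistedForm_toPhase (μ : ℝ) (x ξ η : E3 × E3) :
    twistedForm (magneticPotential μ) (toPhase x) (toPhase ξ) (toPhase η) =
      ⟪ξ.2, η.1⟫_ℝ - ⟪η.2, ξ.1⟫_ℝ + (magneticPotential μ).d x.1 ξ.1 η.1 := rfl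

/-- The twisted form is non-degenerate on tangent vectors, so the gradient is unique and it suffices
to exhibit a solution. The derivative `dH` in the definition is arbitrary off the tangent space;
curves inside the bundle (`exists_curve`) show that its values on tangent vectors are the expected
ones. -/
theorem isSymplecticGradientAt_iff (μ : ℝ) {x : E3 × E3} (hx : x ∈ tangentBundle)
    (X : E3 × E3) :
    IsSymplecticGradientAt roundMetric (magneticPotential μ) (toPhase x) (toPhase X) ↔
      X = (x.2, acceleration μ x) := by
  obtain ⟨hq, hv⟩ := id hx
  have hsol : ∀ ξ : E3 × E3, ⟪x.1, ξ.1⟫_ℝ = 0 →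
      ⟪acceleration μ x, ξ.1⟫_ℝ - ⟪ξ.2, x.2⟫_ℝ + (magneticPotential μ).d x.1 x.2 ξ.1 =
        -⟪x.2, ξ.2⟫_ℝ := by
    intro ξ hξ
    rw [d_magneticPotential μ hq hξ hv, acceleration, inner_sub_left, real_inner_smul_left,
      real_inner_smul_left, hξ]
    linarith [real_inner_comm x.2 ξ.2]
  have htan : ⟪x.1, acceleration μ x⟫_ℝ + ⟪x.2, x.2⟫_ℝ = 0 := by
    rw [acceleration, inner_sub_right, real_inner_smul_right, real_inner_smul_right,
      inner_cross_left, hq]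
    ring
  constructor
  · rintro ⟨hX, dH, hdH, h⟩
    rw [toPhase_mem_phaseTangent] at hX
    have h1 : ∀ ξ : E3 × E3, ⟪x.1, ξ.1⟫_ℝ = 0 → ⟪x.1, ξ.2⟫_ℝ + ⟪ξ.1, x.2⟫_ℝ = 0 →
        ⟪X.2, ξ.1⟫_ℝ - ⟪ξ.2, X.1⟫_ℝ + (magneticPotential μ).d x.1 X.1 ξ.1 = -⟪x.2, ξ.2⟫_ℝ := by
      intro ξ h₁ h₂
      obtain ⟨γ, hγ0, hγ, hγm⟩ := exists_curve hx h₁ h₂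
      have hm : ∀ s, toPhase (γ s) ∈ cotangentBundle := fun s =>
        toPhase_mem_cotangentBundle.2 (hγm s)
      have hγ' : HasDerivAt (fun s => toPhase (γ s)) (toPhase ξ) 0 :=
        toPhase.hasFDerivAt.comp_hasDerivAt (0 : ℝ) hγ
      have e1 := HasFDerivWithinAt.comp_hasDerivAt_of_eq (0 : ℝ) hdH hγ' (Eventually.of_forall hm)
        (by rw [hγ0])
      have e2 := HasFDerivWithinAt.comp_hasDerivAt_of_eq (0 : ℝ)
        (hasFDerivWithinAt_hamiltonian hx) hγ' (Eventually.of_forall hm) (by rw [hγ0])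
      have e3 := e1.unique e2
      have e4 := h (toPhase ξ) (toPhase_mem_phaseTangent.2 ⟨h₁, h₂⟩)
      rw [twistedForm_toPhase, e3] at e4
      rw [e4]
      simp
    have h2 : ∀ ξ : E3 × E3, ⟪x.1, ξ.1⟫_ℝ = 0 → ⟪x.1, ξ.2⟫_ℝ + ⟪ξ.1, x.2⟫_ℝ = 0 →
        ⟪X.2 - acceleration μ x, ξ.1⟫_ℝ - ⟪ξ.2, X.1 - x.2⟫_ℝ +
          (magneticPotential μ).d x.1 (X.1 - x.2) ξ.1 = 0 := by
      intro ξ h₁ h₂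
      rw [d_magneticPotential_sub, inner_sub_left, inner_sub_right]
      linarith [h1 ξ h₁ h₂, hsol ξ h₁]
    -- Vertical test vectors detect the base component of the difference.
    have hz1 : X.1 - x.2 = 0 := by
      have := h2 (0, X.1 - x.2) (by simp) (by simp [inner_sub_right, hX.1, hv])
      simp only [inner_zero_right, SphereOneForm.d, map_zero, zero_apply,
        zero_sub, sub_zero, add_zero, neg_eq_zero] at this
      exact inner_self_eq_zero.1 this
    have hX1 : X.1 = x.2 := sub_eq_zero.1 hz1
    have hz2 : X.2 - acceleration μ x = 0 := by
      have hperp : ⟪x.1, X.2 - acceleration μ x⟫_ℝ = 0 := by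
        rw [inner_sub_right]
        have := hX.2
        rw [hX1] at this
        linarith
      -- The base component of this test vector is the remaining difference; the multiple of the
      -- normal x.1 in the fibre makes it satisfy the linearized constraint.
      have := h2 (X.2 - acceleration μ x, -⟪X.2 - acceleration μ x, x.2⟫_ℝ • x.1) hperp
        (by rw [real_inner_smul_right, hq]; ring)
      rw [hz1] at this
      simp only [inner_zero_right, SphereOneForm.d, map_zero, zero_apply,
        sub_zero, add_zero] at this
      exact inner_self_eq_zero.1 this
    exact Prod.ext hX1 (sub_eq_zero.1 hz2)
  · rintro rfl
    refine ⟨toPhase_mem_phaseTangent.2 ⟨hv, htan⟩, _, hasFDerivWithinAt_hamiltonian hx, ?_⟩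
    intro ξ hξ
    obtain ⟨ξ, rfl⟩ := toPhase.surjective ξ
    rw [toPhase_mem_phaseTangent] at hξ
    rw [twistedForm_toPhase, hsol ξ hξ.1]
    simp

/-- A curve in phase space is an integral curve if and only if it is a magnetic geodesic. -/
theorem isIntegralCurveOn_iff (μ : ℝ) (x : ℝ → E3 × E3) (I : Set ℝ) :
    IsIntegralCurveOn roundMetric (magneticPotential μ) (fun t => toPhase (x t)) I ↔
      ∀ t ∈ I, x t ∈ tangentBundle ∧
        HasDerivWithinAt x ((x t).2, acceleration μ (x t)) I t := by
  refine forall₂_congr fun t _ => ?_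
  rw [toPhase_mem_cotangentBundle]
  refine and_congr_right fun hx => ?_
  constructor
  · rintro ⟨X, hX, hd⟩
    obtain ⟨X, rfl⟩ := toPhase.surjective X
    rw [isSymplecticGradientAt_iff μ hx] at hX
    subst hX
    have := toPhase.symm.hasFDerivAt.comp_hasDerivWithinAt t hd
    simpa [Function.comp_def, -toPhase_apply] using this
  · intro hd
    exact ⟨_, (isSymplecticGradientAt_iff μ hx _).2 rfl,
      toPhase.hasFDerivAt.comp_hasDerivWithinAt t hd⟩

/-! ### The Mañé critical value -/

theorem maneCriticalValue_lt {μ : ℝ} (hμ : μ ^ 2 < 27 / 4) :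
    maneCriticalValue roundMetric (magneticPotential μ) < ((1 / 2 : ℝ) : EReal) := by
  have key : ∀ q ∈ S2, roundMetric.hamiltonian q ((magneticPotential μ).form q) ≤
      2 / 27 * μ ^ 2 := by
    intro q hq
    rw [mem_S2, inner_eq] at hq
    have h0 : ⟪q, potentialVector μ q⟫_ℝ = 0 := by
      rw [inner_eq]
      simp [potentialVector]
      ring
    change roundMetric.hamiltonian q (flat (potentialVector μ q)) ≤ _
    rw [hamiltonian_flat h0, inner_eq]
    have e : potentialVector μ q 0 * potentialVector μ q 0 +
        potentialVector μ q 1 * potentialVector μ q 1 +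
        potentialVector μ q 2 * potentialVector μ q 2 =
          μ ^ 2 * ((q 2 ^ 2) ^ 2 * (1 - q 2 ^ 2)) := by
      simp [potentialVector]
      linear_combination μ ^ 2 * q 2 ^ 4 * hq
    -- The maximum over X = q₂² is at X = 2/3: the defect 4/27 - X²(1 - X) equals (X - 2/3)²(X +
    -- 1/3).
    have h1 : (q 2 ^ 2) ^ 2 * (1 - q 2 ^ 2) ≤ 4 / 27 := by
      nlinarith [mul_nonneg (sq_nonneg (q 2 ^ 2 - 2 / 3)) (by positivity : 0 ≤ q 2 ^ 2 + 1 / 3)]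
    rw [e]
    nlinarith [mul_le_mul_of_nonneg_left h1 (sq_nonneg μ)]
  have h1 : maneCriticalValue roundMetric (magneticPotential μ) ≤
      ((2 / 27 * μ ^ 2 : ℝ) : EReal) :=
    (iInf₂_le (magneticPotential μ) fun _ _ _ _ _ _ => rfl).trans
      (iSup₂_le fun q hq => EReal.coe_le_coe_iff.2 (key q hq))
  exact h1.trans_lt (EReal.coe_lt_coe_iff.2 (by linarith))

/-! ### Differentiability of a flow at an equilibrium -/

section AutonomousODE

variable {E : Type*} [NormedAddCommGroup E] [NormedSpace ℝ E]

/-- `x` solves the autonomous equation `x' = f(x)` on `[0, T]`. -/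
def SolvesOn (f : E → E) (T : ℝ) (x : ℝ → E) : Prop :=
  ∀ t ∈ Icc 0 T, HasDerivWithinAt x (f (x t)) (Icc 0 T) t

theorem SolvesOn.continuousOn {f : E → E} {T : ℝ} {x : ℝ → E} (h : SolvesOn f T x) :
    ContinuousOn x (Icc 0 T) := fun t ht => (h t ht).continuousWithinAt

theorem SolvesOn.hasDerivWithinAt_Ici {f : E → E} {T : ℝ} {x : ℝ → E} (h : SolvesOn f T x) {t : ℝ}
    (ht : t ∈ Ico 0 T) : HasDerivWithinAt x (f (x t)) (Ici t) t :=
  (h t (Ico_subset_Icc_self ht)).mono_of_mem_nhdsWithin (Icc_mem_nhdsGE_of_mem ht)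

variable [CompleteSpace E]

/-- A bounded field cannot leave the ball of radius LT in time T, so Picard–Lindelöf applies on the
whole interval at once. -/
theorem exists_solvesOn {f : E → E} {K L : NNReal} (hf : LipschitzWith K f)
    (hL : ∀ x, ‖f x‖ ≤ L) {T : ℝ} (hT : 0 ≤ T) (x₀ : E) :
    ∃ x : ℝ → E, x 0 = x₀ ∧ SolvesOn f T x := by
  have h : IsPicardLindelof (fun _ => f) (tmin := 0) (tmax := T) ⟨0, left_mem_Icc.2 hT⟩ x₀
      (L * ⟨T, hT⟩) 0 L K :=
    IsPicardLindelof.of_time_independent (fun x _ => hL x) hf.lipschitzOnWith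
      (by simp [hT]; rfl)
  exact h.exists_eq_forall_mem_Icc_hasDerivWithinAt₀

/-- The time `T` map of an autonomous equation is differentiable at a zero `x₀` of the vector
field, with derivative the exponential of the linearization. -/
theorem isLittleO_flow {f : E → E} {K : NNReal} (hf : LipschitzWith K f) {A : E →L[ℝ] E} {x₀ : E}
    (h₀ : f x₀ = 0) (hA : HasFDerivAt f A x₀) {T : ℝ} (hT : 0 ≤ T) {ι : Type*} {l : Filter ι}
    {x : ι → ℝ → E} (hx : ∀ᶠ i in l, SolvesOn f T (x i))
    (hl : Tendsto (fun i => x i 0) l (𝓝 x₀)) :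
    (fun i => x i T - x₀ - NormedSpace.exp (T • A) (x i 0 - x₀)) =o[l]
      fun i => x i 0 - x₀ := by
  obtain ⟨M, hM⟩ : ∃ M, ∀ t ∈ Icc 0 T, ‖NormedSpace.exp ((T - t) • A)‖ ≤ M := by
    refine isCompact_Icc.exists_bound_of_continuousOn (Continuous.continuousOn ?_)
    have : Continuous fun u : ℝ => NormedSpace.exp (u • A) :=
      continuous_iff_continuousAt.2 fun u => (hasDerivAt_exp_smul_const A u).continuousAt
    exact this.comp (continuous_const.sub continuous_id)
  have hM0 : 0 ≤ M := (norm_nonneg _).trans (hM 0 (left_mem_Icc.2 hT))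
  rw [Asymptotics.isLittleO_iff]
  intro ε hε
  set G := Real.exp (K * T) with hG
  have hG0 : 0 < G := Real.exp_pos _
  -- Chosen so that M · c · G · T ≤ ε, the bound that results from integrating the remainder over
  -- [0, T].
  set c := ε / ((M + 1) * G * (T + 1)) with hc
  have hc0 : 0 < c := by positivity
  obtain ⟨δ, hδ, hδ'⟩ := Metric.eventually_nhds_iff.1 ((Asymptotics.isLittleO_iff.1 hA.isLittleO) hc0)
  have hev : ∀ᶠ i in l, dist (x i 0) x₀ < δ / G := hl.eventually (Metric.ball_mem_nhds _ (by positivity))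
  filter_upwards [hx, hev] with i hi hd
  -- Grönwall against the constant solution x₀ keeps the whole trajectory as close to x₀ as its
  -- starting point, up to the factor G.
  have hgron : ∀ t ∈ Icc 0 T, ‖x i t - x₀‖ ≤ ‖x i 0 - x₀‖ * G := by
    intro t ht
    have h := dist_le_of_trajectories_ODE (v := fun _ => f) (K := K) (a := 0) (b := T)
      (g := fun _ => x₀) (δ := dist (x i 0) x₀) (fun _ => hf) hi.continuousOn
      (fun t ht => hi.hasDerivWithinAt_Ici ht) continuousOn_const
      (fun t _ => by rw [h₀]; exact hasDerivWithinAt_const _ _ _) le_rfl t ht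
    rw [dist_eq_norm, dist_eq_norm] at h
    refine h.trans (mul_le_mul_of_nonneg_left ?_ (norm_nonneg _))
    rw [hG, Real.exp_le_exp]
    have := ht.2
    have := K.2
    nlinarith [NNReal.coe_nonneg K]
  have hsmall : ∀ t ∈ Icc 0 T, ‖f (x i t) - A (x i t - x₀)‖ ≤ c * (‖x i 0 - x₀‖ * G) := by
    intro t ht
    have h1 : dist (x i t) x₀ < δ := by
      rw [dist_eq_norm] at hd ⊢
      calc _ ≤ _ := hgron t ht
        _ < δ / G * G := mul_lt_mul_of_pos_right hd hG0
        _ = δ := div_mul_cancel₀ _ hG0.ne'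
    have h2 := hδ' h1
    rw [h₀, sub_zero] at h2
    exact h2.trans (mul_le_mul_of_nonneg_left (hgron t ht) hc0.le)
  -- Variation of constants: transported by the linear flow, the deviation changes only through the
  -- nonlinear remainder of f at x₀.
  have hder : ∀ t ∈ Icc 0 T, HasDerivWithinAt
      (fun t => NormedSpace.exp ((T - t) • A) (x i t - x₀))
      (NormedSpace.exp ((T - t) • A) (f (x i t) - A (x i t - x₀))) (Icc 0 T) t := by
    intro t ht
    have h1 : HasDerivAt (fun t : ℝ => NormedSpace.exp ((T - t) • A))
        (-(NormedSpace.exp ((T - t) • A) * A)) t := by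
      have := (hasDerivAt_exp_smul_const A (T - t)).scomp t ((hasDerivAt_id t).const_sub T)
      simpa [Function.comp_def] using this
    refine (h1.hasDerivWithinAt.clm_apply ((hi t ht).sub_const x₀)).congr_deriv ?_
    simp only [map_sub, neg_apply, mul_apply_eq_comp]
    abel
  have := norm_image_sub_le_of_norm_deriv_le_segment' hder (C := M * (c * (‖x i 0 - x₀‖ * G)))
    (fun t ht => ?_) T (right_mem_Icc.2 hT)
  · simp only [sub_self, zero_smul, NormedSpace.exp_zero, sub_zero,
      one_apply_eq_self] at this
    refine this.trans ?_
    have e : M * (c * (‖x i 0 - x₀‖ * G)) * T =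
        ε * ‖x i 0 - x₀‖ * ((M / (M + 1)) * (T / (T + 1))) := by
      rw [hc]; field_simp
    rw [e]
    refine mul_le_of_le_one_right (by positivity) (mul_le_one₀ ?_ (by positivity) ?_)
    · rw [div_le_one (by positivity)]; linarith
    · rw [div_le_one (by positivity)]; linarith
  · have ht' := Ico_subset_Icc_self ht
    refine (ContinuousLinearMap.le_opNorm _ _).trans ?_
    exact mul_le_mul (hM t ht') (hsmall t ht') (norm_nonneg _) hM0

theorem hasFDerivWithinAt_flow {f : E → E} {K : NNReal} (hf : LipschitzWith K f) {A : E →L[ℝ] E}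
    {x₀ : E} (h₀ : f x₀ = 0) (hA : HasFDerivAt f A x₀) {T : ℝ} (hT : 0 ≤ T) {S : Set E}
    {Φ : E → E} (hΦ : ∀ x ∈ S, ∃ c, SolvesOn f T c ∧ c 0 = x ∧ c T = Φ x) (hx₀ : Φ x₀ = x₀) :
    HasFDerivWithinAt Φ (NormedSpace.exp (T • A)) S x₀ := by
  choose! c hc hc0 hcT using hΦ
  have hS : ∀ᶠ x in 𝓝[S] x₀, x ∈ S := eventually_mem_nhdsWithin
  have h := isLittleO_flow hf h₀ hA hT (l := 𝓝[S] x₀) (x := c) (hS.mono hc)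
    ((tendsto_id.mono_left nhdsWithin_le_nhds).congr' (hS.mono fun x hx => (hc0 x hx).symm))
  rw [hasFDerivWithinAt_iff_isLittleO]
  refine h.congr' (hS.mono fun x hx => ?_) (hS.mono fun x hx => ?_)
  · simp only [hcT x hx, hc0 x hx, hx₀]
  · simp only [hc0 x hx]

/-- The same estimate along a one-parameter family of solutions; this is the form needed for orbit
cylinders, where no time T map is given. -/
theorem hasDerivAt_flow {f : E → E} {K : NNReal} (hf : LipschitzWith K f) {A : E →L[ℝ] E}
    {x₀ : E} (h₀ : f x₀ = 0) (hA : HasFDerivAt f A x₀) {T : ℝ} (hT : 0 ≤ T) {c : ℝ → ℝ → E}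
    {a : ℝ} (hc : ∀ᶠ e in 𝓝 a, SolvesOn f T (c e)) (ha : c a 0 = x₀) (haT : c a T = x₀) {ξ : E}
    (hξ : HasDerivAt (fun e => c e 0) ξ a) :
    HasDerivAt (fun e => c e T) (NormedSpace.exp (T • A) ξ) a := by
  have hl : Tendsto (fun e => c e 0) (𝓝 a) (𝓝 x₀) := by
    simpa only [ha] using hξ.continuousAt.tendsto
  have h1 := isLittleO_flow hf h₀ hA hT hc hl
  have h2 := (NormedSpace.exp (T • A)).hasFDerivAt.comp_hasDerivAt a (hξ.sub_const x₀)
  rw [hasDerivAt_iff_isLittleO] at h2 ⊢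
  have h3 := hξ.isBigO_sub
  simp only [ha] at h3
  refine ((h1.trans_isBigO h3).add h2).congr_left fun e => ?_
  simp [ha, haT]

end AutonomousODE

/-! ### A Poincaré inequality -/

/-- Cauchy–Schwarz, read off from ∫ (T|w| - m)² ≥ 0 with m = ∫ |w|. -/
theorem sq_integral_abs_le {T : ℝ} (hT : 0 < T) {w : ℝ → ℝ} (hw : IntervalIntegrable w volume 0 T)
    (hw2 : IntervalIntegrable (fun t => w t ^ 2) volume 0 T) :
    (∫ t in 0..T, |w t|) ^ 2 ≤ T * ∫ t in 0..T, w t ^ 2 := by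
  set m := ∫ t in 0..T, |w t| with hm
  have h0 : 0 ≤ ∫ t in 0..T, (T * |w t| - m) ^ 2 :=
    intervalIntegral.integral_nonneg hT.le fun t _ => sq_nonneg _
  have e : ∀ t, (T * |w t| - m) ^ 2 = T ^ 2 * w t ^ 2 - 2 * T * m * |w t| + m ^ 2 := fun t => by
    rw [← sq_abs (w t)]; ring
  simp_rw [e] at h0
  rw [intervalIntegral.integral_add ((hw2.const_mul _).sub (hw.abs.const_mul _))
    intervalIntegrable_const, intervalIntegral.integral_sub (hw2.const_mul _)
    (hw.abs.const_mul _), intervalIntegral.integral_const_mul, intervalIntegral.integral_const_mul,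
    intervalIntegral.integral_const, ← hm, smul_eq_mul] at h0
  have : 0 ≤ T * (T * (∫ t in 0..T, w t ^ 2) - m ^ 2) := by nlinarith
  nlinarith [nonneg_of_mul_nonneg_right this hT]

/-- A primitive of a square integrable function that vanishes somewhere on `[0, T]`. -/
theorem sq_le_mul_integral_sq {T : ℝ} (hT : 0 < T) {f w : ℝ → ℝ}
    (hw : IntervalIntegrable w volume 0 T)
    (hw2 : IntervalIntegrable (fun t => w t ^ 2) volume 0 T)
    (hf : ∀ t ∈ Icc 0 T, f t = f 0 + ∫ s in 0..t, w s) {t₀ : ℝ} (ht₀ : t₀ ∈ Icc 0 T)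
    (hz : f t₀ = 0) {t : ℝ} (ht : t ∈ Icc 0 T) : f t ^ 2 ≤ T * ∫ s in 0..T, w s ^ 2 := by
  refine le_trans ?_ (sq_integral_abs_le hT hw hw2)
  rw [← sq_abs]
  refine pow_le_pow_left₀ (abs_nonneg _) ?_ 2
  have hsub : ∀ {a b : ℝ}, a ∈ Icc 0 T → b ∈ Icc 0 T → IntervalIntegrable w volume a b := by
    intro a b ha hb
    refine hw.mono_set ?_
    rw [uIcc_of_le hT.le]
    exact Set.uIcc_subset_Icc ha hb
  have h0 : (0 : ℝ) ∈ Icc 0 T := left_mem_Icc.2 hT.le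
  have e : f t = ∫ s in t₀..t, w s := by
    rw [← intervalIntegral.integral_interval_sub_left (hsub h0 ht) (hsub h0 ht₀)]
    linarith [hf t ht, hf t₀ ht₀]
  rw [e]
  calc |∫ s in t₀..t, w s| ≤ |∫ s in t₀..t, (|w s|)| := by
        simpa using intervalIntegral.norm_integral_le_abs_integral_norm (f := w) (a := t₀) (b := t)
    _ ≤ |∫ s in 0..T, (|w s|)| := by
        refine intervalIntegral.abs_integral_mono_interval ?_
          (Eventually.of_forall fun s => abs_nonneg _) hw.abs
        rw [uIoc_of_le hT.le]
        rcases le_total t₀ t with h | h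
        · rw [uIoc_of_le h]; exact Ioc_subset_Ioc ht₀.1 ht.2
        · rw [uIoc_of_ge h]; exact Ioc_subset_Ioc ht.1 ht₀.2
    _ = ∫ s in 0..T, |w s| := abs_of_nonneg
        (intervalIntegral.integral_nonneg hT.le fun s _ => abs_nonneg _)

/-- Integrates the pointwise bound. The constant T² is far from sharp, but circles with small normal
frequency leave enough room for it. -/
theorem integral_sq_le {T : ℝ} (hT : 0 < T) {f w : ℝ → ℝ}
    (hw : IntervalIntegrable w volume 0 T)
    (hw2 : IntervalIntegrable (fun t => w t ^ 2) volume 0 T)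
    (hf2 : IntervalIntegrable (fun t => f t ^ 2) volume 0 T)
    (hf : ∀ t ∈ Icc 0 T, f t = f 0 + ∫ s in 0..t, w s) {t₀ : ℝ} (ht₀ : t₀ ∈ Icc 0 T)
    (hz : f t₀ = 0) : ∫ s in 0..T, f s ^ 2 ≤ T ^ 2 * ∫ s in 0..T, w s ^ 2 := by
  calc ∫ s in 0..T, f s ^ 2 ≤ ∫ _ in 0..T, T * ∫ s in 0..T, w s ^ 2 :=
        intervalIntegral.integral_mono_on hT.le hf2 intervalIntegrable_const
          fun s hs => sq_le_mul_integral_sq hT hw hw2 hf ht₀ hz hs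
    _ = T ^ 2 * ∫ s in 0..T, w s ^ 2 := by
        rw [intervalIntegral.integral_const, smul_eq_mul]; ring

/-- Periodic solutions of `f'' + κ f = K` are constant if the period is short. -/
theorem eq_zero_of_periodic_oscillator {T κ K : ℝ} (hT : 0 < T) (hκ : κ * T ^ 2 < 1)
    {f g : ℝ → ℝ} (hf : ∀ t, HasDerivAt f (g t) t) (hg : ∀ t, HasDerivAt g (K - κ * f t) t)
    (hfT : f T = f 0) (hgT : g T = g 0) : g 0 = 0 ∧ K - κ * f 0 = 0 := by
  have hfc : Continuous f := continuous_iff_continuousAt.2 fun t => (hf t).continuousAt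
  have hgc : Continuous g := continuous_iff_continuousAt.2 fun t => (hg t).continuousAt
  set h : ℝ → ℝ := fun t => K - κ * f t with hh
  have hhc : Continuous h := continuous_const.sub (continuous_const.mul hfc)
  have hh' : ∀ t, HasDerivAt h (-(κ * g t)) t := fun t =>
    (((hf t).const_mul κ).const_sub K)
  -- By Rolle g = f' has a zero, so the Poincaré inequality applies to g, whose derivative is h.
  obtain ⟨t₀, ht₀, hz⟩ := exists_hasDerivAt_eq_zero hT hfc.continuousOn hfT.symm
    fun t _ => hf t
  have hgi : ∀ t ∈ Icc 0 T, g t = g 0 + ∫ s in 0..t, h s := fun t _ => by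
    rw [intervalIntegral.integral_eq_sub_of_hasDerivAt (fun s _ => hg s)
      (hhc.intervalIntegrable _ _)]
    ring
  have hP := integral_sq_le hT (hhc.intervalIntegrable _ _) ((hhc.pow 2).intervalIntegrable _ _)
    ((hgc.pow 2).intervalIntegrable _ _) hgi (Ioo_subset_Icc_self ht₀) hz
  -- Since g' = h and h' = -κg, the integrand is the derivative of the periodic function gh.
  have hE : ∫ t in 0..T, (h t ^ 2 - κ * g t ^ 2) = 0 := by
    have hd : ∀ t ∈ uIcc 0 T, HasDerivAt (fun t => g t * h t) (h t ^ 2 - κ * g t ^ 2) t :=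
      fun t _ => ((hg t).mul (hh' t)).congr_deriv (by simp only [hh]; ring)
    rw [intervalIntegral.integral_eq_sub_of_hasDerivAt hd
      (((hhc.pow 2).sub (continuous_const.mul (hgc.pow 2))).intervalIntegrable _ _)]
    simp only [hh, hfT, hgT, sub_self]
  have hh2 : Continuous fun t => h t ^ 2 := hhc.pow 2
  have hg2 : Continuous fun t => κ * g t ^ 2 := continuous_const.mul (hgc.pow 2)
  rw [intervalIntegral.integral_sub (hh2.intervalIntegrable _ _) (hg2.intervalIntegrable _ _),
    intervalIntegral.integral_const_mul] at hE
  have hH0 : 0 ≤ ∫ t in 0..T, h t ^ 2 :=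
    intervalIntegral.integral_nonneg hT.le fun t _ => sq_nonneg _
  have hG0 : 0 ≤ ∫ t in 0..T, g t ^ 2 :=
    intervalIntegral.integral_nonneg hT.le fun t _ => sq_nonneg _
  -- For κ > 0 one has ∫ h² = κ ∫ g² ≤ κT² ∫ h² with κT² < 1; for κ ≤ 0 the equality alone forces ∫
  -- h² = 0.
  have hH : ∫ t in 0..T, h t ^ 2 = 0 := by
    rcases le_or_gt κ 0 with hk | hk
    · nlinarith
    · nlinarith [mul_le_mul_of_nonneg_left hP hk.le]
  rw [hH, mul_zero] at hP
  have hG : ∫ t in 0..T, g t ^ 2 = 0 := le_antisymm hP hG0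
  have hzero : ∀ k : ℝ → ℝ, Continuous k → ∫ t in 0..T, k t ^ 2 = 0 → k 0 = 0 := by
    intro k hk hk0
    by_contra hne
    have := intervalIntegral.integral_pos hT (f := fun t => k t ^ 2) (hk.pow 2).continuousOn
      (fun t _ => sq_nonneg _) ⟨0, left_mem_Icc.2 hT.le, by positivity⟩
    linarith
  exact ⟨hzero g hgc hG, hzero h hhc hH⟩

/-! ### Rotations -/

theorem hasDerivWithinAt_E3 {f : ℝ → E3} {f' : E3} {s : Set ℝ} {t : ℝ} :
    HasDerivWithinAt f f' s t ↔ ∀ i, HasDerivWithinAt (fun t => f t i) (f' i) s t := by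
  rw [hasDerivWithinAt_iff_hasFDerivWithinAt, hasFDerivWithinAt_euclidean]
  refine forall_congr' fun i => ?_
  rw [hasDerivWithinAt_iff_hasFDerivWithinAt]
  have : (EuclideanSpace.proj i : E3 →L[ℝ] ℝ).comp (ContinuousLinearMap.toSpanSingleton ℝ f') =
      ContinuousLinearMap.toSpanSingleton ℝ (f' i) := by
    ext; simp
  rw [← this]

theorem E3_ext {x y : E3} (h0 : x 0 = y 0) (h1 : x 1 = y 1) (h2 : x 2 = y 2) : x = y := by
  ext i
  fin_cases i
  exacts [h0, h1, h2]

/-- The infinitesimal rotation about the vertical axis. -/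
def turn (x : E3) : E3 := !₂[-x 1, x 0, 0]

@[simp] theorem turn_zero (x : E3) : turn x 0 = -x 1 := rfl
@[simp] theorem turn_one (x : E3) : turn x 1 = x 0 := rfl
@[simp] theorem turn_two (x : E3) : turn x 2 = 0 := rfl

/-- The rotation by the angle `θ` about the vertical axis. -/
def rot (θ : ℝ) (x : E3) : E3 :=
  !₂[Real.cos θ * x 0 - Real.sin θ * x 1, Real.sin θ * x 0 + Real.cos θ * x 1, x 2]

@[simp] theorem rot_zero (θ : ℝ) (x : E3) :
    rot θ x 0 = Real.cos θ * x 0 - Real.sin θ * x 1 := rfl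
@[simp] theorem rot_one (θ : ℝ) (x : E3) :
    rot θ x 1 = Real.sin θ * x 0 + Real.cos θ * x 1 := rfl
@[simp] theorem rot_two (θ : ℝ) (x : E3) : rot θ x 2 = x 2 := rfl

theorem rot_of_cos_eq_one {θ : ℝ} (h : Real.cos θ = 1) (x : E3) : rot θ x = x := by
  have hs : Real.sin θ = 0 := by
    have := Real.sin_sq_add_cos_sq θ
    rw [h] at this
    nlinarith
  apply E3_ext <;> simp [h, hs]

theorem inner_rot (θ : ℝ) (x y : E3) : ⟪rot θ x, rot θ y⟫_ℝ = ⟪x, y⟫_ℝ := by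
  rw [inner_eq, inner_eq]
  simp only [rot_zero, rot_one, rot_two]
  linear_combination (x 0 * y 0 + x 1 * y 1) * Real.sin_sq_add_cos_sq θ

theorem cross_rot (θ : ℝ) (x y : E3) : cross (rot θ x) (rot θ y) = rot θ (cross x y) := by
  apply E3_ext
  · simp; ring
  · simp; ring
  · simp
    linear_combination (x 0 * y 1 - x 1 * y 0) * Real.sin_sq_add_cos_sq θ

theorem rot_sub (θ : ℝ) (x y : E3) : rot θ (x - y) = rot θ x - rot θ y := by
  apply E3_ext <;> simp <;> ring

theorem rot_smul (θ c : ℝ) (x : E3) : rot θ (c • x) = c • rot θ x := by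
  apply E3_ext <;> simp <;> ring

theorem turn_rot (θ : ℝ) (x : E3) : turn (rot θ x) = rot θ (turn x) := by
  apply E3_ext <;> simp <;> ring

theorem hasDerivWithinAt_rot {Ω : ℝ} {x : ℝ → E3} {x' : E3} {s : Set ℝ} {t : ℝ}
    (h : HasDerivWithinAt x x' s t) :
    HasDerivWithinAt (fun t => rot (Ω * t) (x t)) (rot (Ω * t) (x' + Ω • turn (x t))) s t := by
  rw [hasDerivWithinAt_E3] at h ⊢
  have ha : HasDerivWithinAt (fun t : ℝ => Ω * t) Ω s t := by
    simpa using (hasDerivWithinAt_id t s).const_mul Ω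
  have hc := ha.cos
  have hs := ha.sin
  intro i
  fin_cases i
  · refine ((hc.fun_mul (h 0)).fun_sub (hs.fun_mul (h 1))).congr_deriv ?_
    simp; ring
  · refine ((hs.fun_mul (h 0)).fun_add (hc.fun_mul (h 1))).congr_deriv ?_
    simp; ring
  · refine (h 2).congr_deriv ?_
    simp

/-- The action of rotations on pairs of vectors. -/
def rotPair (θ : ℝ) (x : E3 × E3) : E3 × E3 := (rot θ x.1, rot θ x.2)

theorem rotPair_mem {θ : ℝ} {x : E3 × E3} (hx : x ∈ tangentBundle) :
    rotPair θ x ∈ tangentBundle :=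
  ⟨by simpa only [rotPair, inner_rot] using hx.1, by simpa only [rotPair, inner_rot] using hx.2⟩

theorem acceleration_rot (μ θ : ℝ) (x : E3 × E3) :
    acceleration μ (rotPair θ x) = rot θ (acceleration μ x) := by
  simp only [acceleration, rotPair, cross_rot, inner_rot, rot_two, rot_sub, rot_smul]

theorem hasDerivWithinAt_rotPair {Ω : ℝ} {x : ℝ → E3 × E3} {x' : E3 × E3} {s : Set ℝ} {t : ℝ}
    (h : HasDerivWithinAt x x' s t) :
    HasDerivWithinAt (fun t => rotPair (Ω * t) (x t))
      (rotPair (Ω * t) (x'.1 + Ω • turn (x t).1, x'.2 + Ω • turn (x t).2)) s t := by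
  have h1 : HasDerivWithinAt (fun t => (x t).1) x'.1 s t :=
    (ContinuousLinearMap.fst ℝ E3 E3).hasFDerivAt.comp_hasDerivWithinAt t h
  have h2 : HasDerivWithinAt (fun t => (x t).2) x'.2 s t :=
    (ContinuousLinearMap.snd ℝ E3 E3).hasFDerivAt.comp_hasDerivWithinAt t h
  exact (hasDerivWithinAt_rot h1).prodMk (hasDerivWithinAt_rot h2)

/-! ### The magnetic field in a rotating frame -/

/-- The geodesic field, in a frame that rotates with angular velocity `Ω`, extended to pairs of
vectors in such a way that the inner products of the pair are conserved. -/
def rotatingField (μ Ω : ℝ) (x : E3 × E3) : E3 × E3 :=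
  (⟪x.1, x.1⟫_ℝ • x.2 - ⟪x.1, x.2⟫_ℝ • x.1 - Ω • turn x.1,
    ⟪x.1, x.2⟫_ℝ • x.2 - ⟪x.2, x.2⟫_ℝ • x.1 + fieldStrength μ (x.1 2) • cross x.1 x.2 -
      Ω • turn x.2)

theorem rotatingField_of_mem (μ Ω : ℝ) {x : E3 × E3} (hx : x ∈ tangentBundle) :
    rotatingField μ Ω x = (x.2 - Ω • turn x.1, acceleration μ x - Ω • turn x.2) := by
  obtain ⟨h1, h2⟩ := hx
  simp only [rotatingField, acceleration, h1, h2, one_smul, zero_smul, sub_zero, zero_sub]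
  congr 2
  abel

theorem contDiff_turn : ContDiff ℝ ∞ turn := by
  rw [contDiff_euclidean]
  intro i
  fin_cases i
  · change ContDiff ℝ ∞ fun x : E3 => -x 1
    fun_prop
  · change ContDiff ℝ ∞ fun x : E3 => x 0
    fun_prop
  · exact contDiff_const

theorem contDiff_cross : ContDiff ℝ ∞ fun x : E3 × E3 => cross x.1 x.2 := by
  rw [contDiff_euclidean]
  intro i
  fin_cases i
  · change ContDiff ℝ ∞ fun x : E3 × E3 => x.1 1 * x.2 2 - x.1 2 * x.2 1
    fun_prop
  · change ContDiff ℝ ∞ fun x : E3 × E3 => x.1 2 * x.2 0 - x.1 0 * x.2 2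
    fun_prop
  · change ContDiff ℝ ∞ fun x : E3 × E3 => x.1 0 * x.2 1 - x.1 1 * x.2 0
    fun_prop

theorem contDiff_rotatingField (μ Ω : ℝ) : ContDiff ℝ ∞ (rotatingField μ Ω) := by
  have h1 : ContDiff ℝ ∞ fun x : E3 × E3 => turn x.1 := contDiff_turn.comp contDiff_fst
  have h2 : ContDiff ℝ ∞ fun x : E3 × E3 => turn x.2 := contDiff_turn.comp contDiff_snd
  have h3 := contDiff_cross
  have i1 : ContDiff ℝ ∞ fun x : E3 × E3 => ⟪x.1, x.1⟫_ℝ := contDiff_fst.inner ℝ contDiff_fst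
  have i2 : ContDiff ℝ ∞ fun x : E3 × E3 => ⟪x.1, x.2⟫_ℝ := contDiff_fst.inner ℝ contDiff_snd
  have i3 : ContDiff ℝ ∞ fun x : E3 × E3 => ⟪x.2, x.2⟫_ℝ := contDiff_snd.inner ℝ contDiff_snd
  have h4 : ContDiff ℝ ∞ fun x : E3 × E3 => fieldStrength μ (x.1 2) := by
    unfold fieldStrength
    fun_prop
  exact (((i1.smul contDiff_snd).sub (i2.smul contDiff_fst)).sub (h1.const_smul Ω)).prodMk
    ((((i2.smul contDiff_snd).sub (i3.smul contDiff_fst)).add (h4.smul h3)).sub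
      (h2.const_smul Ω))

/-- A cutoff function which is `1` on the ball of radius `3`. -/
def cutoff : ContDiffBump (0 : E3 × E3) := ⟨3, 4, by norm_num, by norm_num⟩

/-- The geodesic field in the rotating frame, cut off outside of a large ball. -/
def cutoffField (μ Ω : ℝ) (x : E3 × E3) : E3 × E3 := cutoff x • rotatingField μ Ω x

theorem cutoffField_of_norm_le (μ Ω : ℝ) {x : E3 × E3} (hx : ‖x‖ ≤ 3) :
    cutoffField μ Ω x = rotatingField μ Ω x := by
  rw [cutoffField, cutoff.one_of_mem_closedBall (mem_closedBall_zero_iff.2 hx), one_smul]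

/-- Compact support makes the smooth field bounded and globally Lipschitz, as the flow lemmas
require. -/
theorem exists_bounds_cutoffField (μ Ω : ℝ) :
    ∃ K L : NNReal, LipschitzWith K (cutoffField μ Ω) ∧ ∀ x, ‖cutoffField μ Ω x‖ ≤ L := by
  have hs : HasCompactSupport (cutoffField μ Ω) := cutoff.hasCompactSupport.smul_right
  have hc : ContDiff ℝ ∞ (cutoffField μ Ω) := cutoff.contDiff.smul (contDiff_rotatingField μ Ω)
  obtain ⟨K, hK⟩ := hc.lipschitzWith_of_hasCompactSupport hs (by simp)
  obtain ⟨C, hC⟩ := hc.continuous.bounded_above_of_compact_support hs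
  exact ⟨K, ⟨max C 0, le_max_right _ _⟩, hK, fun x => (hC x).trans (le_max_left _ _)⟩

/-- The inner products of a solution of the cut off equation are conserved. -/
theorem SolvesOn.inner_eq_inner {μ Ω T : ℝ} {x : ℝ → E3 × E3}
    (h : SolvesOn (cutoffField μ Ω) T x) {t : ℝ} (ht : t ∈ Icc 0 T) :
    ⟪(x t).1, (x t).1⟫_ℝ = ⟪(x 0).1, (x 0).1⟫_ℝ ∧ ⟪(x t).1, (x t).2⟫_ℝ = ⟪(x 0).1, (x 0).2⟫_ℝ ∧
      ⟪(x t).2, (x t).2⟫_ℝ = ⟪(x 0).2, (x 0).2⟫_ℝ := by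
  have h1 : ∀ t ∈ Icc 0 T, HasDerivWithinAt (fun t => (x t).1) (cutoffField μ Ω (x t)).1 (Icc 0 T) t :=
    fun t ht => (ContinuousLinearMap.fst ℝ E3 E3).hasFDerivAt.comp_hasDerivWithinAt t (h t ht)
  have h2 : ∀ t ∈ Icc 0 T, HasDerivWithinAt (fun t => (x t).2) (cutoffField μ Ω (x t)).2 (Icc 0 T) t :=
    fun t ht => (ContinuousLinearMap.snd ℝ E3 E3).hasFDerivAt.comp_hasDerivWithinAt t (h t ht)
  have const : ∀ F : ℝ → ℝ, (∀ t ∈ Icc 0 T, HasDerivWithinAt F 0 (Icc 0 T) t) →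
      ∀ t ∈ Icc 0 T, F t = F 0 := fun F hF =>
    constant_of_has_deriv_right_zero (fun t ht => (hF t ht).continuousWithinAt) fun t ht =>
      (hF t (Ico_subset_Icc_self ht)).mono_of_mem_nhdsWithin (Icc_mem_nhdsGE_of_mem ht)
  refine ⟨const _ (fun t ht => ((h1 t ht).inner ℝ (h1 t ht)).congr_deriv ?_) t ht,
    const _ (fun t ht => ((h1 t ht).inner ℝ (h2 t ht)).congr_deriv ?_) t ht,
    const _ (fun t ht => ((h2 t ht).inner ℝ (h2 t ht)).congr_deriv ?_) t ht⟩ <;>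
  · simp only [cutoffField, rotatingField, Prod.smul_fst, Prod.smul_snd, inner_eq, PiLp.smul_apply,
      PiLp.sub_apply, PiLp.add_apply, turn_zero, turn_one, turn_two, cross_zero, cross_one,
      cross_two, smul_eq_mul]
    ring

theorem norm_le_three {x : E3 × E3} (h1 : ⟪x.1, x.1⟫_ℝ ≤ 9) (h2 : ⟪x.2, x.2⟫_ℝ ≤ 9) :
    ‖x‖ ≤ 3 := by
  rw [real_inner_self_eq_norm_sq] at h1 h2
  rw [Prod.norm_def]
  exact max_le (by nlinarith [norm_nonneg x.1]) (by nlinarith [norm_nonneg x.2])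

/-- Solutions of the cut off equation that start on the energy levels at most `9 / 2` are
magnetic geodesics in the rotating frame. -/
theorem SolvesOn.isIntegralCurveOn {μ Ω T : ℝ} {x : ℝ → E3 × E3}
    (h : SolvesOn (cutoffField μ Ω) T x) (hx : x 0 ∈ tangentBundle)
    (hE : ⟪(x 0).2, (x 0).2⟫_ℝ ≤ 9) :
    IsIntegralCurveOn roundMetric (magneticPotential μ)
      (fun t => toPhase (rotPair (Ω * t) (x t))) (Icc 0 T) := by
  rw [isIntegralCurveOn_iff]
  intro t ht
  obtain ⟨e1, e2, e3⟩ := h.inner_eq_inner ht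
  have hm : x t ∈ tangentBundle := ⟨e1.trans hx.1, e2.trans hx.2⟩
  refine ⟨rotPair_mem hm, ?_⟩
  have hd := h t ht
  rw [cutoffField_of_norm_le μ Ω (norm_le_three (by rw [hm.1]; norm_num) (by rw [e3]; exact hE)),
    rotatingField_of_mem μ Ω hm] at hd
  refine (hasDerivWithinAt_rotPair hd).congr_deriv ?_
  rw [acceleration_rot]
  simp [rotPair]

/-- Magnetic geodesics solve the cut off equation in the rotating frame. -/
theorem solvesOn_of_isIntegralCurveOn {μ Ω T : ℝ} {x : ℝ → E3 × E3}
    (h : IsIntegralCurveOn roundMetric (magneticPotential μ) (fun t => toPhase (x t)) (Icc 0 T))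
    (hE : ∀ t ∈ Icc 0 T, ⟪(x t).2, (x t).2⟫_ℝ ≤ 9) :
    SolvesOn (cutoffField μ Ω) T fun t => rotPair (-Ω * t) (x t) := by
  rw [isIntegralCurveOn_iff] at h
  intro t ht
  obtain ⟨hm, hd⟩ := h t ht
  have hm' := rotPair_mem (θ := -Ω * t) hm
  rw [cutoffField_of_norm_le μ Ω (norm_le_three (by rw [hm'.1]; norm_num)
    (by simpa only [rotPair, inner_rot] using hE t ht)), rotatingField_of_mem μ Ω hm']
  refine (hasDerivWithinAt_rotPair hd).congr_deriv ?_
  rw [acceleration_rot]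
  simp only [rotPair, turn_rot, neg_smul, ← sub_eq_add_neg, rot_sub, rot_smul]

/-! ### Linearization -/

/-- The derivative of the rotating field at `x` in the direction of `ξ`. -/
def linearizedField (μ Ω : ℝ) (x ξ : E3 × E3) : E3 × E3 :=
  ((2 * ⟪x.1, ξ.1⟫_ℝ) • x.2 + ⟪x.1, x.1⟫_ℝ • ξ.2 - (⟪x.1, ξ.2⟫_ℝ + ⟪ξ.1, x.2⟫_ℝ) • x.1 -
      ⟪x.1, x.2⟫_ℝ • ξ.1 - Ω • turn ξ.1,
    (⟪x.1, ξ.2⟫_ℝ + ⟪ξ.1, x.2⟫_ℝ) • x.2 + ⟪x.1, x.2⟫_ℝ • ξ.2 - (2 * ⟪x.2, ξ.2⟫_ℝ) • x.1 -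
      ⟪x.2, x.2⟫_ℝ • ξ.1 + (2 * μ * (6 * x.1 2 ^ 2 - 1) * ξ.1 2) • cross x.1 x.2 +
      fieldStrength μ (x.1 2) • (cross ξ.1 x.2 + cross x.1 ξ.2) - Ω • turn ξ.2)

theorem hasDerivAt_E3 {f : ℝ → E3} {f' : E3} {t : ℝ} :
    HasDerivAt f f' t ↔ ∀ i, HasDerivAt (fun t => f t i) (f' i) t := by
  simp_rw [← hasDerivWithinAt_univ]
  exact hasDerivWithinAt_E3

theorem HasDerivAt.turn {q : ℝ → E3} {q' : E3} {t : ℝ} (hq : HasDerivAt q q' t) :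
    HasDerivAt (fun t => turn (q t)) (turn q') t := by
  rw [hasDerivAt_E3] at *
  intro i
  fin_cases i
  exacts [(hq 1).neg, hq 0, hasDerivAt_const t 0]

theorem HasDerivAt.cross {q v : ℝ → E3} {q' v' : E3} {t : ℝ} (hq : HasDerivAt q q' t)
    (hv : HasDerivAt v v' t) :
    HasDerivAt (fun t => cross (q t) (v t)) (cross q' (v t) + cross (q t) v') t := by
  rw [hasDerivAt_E3] at *
  intro i
  fin_cases i
  · refine (((hq 1).mul (hv 2)).sub ((hq 2).mul (hv 1))).congr_deriv ?_
    simp; ring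
  · refine (((hq 2).mul (hv 0)).sub ((hq 0).mul (hv 2))).congr_deriv ?_
    simp; ring
  · refine (((hq 0).mul (hv 1)).sub ((hq 1).mul (hv 0))).congr_deriv ?_
    simp; ring

theorem hasDerivAt_fieldStrength (μ h : ℝ) :
    HasDerivAt (fieldStrength μ) (2 * μ * (6 * h ^ 2 - 1)) h := by
  refine (((hasDerivAt_id h).const_mul (2 * μ)).fun_mul
    ((((hasDerivAt_id h).fun_pow 2).const_mul 2).sub_const 1)).congr_deriv ?_
  simp; ring

theorem fderiv_rotatingField (μ Ω : ℝ) (x ξ : E3 × E3) :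
    fderiv ℝ (rotatingField μ Ω) x ξ = linearizedField μ Ω x ξ := by
  have hq := hasDerivAt_line x.1 ξ.1
  have hv := hasDerivAt_line x.2 ξ.2
  have hl : HasDerivAt (fun s : ℝ => (x.1 + s • ξ.1, x.2 + s • ξ.2)) ξ 0 := hq.prodMk hv
  have hd : HasFDerivAt (rotatingField μ Ω) (fderiv ℝ (rotatingField μ Ω) x)
      (x.1 + (0 : ℝ) • ξ.1, x.2 + (0 : ℝ) • ξ.2) := by
    rw [zero_smul, zero_smul, add_zero, add_zero]
    exact ((contDiff_rotatingField μ Ω).differentiable (by simp) x).hasFDerivAt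
  refine (hd.comp_hasDerivAt (0 : ℝ) hl).unique ?_
  have h2 := hasDerivAt_E3.1 hq 2
  have hβ : HasDerivAt (fun s : ℝ => fieldStrength μ ((x.1 + s • ξ.1) 2))
      (2 * μ * (6 * (x.1 + (0 : ℝ) • ξ.1) 2 ^ 2 - 1) * ξ.1 2) 0 :=
    (hasDerivAt_fieldStrength μ _).comp (0 : ℝ) h2
  refine ((((((hq.inner ℝ hq).fun_smul hv).fun_sub ((hq.inner ℝ hv).fun_smul hq)).fun_sub
    ((HasDerivAt.turn hq).const_smul Ω)).prodMk
    (((((hq.inner ℝ hv).fun_smul hv).fun_sub ((hv.inner ℝ hv).fun_smul hq)).fun_add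
      (hβ.fun_smul (HasDerivAt.cross hq hv))).fun_sub ((HasDerivAt.turn hv).const_smul Ω)))).congr_deriv ?_
  simp only [zero_smul, add_zero, linearizedField, Prod.mk.injEq, real_inner_comm x.1 ξ.1,
    real_inner_comm x.2 ξ.2]
  constructor <;> module

/-! ### Circles of latitude -/

/-- The starting point of the circle of latitude of radius `r` at height `u`, traversed with
angular velocity `Ω`. -/
def basePoint (r u Ω : ℝ) : E3 × E3 := (!₂[r, 0, u], !₂[0, r * Ω, 0])

/-- The circle of latitude as a curve in phase space. -/
def circleOrbit (r u Ω : ℝ) (t : ℝ) : Phase := toPhase (rotPair (Ω * t) (basePoint r u Ω))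

theorem basePoint_mem {r u Ω : ℝ} (h : r ^ 2 + u ^ 2 = 1) : basePoint r u Ω ∈ tangentBundle := by
  constructor
  · rw [inner_eq]; simp [basePoint]; linarith
  · rw [inner_eq]; simp [basePoint]

theorem inner_basePoint (r u Ω : ℝ) :
    ⟪(basePoint r u Ω).2, (basePoint r u Ω).2⟫_ℝ = r ^ 2 * Ω ^ 2 := by
  rw [inner_eq]; simp [basePoint]; ring

/-- The condition for the circle of latitude to be a magnetic geodesic. -/
def IsMagneticCircle (μ r u Ω : ℝ) : Prop :=
  r ^ 2 + u ^ 2 = 1 ∧ fieldStrength μ u = Ω * u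

/-- In the frame turning with the circle the orbit stands still, so the study of a periodic orbit
becomes that of an equilibrium. -/
theorem rotatingField_basePoint {μ r u Ω : ℝ} (h : IsMagneticCircle μ r u Ω) :
    rotatingField μ Ω (basePoint r u Ω) = 0 := by
  obtain ⟨h1, h2⟩ := h
  rw [rotatingField_of_mem μ Ω (basePoint_mem h1)]
  refine Prod.ext (E3_ext ?_ ?_ ?_) (E3_ext ?_ ?_ ?_)
  · simp [basePoint]
  · simp [basePoint]; ring
  · simp [basePoint]
  · simp only [acceleration, inner_basePoint]
    simp [basePoint, h2]
    linear_combination (-r * Ω ^ 2) * h1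
  · simp [basePoint, acceleration]
  · simp only [acceleration, inner_basePoint]
    simp [basePoint, h2]
    ring

theorem isClosedOrbit_circleOrbit {μ r u Ω T k : ℝ} (h : IsMagneticCircle μ r u Ω) (hT : 0 < T)
    (hΩT : Real.cos (Ω * T) = 1) (hk : r ^ 2 * Ω ^ 2 = 2 * k) :
    IsClosedOrbit roundMetric (magneticPotential μ) k T (circleOrbit r u Ω) where
  period_pos := hT
  periodic := fun t => by
    have hs : Real.sin (Ω * T) = 0 := by
      have := Real.sin_sq_add_cos_sq (Ω * T)
      rw [hΩT] at this
      nlinarith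
    have : ∀ x, rot (Ω * (t + T)) x = rot (Ω * t) x := by
      intro x
      apply E3_ext <;> simp [mul_add, Real.cos_add, Real.sin_add, hΩT, hs]
    simp only [circleOrbit, rotPair, this]
  integral := by
    unfold circleOrbit
    rw [isIntegralCurveOn_iff]
    intro t _
    have hm := basePoint_mem (Ω := Ω) h.1
    refine ⟨rotPair_mem hm, ?_⟩
    refine (hasDerivWithinAt_rotPair (hasDerivWithinAt_const t univ _)).congr_deriv ?_
    have h0 := rotatingField_basePoint h
    rw [rotatingField_of_mem μ Ω hm, Prod.mk_eq_zero, sub_eq_zero, sub_eq_zero] at h0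
    rw [acceleration_rot]
    simp only [rotPair, Prod.fst_zero, Prod.snd_zero, zero_add, ← h0.1, ← h0.2]
  energy := fun t => by
    have hm := rotPair_mem (θ := Ω * t) (basePoint_mem (Ω := Ω) h.1)
    have e : roundMetric.hamiltonian (circleOrbit r u Ω t).1 (circleOrbit r u Ω t).2 = _ :=
      hamiltonian_flat hm.2
    rw [e]
    simp only [inner_rot, inner_basePoint, hk]
    ring

/-- The square of the normal frequency of a circle of latitude of unit speed. -/
def normalFrequency (μ r u Ω : ℝ) : ℝ :=
  1 - 2 * μ * (6 * u ^ 2 - 1) * (r ^ 2 * Ω) + fieldStrength μ u ^ 2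

/-- Here aᵢ and bᵢ are the coordinates of the variations of q and v. The tangency constraints, the
linearized energy and the linearized Clairaut integral are constant and leave an oscillator for the
height a₂, whose periodicity fixes its value. The drift of the longitude a₁ over one period then
determines the time shift τ. -/
theorem linearized_return_aux {μ r u Ω T τ : ℝ} (h : IsMagneticCircle μ r u Ω)
    (hs : r ^ 2 * Ω ^ 2 = 1) (hT : 0 < T)
    (hκ₀ : normalFrequency μ r u Ω ≠ 0) (hκ : normalFrequency μ r u Ω * T ^ 2 < 1)
    {a₀ a₁ a₂ b₀ b₁ b₂ : ℝ → ℝ}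
    (ha₀ : ∀ t, HasDerivAt a₀ (b₀ t - (r * b₀ t + u * b₂ t + r * Ω * a₁ t) * r + Ω * a₁ t) t)
    (ha₁ : ∀ t, HasDerivAt a₁ (2 * (r * a₀ t + u * a₂ t) * (r * Ω) + b₁ t - Ω * a₀ t) t)
    (ha₂ : ∀ t, HasDerivAt a₂ (b₂ t - (r * b₀ t + u * b₂ t + r * Ω * a₁ t) * u) t)
    (hb₀ : ∀ t, HasDerivAt b₀ (-2 * (r * Ω * b₁ t) * r - a₀ t -
        2 * μ * (6 * u ^ 2 - 1) * a₂ t * (u * r * Ω) + Ω * u * (-(a₂ t * (r * Ω)) - u * b₁ t) +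
        Ω * b₁ t) t)
    (hb₁ : ∀ t, HasDerivAt b₁ ((r * b₀ t + u * b₂ t + r * Ω * a₁ t) * (r * Ω) - a₁ t +
        Ω * u * (u * b₀ t - r * b₂ t) - Ω * b₀ t) t)
    (hb₂ : ∀ t, HasDerivAt b₂ (-2 * (r * Ω * b₁ t) * u - a₂ t +
        2 * μ * (6 * u ^ 2 - 1) * a₂ t * (r ^ 2 * Ω) +
        Ω * u * (a₀ t * (r * Ω) + r * b₁ t)) t)
    (h₁ : r * a₀ 0 + u * a₂ 0 = 0) (h₂ : r * b₀ 0 + u * b₂ 0 + r * Ω * a₁ 0 = 0)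
    (haT₁ : a₁ T = a₁ 0 - τ * (Ω * r)) (haT₂ : a₂ T = a₂ 0) (hbT₂ : b₂ T = b₂ 0) :
    normalFrequency μ r u Ω * a₂ 0 = -(u * (r * Ω * b₁ 0)) ∧ b₂ 0 = 0 ∧
      τ * r ^ 2 = -(T * (r ^ 2 * (r * Ω * b₁ 0) + u * a₂ 0)) := by
  obtain ⟨h1, h2⟩ := h
  have const : ∀ F : ℝ → ℝ, (∀ t, HasDerivAt F 0 t) → ∀ t, F t = F 0 := fun F hF t =>
    is_const_of_deriv_eq_zero (fun t => (hF t).differentiableAt) (fun t => (hF t).deriv) t 0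
  -- Linearization of |q|² = 1.
  have c1 : ∀ t, r * a₀ t + u * a₂ t = 0 := fun t =>
    (const (fun t => r * a₀ t + u * a₂ t) (fun t =>
      (((ha₀ t).const_mul r).fun_add ((ha₂ t).const_mul u)).congr_deriv (by
        linear_combination (-(r * b₀ t + u * b₂ t + r * Ω * a₁ t)) * h1)) t).trans h₁
  -- Linearization of ⟪q, v⟫ = 0.
  have c2 : ∀ t, r * b₀ t + u * b₂ t + r * Ω * a₁ t = 0 := fun t =>
    (const (fun t => r * b₀ t + u * b₂ t + r * Ω * a₁ t) (fun t =>
      ((((hb₀ t).const_mul r).fun_add ((hb₂ t).const_mul u)).fun_add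
        ((ha₁ t).const_mul (r * Ω))).congr_deriv (by
          linear_combination (-2 * (r * Ω * b₁ t) + r * Ω ^ 2 * a₀ t) * h1 +
            (2 * (r * a₀ t + u * a₂ t) - r * a₀ t - u * a₂ t) * hs)) t).trans h₂
  -- Linearization of the energy ½|v|².
  have cε : ∀ t, r * Ω * b₁ t = r * Ω * b₁ 0 := const (fun t => r * Ω * b₁ t) fun t =>
    ((hb₁ t).const_mul (r * Ω)).congr_deriv (by
      linear_combination c2 t * (r ^ 2 * Ω ^ 2) + r * Ω ^ 2 * b₀ t * h1 - c2 t +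
        (r * a₁ t * Ω) * hs - (r * b₀ t + u * b₂ t + r * Ω * a₁ t) * hs)
  -- Linearization of the conserved magnetic angular momentum q₀v₁ - q₁v₀ + B(q₂), where B' = β and
  -- β(u) = Ωu.
  have cl : ∀ t, r * Ω * a₀ t + r * b₁ t + Ω * u * a₂ t =
      r * Ω * a₀ 0 + r * b₁ 0 + Ω * u * a₂ 0 :=
    const (fun t => r * Ω * a₀ t + r * b₁ t + Ω * u * a₂ t) fun t =>
      ((((ha₀ t).const_mul (r * Ω)).fun_add ((hb₁ t).const_mul r)).fun_add
        ((ha₂ t).const_mul (Ω * u))).congr_deriv (by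
          linear_combination (-(r * Ω ^ 2 * a₁ t + Ω * u * b₂ t)) * h1 + (r * a₁ t) * hs)
  set κ := normalFrequency μ r u Ω with hκd
  have key := eq_zero_of_periodic_oscillator (f := a₂) (g := b₂) (κ := κ)
    (K := -2 * (r * Ω * b₁ 0) * u + Ω * u * (r * Ω * a₀ 0 + r * b₁ 0 + Ω * u * a₂ 0)) hT hκ
    (fun t => (ha₂ t).congr_deriv (by rw [c2 t]; ring))
    (fun t => (hb₂ t).congr_deriv (by
      rw [hκd, normalFrequency, h2]
      linear_combination (-2 * u) * cε t + Ω * u * cl t)) haT₂ hbT₂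
  obtain ⟨k1, k2⟩ := key
  set K := -2 * (r * Ω * b₁ 0) * u + Ω * u * (r * Ω * a₀ 0 + r * b₁ 0 + Ω * u * a₂ 0) with hK
  have hη : κ * a₂ 0 = -(u * (r * Ω * b₁ 0)) := by
    linear_combination -k2 + hK + Ω ^ 2 * u * h₁
  refine ⟨hη, k1, ?_⟩
  have hr : r * Ω ≠ 0 := fun h0 => by
    have : (r * Ω) ^ 2 = 1 := by linarith [mul_pow r Ω 2]
    rw [h0] at this
    norm_num at this
  have hb : ∀ t, b₁ t = b₁ 0 := fun t => mul_left_cancel₀ hr (cε t)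
  -- The summand Ωu b₂ cancels the term in a₂ from κr a₁', so this combination has constant slope
  -- and the height is not needed at intermediate times.
  have hF := const (fun t => κ * r * a₁ t + Ω * u * b₂ t - (κ * r * b₁ 0 + Ω * u * K) * t)
    (fun t => (((((ha₁ t).const_mul (κ * r)).fun_add ((hb₂ t).const_mul (Ω * u)))).fun_sub
      ((hasDerivAt_id t).const_mul _)).congr_deriv (by
        rw [hb t, hK, hκd, normalFrequency, h2]
        linear_combination ((1 - 2 * μ * (6 * u ^ 2 - 1) * (r ^ 2 * Ω) + (Ω * u) ^ 2) *
          (2 * r ^ 2 * Ω - Ω)) * c1 t + Ω * u * (Ω * u * cl t) - Ω ^ 2 * u ^ 2 * r * hb t)) T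
  simp only [haT₁, hbT₂, mul_zero, sub_zero] at hF
  have h3 : κ * (τ * Ω * r ^ 2 + T * (r * b₁ 0 + Ω * u * a₂ 0)) = 0 := by
    linear_combination -hF - T * Ω * u * k2
  have h4 := (mul_eq_zero.1 h3).resolve_left hκ₀
  linear_combination (Ω * r ^ 2) * h4 - (τ * r ^ 2 + T * u * a₂ 0) * hs

/-- Solutions of the linearized equation along a circle of latitude that return to their starting
point up to a time shift. -/
theorem linearized_return {μ r u Ω T τ : ℝ} (h : IsMagneticCircle μ r u Ω)
    (hs : r ^ 2 * Ω ^ 2 = 1) (hT : 0 < T)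
    (hκ₀ : normalFrequency μ r u Ω ≠ 0) (hκ : normalFrequency μ r u Ω * T ^ 2 < 1)
    {ξ : ℝ → E3 × E3} (hξ : ∀ t, HasDerivAt ξ (linearizedField μ Ω (basePoint r u Ω) (ξ t)) t)
    (h₁ : ⟪(basePoint r u Ω).1, (ξ 0).1⟫_ℝ = 0)
    (h₂ : ⟪(basePoint r u Ω).1, (ξ 0).2⟫_ℝ + ⟪(ξ 0).1, (basePoint r u Ω).2⟫_ℝ = 0)
    (hret : ξ T = ξ 0 - τ • (Ω • turn (basePoint r u Ω).1, Ω • turn (basePoint r u Ω).2)) :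
    normalFrequency μ r u Ω * (ξ 0).1 2 = -(u * (r * Ω * (ξ 0).2 1)) ∧ (ξ 0).2 2 = 0 ∧
      τ * r ^ 2 = -(T * (r ^ 2 * (r * Ω * (ξ 0).2 1) + u * (ξ 0).1 2)) := by
  have hq : ∀ t, HasDerivAt (fun t => (ξ t).1) (linearizedField μ Ω (basePoint r u Ω) (ξ t)).1 t :=
    fun t => (ContinuousLinearMap.fst ℝ E3 E3).hasFDerivAt.comp_hasDerivAt t (hξ t)
  have hv : ∀ t, HasDerivAt (fun t => (ξ t).2) (linearizedField μ Ω (basePoint r u Ω) (ξ t)).2 t :=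
    fun t => (ContinuousLinearMap.snd ℝ E3 E3).hasFDerivAt.comp_hasDerivAt t (hξ t)
  simp only [hasDerivAt_E3] at hq hv
  have hn1 : ⟪(basePoint r u Ω).1, (basePoint r u Ω).1⟫_ℝ = 1 := (basePoint_mem h.1).1
  have hn2 : ⟪(basePoint r u Ω).1, (basePoint r u Ω).2⟫_ℝ = 0 := (basePoint_mem h.1).2
  have hn3 : ⟪(basePoint r u Ω).2, (basePoint r u Ω).2⟫_ℝ = 1 := (inner_basePoint r u Ω).trans hs
  have h2 := h.2
  refine linearized_return_aux h hs hT hκ₀ hκ (a₀ := fun t => (ξ t).1 0) (a₁ := fun t => (ξ t).1 1)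
    (a₂ := fun t => (ξ t).1 2) (b₀ := fun t => (ξ t).2 0) (b₁ := fun t => (ξ t).2 1)
    (b₂ := fun t => (ξ t).2 2) (fun t => (hq t 0).congr_deriv ?_) (fun t => (hq t 1).congr_deriv ?_)
    (fun t => (hq t 2).congr_deriv ?_) (fun t => (hv t 0).congr_deriv ?_)
    (fun t => (hv t 1).congr_deriv ?_) (fun t => (hv t 2).congr_deriv ?_) ?_ ?_ ?_ ?_ ?_
  iterate 6
    simp only [linearizedField, hn1, hn2, hn3]
    simp only [inner_eq]
    simp [basePoint, h2, -mul_eq_mul_left_iff, -mul_eq_mul_right_iff]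
    ring_nf
  · rw [inner_eq] at h₁
    simpa [basePoint] using h₁
  · rw [inner_eq, inner_eq] at h₂
    simp [basePoint] at h₂
    linarith
  · rw [hret]; simp [basePoint]
  · rw [hret]; simp
  · rw [hret]; simp

/-! ### Strong non-degeneracy -/

/-- The linearization of the rotating field at the starting point of a circle of latitude. -/
def generator (μ r u Ω : ℝ) : (E3 × E3) →L[ℝ] (E3 × E3) :=
  fderiv ℝ (rotatingField μ Ω) (basePoint r u Ω)

/-- The infinitesimal rotation of the starting point of a circle of latitude. -/
def turnBase (r u Ω : ℝ) : E3 × E3 := (turn (basePoint r u Ω).1, turn (basePoint r u Ω).2)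

theorem norm_basePoint_lt {r u Ω : ℝ} (h : r ^ 2 + u ^ 2 = 1) (hs : r ^ 2 * Ω ^ 2 = 1) :
    ‖basePoint r u Ω‖ < 3 := by
  have h1 := (basePoint_mem (Ω := Ω) h).1
  have h2 := inner_basePoint r u Ω
  rw [hs, real_inner_self_eq_norm_sq] at h2
  rw [real_inner_self_eq_norm_sq] at h1
  rw [Prod.norm_def]
  exact max_lt (by nlinarith [norm_nonneg (basePoint r u Ω).1])
    (by nlinarith [norm_nonneg (basePoint r u Ω).2])

theorem cutoffField_basePoint {μ r u Ω : ℝ} (h : IsMagneticCircle μ r u Ω)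
    (hs : r ^ 2 * Ω ^ 2 = 1) : cutoffField μ Ω (basePoint r u Ω) = 0 := by
  rw [cutoffField_of_norm_le μ Ω (norm_basePoint_lt h.1 hs).le, rotatingField_basePoint h]

theorem hasFDerivAt_cutoffField {μ r u Ω : ℝ} (h : IsMagneticCircle μ r u Ω)
    (hs : r ^ 2 * Ω ^ 2 = 1) :
    HasFDerivAt (cutoffField μ Ω) (generator μ r u Ω) (basePoint r u Ω) := by
  have hd : HasFDerivAt (rotatingField μ Ω) (generator μ r u Ω) (basePoint r u Ω) :=
    ((contDiff_rotatingField μ Ω).differentiable (by simp) _).hasFDerivAt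
  refine hd.congr_of_eventuallyEq ?_
  have : ∀ᶠ x in 𝓝 (basePoint r u Ω), ‖x‖ < 3 :=
    continuous_norm.continuousAt.eventually_lt continuousAt_const (norm_basePoint_lt h.1 hs)
  filter_upwards [this] with x hx using cutoffField_of_norm_le μ Ω hx.le

theorem hasDerivAt_exp_generator (μ r u Ω : ℝ) (ζ : E3 × E3) (t : ℝ) :
    HasDerivAt (fun t : ℝ => NormedSpace.exp (t • generator μ r u Ω) ζ)
      (linearizedField μ Ω (basePoint r u Ω) (NormedSpace.exp (t • generator μ r u Ω) ζ)) t := by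
  have h := (hasDerivAt_exp_smul_const' (generator μ r u Ω) t).clm_apply (hasDerivAt_const t ζ)
  refine h.congr_deriv ?_
  rw [← fderiv_rotatingField]
  simp [generator]

theorem exp_smul_apply_of_apply_eq_zero {E : Type*} [NormedAddCommGroup E] [NormedSpace ℝ E]
    [CompleteSpace E] {A : E →L[ℝ] E} {v : E} (h : A v = 0) (t : ℝ) :
    NormedSpace.exp (t • A) v = v := by
  have hd : ∀ t : ℝ, HasDerivAt (fun t : ℝ => NormedSpace.exp (t • A) v) 0 t := fun t =>
    ((hasDerivAt_exp_smul_const A t).clm_apply (hasDerivAt_const t v)).congr_deriv (by simp [h])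
  have := is_const_of_deriv_eq_zero (fun t => (hd t).differentiableAt) (fun t => (hd t).deriv) t 0
  simpa using this

theorem exp_zero_smul_apply {E : Type*} [NormedAddCommGroup E] [NormedSpace ℝ E]
    [CompleteSpace E] (A : E →L[ℝ] E) (v : E) : NormedSpace.exp ((0 : ℝ) • A) v = v := by
  simp

/-- This reflects the rotational symmetry: all rotations of the base point are equilibria of the
rotating field. -/
theorem generator_turnBase {μ r u Ω : ℝ} (h : IsMagneticCircle μ r u Ω) :
    generator μ r u Ω (turnBase r u Ω) = 0 := by
  obtain ⟨h1, h2⟩ := h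
  rw [generator, fderiv_rotatingField]
  refine Prod.ext (E3_ext ?_ ?_ ?_) (E3_ext ?_ ?_ ?_) <;>
  · simp only [linearizedField, turnBase, inner_eq]
    simp [basePoint, h2, -mul_eq_mul_left_iff, -mul_eq_mul_right_iff]
    try first
      | linear_combination (-(Ω * r)) * h1
      | linear_combination (-(Ω ^ 2 * r)) * h1
      | ring

theorem rotPair_of_cos_eq_one {θ : ℝ} (h : Real.cos θ = 1) (x : E3 × E3) : rotPair θ x = x := by
  simp only [rotPair, rot_of_cos_eq_one h]

theorem circleOrbit_zero (r u Ω : ℝ) : circleOrbit r u Ω 0 = toPhase (basePoint r u Ω) := by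
  rw [circleOrbit, mul_zero, rotPair_of_cos_eq_one Real.cos_zero]

/-- A fixed vector of exp(TA) is a linearized return without time shift. `linearized_return` then
gives two linear equations for the height and energy variations, of determinant r²κ - u² up to sign;
when it is non-zero only the direction of the orbit survives. -/
theorem stronglyNondegenerate_circleOrbit {μ r u Ω T : ℝ} (h : IsMagneticCircle μ r u Ω)
    (hs : r ^ 2 * Ω ^ 2 = 1) (hT : 0 < T) (hΩT : Real.cos (Ω * T) = 1)
    (hκ₀ : normalFrequency μ r u Ω ≠ 0) (hκ : normalFrequency μ r u Ω * T ^ 2 < 1)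
    (hnd : r ^ 2 * normalFrequency μ r u Ω ≠ u ^ 2) :
    StronglyNondegenerate roundMetric (magneticPotential μ) T (circleOrbit r u Ω) := by
  obtain ⟨K, L, hK, hL⟩ := exists_bounds_cutoffField μ Ω
  set B := basePoint r u Ω with hB
  have hB0 : cutoffField μ Ω B = 0 := cutoffField_basePoint h hs
  -- The solution through B is prescribed to be constant, so that the chosen time T map fixes B
  -- without an appeal to uniqueness.
  have hex : ∀ p : E3 × E3, ∃ x : ℝ → E3 × E3, x 0 = p ∧ SolvesOn (cutoffField μ Ω) T x ∧
      (p = B → x T = B) := by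
    intro p
    by_cases hp : p = B
    · refine ⟨fun _ => B, hp.symm, fun t _ => ?_, fun _ => rfl⟩
      simp only [hB0]
      exact hasDerivWithinAt_const _ _ _
    · obtain ⟨x, hx0, hx⟩ := exists_solvesOn hK hL hT.le p
      exact ⟨x, hx0, hx, fun h => absurd h hp⟩
  choose c hc0 hc hcB using hex
  set A := generator μ r u Ω with hA
  have hΨ : HasFDerivWithinAt (fun p => c p T) (NormedSpace.exp (T • A)) univ B :=
    hasFDerivWithinAt_flow hK hB0 (hasFDerivAt_cutoffField h hs) hT.le
      (fun x _ => ⟨c x, hc x, hc0 x, rfl⟩) (hcB B rfl)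
  rw [hasFDerivWithinAt_univ] at hΨ
  have hr : r ≠ 0 := by
    rintro rfl
    norm_num at hs
  refine ⟨fun x => toPhase (c (toPhase.symm x) T),
    (toPhase : (E3 × E3) →L[ℝ] Phase).comp ((NormedSpace.exp (T • A)).comp
      (toPhase.symm : Phase →L[ℝ] (E3 × E3))), ?_, ?_, ?_⟩
  · rw [circleOrbit_zero]
    have hcont : ContinuousAt (fun x : Phase => ⟪(toPhase.symm x).2, (toPhase.symm x).2⟫_ℝ)
        (toPhase B) := by fun_prop
    have hlt : ∀ᶠ x in 𝓝 (toPhase B), ⟪(toPhase.symm x).2, (toPhase.symm x).2⟫_ℝ < 9 := by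
      refine hcont.eventually_lt continuousAt_const ?_
      rw [ContinuousLinearEquiv.symm_apply_apply, hB, inner_basePoint, hs]
      norm_num
    filter_upwards [eventually_mem_nhdsWithin, hlt.filter_mono nhdsWithin_le_nhds] with x hx hx9
    obtain ⟨p, rfl⟩ := toPhase.surjective x
    rw [ContinuousLinearEquiv.symm_apply_apply] at hx9 ⊢
    refine ⟨_, (hc p).isIntegralCurveOn (by rwa [hc0, ← toPhase_mem_cotangentBundle])
      (by rw [hc0]; exact hx9.le), ?_, ?_⟩
    · simp only [mul_zero, rotPair_of_cos_eq_one Real.cos_zero, hc0]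
    · simp only [rotPair_of_cos_eq_one hΩT]
  · rw [circleOrbit_zero]
    refine HasFDerivAt.hasFDerivWithinAt ?_
    rw [← ContinuousLinearEquiv.symm_apply_apply toPhase B] at hΨ
    exact toPhase.hasFDerivAt.comp _ (hΨ.comp (toPhase B) toPhase.symm.hasFDerivAt)
  · have hspan : phaseTangent (circleOrbit r u Ω 0) ⊓ LinearMap.ker
        (((toPhase : (E3 × E3) →L[ℝ] Phase).comp ((NormedSpace.exp (T • A)).comp
          (toPhase.symm : Phase →L[ℝ] (E3 × E3)))).toLinearMap - LinearMap.id) =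
        Submodule.span ℝ {toPhase (turnBase r u Ω)} := by
      ext ξ
      obtain ⟨ζ, rfl⟩ := toPhase.surjective ξ
      have hker : toPhase ζ ∈ LinearMap.ker
          (((toPhase : (E3 × E3) →L[ℝ] Phase).comp ((NormedSpace.exp (T • A)).comp
            (toPhase.symm : Phase →L[ℝ] (E3 × E3)))).toLinearMap - LinearMap.id) ↔
          NormedSpace.exp (T • A) ζ = ζ := by
        rw [LinearMap.mem_ker, LinearMap.sub_apply, sub_eq_zero]
        change toPhase (NormedSpace.exp (T • A) (toPhase.symm (toPhase ζ))) = toPhase ζ ↔ _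
        rw [ContinuousLinearEquiv.symm_apply_apply, toPhase.injective.eq_iff]
      rw [Submodule.mem_inf, hker, circleOrbit_zero, toPhase_mem_phaseTangent,
        Submodule.mem_span_singleton]
      constructor
      · rintro ⟨⟨ht1, ht2⟩, hfix⟩
        obtain ⟨e1, e2, e3⟩ := linearized_return (τ := 0) h hs hT hκ₀ hκ
          (hasDerivAt_exp_generator μ r u Ω ζ) (by rwa [exp_zero_smul_apply])
          (by rwa [exp_zero_smul_apply]) (by rw [← hA, hfix, exp_zero_smul_apply]; simp)
        rw [exp_zero_smul_apply] at e1 e2 e3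
        rw [inner_eq] at ht1
        rw [inner_eq, inner_eq] at ht2
        simp [basePoint] at ht1 ht2
        have e4 : r ^ 2 * (r * Ω * ζ.2 1) + u * ζ.1 2 = 0 := by
          have : T * (r ^ 2 * (r * Ω * ζ.2 1) + u * ζ.1 2) = 0 := by linarith
          exact (mul_eq_zero.1 this).resolve_left hT.ne'
        have hrΩ : r * Ω ≠ 0 := fun h0 => by
          have : (r * Ω) ^ 2 = 1 := by linarith [mul_pow r Ω 2]
          rw [h0] at this
          norm_num at this
        -- Eliminating the height between `e1` and `e4` leaves (r²κ - u²) times the energy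
        -- variation.
        have e5 : ζ.2 1 = 0 := by
          have : (r ^ 2 * normalFrequency μ r u Ω - u ^ 2) * (r * Ω * ζ.2 1) = 0 := by
            linear_combination normalFrequency μ r u Ω * e4 - u * e1
          exact (mul_eq_zero.1 ((mul_eq_zero.1 this).resolve_left (sub_ne_zero.2 hnd))).resolve_left hrΩ
        have e6 : ζ.1 2 = 0 := by
          rw [e5, mul_zero, mul_zero, neg_zero] at e1
          exact (mul_eq_zero.1 e1).resolve_left hκ₀
        have e7 : ζ.1 0 = 0 := by
          rw [e6, mul_zero, add_zero] at ht1
          exact (mul_eq_zero.1 ht1).resolve_left hr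
        have e8 : ζ.2 0 = -(Ω * ζ.1 1) := by
          refine mul_left_cancel₀ hr ?_
          rw [e2] at ht2
          linarith
        refine ⟨ζ.1 1 / r, ?_⟩
        rw [← map_smul]
        congr 1
        refine Prod.ext (E3_ext ?_ ?_ ?_) (E3_ext ?_ ?_ ?_)
        · simp [turnBase, basePoint, e7]
        · simp [turnBase, basePoint, hr]
        · simp [turnBase, e6]
        · simp [turnBase, basePoint, e8]; field_simp
        · simp [turnBase, basePoint, e5]
        · simp [turnBase, e2]
      · rintro ⟨a, ha⟩
        rw [← map_smul, toPhase.injective.eq_iff] at ha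
        subst ha
        refine ⟨⟨?_, ?_⟩, ?_⟩
        · rw [inner_eq]; simp [turnBase, basePoint]
        · rw [inner_eq, inner_eq]; simp [turnBase, basePoint]; ring
        · rw [map_smul, exp_smul_apply_of_apply_eq_zero (generator_turnBase h)]
    rw [hspan]
    refine finrank_span_singleton fun h0 => hr ?_
    rw [map_eq_zero_iff _ toPhase.injective, Prod.ext_iff] at h0
    have := congrArg (fun x : E3 => x 1) h0.1
    simpa [turnBase, basePoint] using this

/-! ### Orbit cylinders -/

/-- The derivative of the period in an orbit cylinder about a circle of latitude. -/
theorem OrbitCylinder.deriv_period_eq {μ r u Ω T : ℝ} (h : IsMagneticCircle μ r u Ω)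
    (hs : r ^ 2 * Ω ^ 2 = 1) (hT : 0 < T) (hΩT : Real.cos (Ω * T) = 1)
    (hκ₀ : normalFrequency μ r u Ω ≠ 0) (hκ : normalFrequency μ r u Ω * T ^ 2 < 1)
    (O : OrbitCylinder roundMetric (magneticPotential μ) (1 / 2) T (circleOrbit r u Ω)) :
    r ^ 2 * normalFrequency μ r u Ω * deriv O.period (1 / 2) =
      T * (u ^ 2 - r ^ 2 * normalFrequency μ r u Ω) := by
  obtain ⟨K, L, hK, -⟩ := exists_bounds_cutoffField μ Ω
  set B := basePoint r u Ω with hB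
  have hΩ : -Ω * T = -(Ω * T) := neg_mul _ _
  have hmem : Ioo (1 / 2 - O.ε) (1 / 2 + O.ε) ∈ 𝓝 (1 / 2 : ℝ) :=
    Ioo_mem_nhds (by linarith [O.ε_pos]) (by linarith [O.ε_pos])
  set x : ℝ → ℝ → E3 × E3 := fun e t => toPhase.symm (O.orbit e t) with hx
  have hxo : ∀ e, O.orbit e = fun t => toPhase (x e t) := fun e => by
    funext t
    exact (toPhase.apply_symm_apply _).symm
  have hxB : ∀ t, x (1 / 2) t = rotPair (Ω * t) B := fun t => by
    simp only [hx, O.orbit_center, circleOrbit, ContinuousLinearEquiv.symm_apply_apply, hB]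
  have hmemT : ∀ e ∈ Ioo (1 / 2 - O.ε) (1 / 2 + O.ε), ∀ t, x e t ∈ tangentBundle ∧
      ⟪(x e t).2, (x e t).2⟫_ℝ = 2 * e := by
    intro e he t
    have hc := O.closed e he
    have h1 := (hc.integral t (mem_univ t)).1
    have h2 := hc.energy t
    rw [hxo e] at h1 h2
    rw [toPhase_mem_cotangentBundle] at h1
    have h3 : roundMetric.hamiltonian (toPhase (x e t)).1 (toPhase (x e t)).2 =
        1 / 2 * ⟪(x e t).2, (x e t).2⟫_ℝ :=
      hamiltonian_flat h1.2
    refine ⟨h1, ?_⟩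
    simp only at h2
    rw [h3] at h2
    linarith
  have hsmooth : ∀ t, HasFDerivAt (fun z : ℝ × ℝ => x z.1 z.2)
      (fderiv ℝ (fun z : ℝ × ℝ => x z.1 z.2) (1 / 2, t)) (1 / 2, t) := by
    intro t
    have h1 : ContDiffAt ℝ ∞ (fun z : ℝ × ℝ => O.orbit z.1 z.2) (1 / 2, t) :=
      O.smooth_orbit.contDiffAt (prod_mem_nhds hmem univ_mem)
    exact ((toPhase.symm.contDiff.contDiffAt.comp _ h1).differentiableAt (by simp)).hasFDerivAt
  set DZ := fun t => fderiv ℝ (fun z : ℝ × ℝ => x z.1 z.2) (1 / 2, t) with hDZ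
  have hde : ∀ t, HasDerivAt (fun e => x e t) (DZ t (1, 0)) (1 / 2) := by
    intro t
    have hp : HasDerivAt (fun e : ℝ => (e, t)) ((1 : ℝ), (0 : ℝ)) (1 / 2) :=
      (hasDerivAt_id _).prodMk (hasDerivAt_const _ t)
    exact (hsmooth t).comp_hasDerivAt (1 / 2 : ℝ) hp
  set ξ := DZ 0 (1, 0) with hξ
  have hcp : ∀ t, x (1 / 2) (t + T) = x (1 / 2) t := by
    intro t
    have := (O.closed (1 / 2) (mem_of_mem_nhds hmem)).periodic t
    rw [O.period_center] at this
    simp only [hx, this]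
  -- the derivative of the time `T` map
  have hflow : DZ T (1, 0) = NormedSpace.exp (T • generator μ r u Ω) ξ := by
    have hev : ∀ᶠ e in 𝓝 (1 / 2 : ℝ),
        SolvesOn (cutoffField μ Ω) T fun t => rotPair (-Ω * t) (x e t) := by
      have h9 : ∀ᶠ e in 𝓝 (1 / 2 : ℝ), e < 9 / 2 := eventually_lt_nhds (by norm_num)
      filter_upwards [hmem, h9] with e he he9
      refine solvesOn_of_isIntegralCurveOn ?_ fun t _ => ?_
      · rw [← hxo e]
        intro t _
        obtain ⟨h1, X, hX, hd⟩ := (O.closed e he).integral t (mem_univ t)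
        exact ⟨h1, X, hX, hd.mono (subset_univ _)⟩
      · rw [(hmemT e he t).2]
        linarith
    have hfl := hasDerivAt_flow hK (cutoffField_basePoint h hs) (hasFDerivAt_cutoffField h hs)
      hT.le (c := fun e t => rotPair (-Ω * t) (x e t)) (a := 1 / 2) (ξ := ξ) hev
      (by simp only [mul_zero, rotPair_of_cos_eq_one Real.cos_zero, hxB, hB])
      (by simp only [hΩ, rotPair_of_cos_eq_one (Real.cos_neg (Ω * T) ▸ hΩT), hxB,
        rotPair_of_cos_eq_one hΩT, hB])
      (by simpa only [mul_zero, rotPair_of_cos_eq_one Real.cos_zero] using hde 0)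
    simp only [hΩ, rotPair_of_cos_eq_one (Real.cos_neg (Ω * T) ▸ hΩT)] at hfl
    exact (hde T).unique hfl
  -- the closing condition
  have hdt : DZ T (0, 1) = (Ω • turn B.1, Ω • turn B.2) := by
    have h1 : HasDerivAt (fun t => x (1 / 2) t) (DZ T (0, 1)) T := by
      have hp : HasDerivAt (fun t : ℝ => ((1 / 2 : ℝ), t)) ((0 : ℝ), (1 : ℝ)) T :=
        (hasDerivAt_const _ _).prodMk (hasDerivAt_id _)
      exact (hsmooth T).comp_hasDerivAt T hp
    have h2 := hasDerivWithinAt_rotPair (Ω := Ω) (hasDerivWithinAt_const T univ B)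
    rw [hasDerivWithinAt_univ, rotPair_of_cos_eq_one hΩT] at h2
    simp only [hxB] at h1
    rw [h1.unique h2]
    simp
  have hp : HasDerivAt O.period (deriv O.period (1 / 2)) (1 / 2) :=
    ((O.smooth_period.contDiffAt hmem).differentiableAt (by simp)).hasDerivAt
  -- The derivative in e of the closing condition x(e, T(e)) = x(e, 0).
  have hclose : DZ T (1, 0) + deriv O.period (1 / 2) • DZ T (0, 1) = ξ := by
    have h1 : HasDerivAt (fun e => x e (O.period e)) (DZ T (1, deriv O.period (1 / 2))) (1 / 2) := by
      have hp' : HasDerivAt (fun e : ℝ => (e, O.period e)) ((1 : ℝ), deriv O.period (1 / 2))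
          (1 / 2) := (hasDerivAt_id _).prodMk hp
      exact (hsmooth T).comp_hasDerivAt_of_eq (1 / 2 : ℝ) hp' (by rw [O.period_center])
    have h2 : HasDerivAt (fun e => x e (O.period e)) ξ (1 / 2) := by
      refine (hde 0).congr_of_eventuallyEq ?_
      filter_upwards [hmem] with e he
      have := (O.closed e he).periodic 0
      rw [zero_add] at this
      simp only [hx, this]
    rw [← h1.unique h2, ← map_smul, ← map_add]
    simp
  have hξ1 : HasDerivAt (fun e => (x e 0).1) ξ.1 (1 / 2) :=
    (ContinuousLinearMap.fst ℝ E3 E3).hasFDerivAt.comp_hasDerivAt (1 / 2 : ℝ) (hde 0)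
  have hξ2 : HasDerivAt (fun e => (x e 0).2) ξ.2 (1 / 2) :=
    (ContinuousLinearMap.snd ℝ E3 E3).hasFDerivAt.comp_hasDerivAt (1 / 2 : ℝ) (hde 0)
  have hx0 : x (1 / 2) 0 = B := by rw [hxB, mul_zero, rotPair_of_cos_eq_one Real.cos_zero]
  have t1 : ⟪B.1, ξ.1⟫_ℝ = 0 := by
    have h1 := hξ1.inner ℝ hξ1
    have h2 : HasDerivAt (fun e => ⟪(x e 0).1, (x e 0).1⟫_ℝ) 0 (1 / 2) := by
      refine (hasDerivAt_const (1 / 2 : ℝ) (1 : ℝ)).congr_of_eventuallyEq ?_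
      filter_upwards [hmem] with e he using (hmemT e he 0).1.1
    have h3 := h1.unique h2
    rw [hx0] at h3
    linarith [real_inner_comm B.1 ξ.1]
  have t2 : ⟪B.1, ξ.2⟫_ℝ + ⟪ξ.1, B.2⟫_ℝ = 0 := by
    have h1 := hξ1.inner ℝ hξ2
    have h2 : HasDerivAt (fun e => ⟪(x e 0).1, (x e 0).2⟫_ℝ) 0 (1 / 2) := by
      refine (hasDerivAt_const (1 / 2 : ℝ) (0 : ℝ)).congr_of_eventuallyEq ?_
      filter_upwards [hmem] with e he using (hmemT e he 0).1.2
    have h3 := h1.unique h2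
    rwa [hx0] at h3
  -- The parameter is the energy, |v|² = 2e, so the linearized energy of the variation is normalized
  -- to 1.
  have t3 : r * Ω * ξ.2 1 = 1 := by
    have h1 := hξ2.inner ℝ hξ2
    have h2 : HasDerivAt (fun e => ⟪(x e 0).2, (x e 0).2⟫_ℝ) (2 * 1) (1 / 2) := by
      refine ((hasDerivAt_id (1 / 2 : ℝ)).const_mul 2).congr_of_eventuallyEq ?_
      filter_upwards [hmem] with e he using (hmemT e he 0).2
    have h3 := h1.unique h2
    rw [hx0, inner_eq, inner_eq] at h3
    simp [hB, basePoint] at h3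
    linarith
  obtain ⟨e1, -, e3⟩ := linearized_return (τ := deriv O.period (1 / 2)) h hs hT hκ₀ hκ
    (hasDerivAt_exp_generator μ r u Ω ξ) (by rwa [exp_zero_smul_apply])
    (by rwa [exp_zero_smul_apply])
    (by rw [exp_zero_smul_apply, ← hflow, eq_sub_iff_add_eq, ← hdt, hclose])
  rw [exp_zero_smul_apply, t3] at e1 e3
  -- Multiplying `e3` by κ allows the height to be eliminated through κa₂ = -u.
  linear_combination normalFrequency μ r u Ω * e3 - T * u * e1

/-- A smooth family of circles of latitude, parametrized by the energy. -/
theorem nonempty_orbitCylinder {μ r u Ω T σ : ℝ} {ρ υ w : ℝ → ℝ} {ε : ℝ} (hε : 0 < ε)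
    (hσ : σ = 1 ∨ σ = -1)
    (hρ : ContDiffOn ℝ ∞ ρ (Ioo (1 / 2 - ε) (1 / 2 + ε)))
    (hυ : ContDiffOn ℝ ∞ υ (Ioo (1 / 2 - ε) (1 / 2 + ε)))
    (hw : ContDiffOn ℝ ∞ w (Ioo (1 / 2 - ε) (1 / 2 + ε)))
    (hpos : ∀ e ∈ Ioo (1 / 2 - ε) (1 / 2 + ε), 0 < σ * w e)
    (hcirc : ∀ e ∈ Ioo (1 / 2 - ε) (1 / 2 + ε), IsMagneticCircle μ (ρ e) (υ e) (w e))
    (hen : ∀ e ∈ Ioo (1 / 2 - ε) (1 / 2 + ε), ρ e ^ 2 * w e ^ 2 = 2 * e)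
    (h1 : ρ (1 / 2) = r) (h2 : υ (1 / 2) = u) (h3 : w (1 / 2) = Ω)
    (hT : T = 2 * Real.pi / (σ * Ω)) :
    Nonempty (OrbitCylinder roundMetric (magneticPotential μ) (1 / 2) T (circleOrbit r u Ω)) := by
  set I := Ioo (1 / 2 - ε) (1 / 2 + ε) with hI
  -- The sign σ of the angular velocity makes the period 2π/(σw) positive.
  refine ⟨{ ε := ε, ε_pos := hε, orbit := fun e => circleOrbit (ρ e) (υ e) (w e),
            period := fun e => 2 * Real.pi / (σ * w e), smooth_orbit := ?_, smooth_period := ?_,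
            closed := ?_, orbit_center := by rw [h1, h2, h3], period_center := by rw [h3, hT] }⟩
  · have k1 : ContDiffOn ℝ ∞ (fun z : ℝ × ℝ => ρ z.1) (I ×ˢ univ) :=
      hρ.comp contDiff_fst.contDiffOn fun z hz => hz.1
    have k2 : ContDiffOn ℝ ∞ (fun z : ℝ × ℝ => υ z.1) (I ×ˢ univ) :=
      hυ.comp contDiff_fst.contDiffOn fun z hz => hz.1
    have k3 : ContDiffOn ℝ ∞ (fun z : ℝ × ℝ => w z.1) (I ×ˢ univ) :=
      hw.comp contDiff_fst.contDiffOn fun z hz => hz.1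
    have k4 : ContDiffOn ℝ ∞ (fun z : ℝ × ℝ => w z.1 * z.2) (I ×ˢ univ) :=
      k3.mul contDiff_snd.contDiffOn
    have kc := k4.cos
    have ks := k4.sin
    have hE3 : ∀ f : ℝ × ℝ → E3, (∀ i, ContDiffOn ℝ ∞ (fun z => f z i) (I ×ˢ univ)) →
        ContDiffOn ℝ ∞ f (I ×ˢ univ) := fun f hf => contDiffOn_euclidean.2 hf
    refine toPhase.contDiff.comp_contDiffOn (ContDiffOn.prodMk (hE3 _ fun i => ?_) (hE3 _ fun i => ?_))
    · fin_cases i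
      · exact (kc.mul k1).sub (ks.mul contDiffOn_const)
      · exact (ks.mul k1).add (kc.mul contDiffOn_const)
      · exact k2
    · fin_cases i
      · exact (kc.mul contDiffOn_const).sub (ks.mul (k1.mul k3))
      · exact (ks.mul contDiffOn_const).add (kc.mul (k1.mul k3))
      · exact contDiffOn_const
  · exact contDiffOn_const.div (contDiffOn_const.mul hw) fun e he => (hpos e he).ne'
  · intro e he
    have hp := hpos e he
    refine isClosedOrbit_circleOrbit (hcirc e he) (by positivity) ?_ (hen e he)
    have hw0 : w e ≠ 0 := fun h0 => by simp [h0] at hp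
    rcases hσ with rfl | rfl
    · rw [one_mul, mul_div_cancel₀ _ hw0, Real.cos_two_pi]
    · have : w e * (2 * Real.pi / (-1 * w e)) = -(2 * Real.pi) := by field_simp
      rw [this, Real.cos_neg, Real.cos_two_pi]

/-! ### Second order jets at zero -/

/-- `F` is twice differentiable at `0`, with value `a`, first derivative `b` and second
derivative `c`. -/
def HasJet (F : ℝ → ℝ) (a b c : ℝ) : Prop :=
  ∃ F' : ℝ → ℝ, (∀ᶠ s in 𝓝 0, HasDerivAt F (F' s) s) ∧ F 0 = a ∧ F' 0 = b ∧ HasDerivAt F' c 0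

namespace HasJet

variable {F G : ℝ → ℝ} {a b c a' b' c' : ℝ}

theorem hasDerivAt (h : HasJet F a b c) : HasDerivAt F b 0 := by
  obtain ⟨F', h1, -, h3, -⟩ := h
  exact h3 ▸ h1.self_of_nhds

theorem iteratedDeriv_two (h : HasJet F a b c) : iteratedDeriv 2 F 0 = c := by
  obtain ⟨F', h1, -, -, h4⟩ := h
  rw [iteratedDeriv_succ, iteratedDeriv_one]
  have : deriv F =ᶠ[𝓝 0] F' := h1.mono fun s hs => hs.deriv
  exact (h4.congr_of_eventuallyEq this).deriv

theorem add (hF : HasJet F a b c) (hG : HasJet G a' b' c') :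
    HasJet (fun s => F s + G s) (a + a') (b + b') (c + c') := by
  obtain ⟨F', h1, h2, h3, h4⟩ := hF
  obtain ⟨G', k1, k2, k3, k4⟩ := hG
  refine ⟨fun s => F' s + G' s, ?_, by simp only [h2, k2], by simp only [h3, k3], h4.fun_add k4⟩
  filter_upwards [h1, k1] with s hs ks using hs.fun_add ks

theorem mul (hF : HasJet F a b c) (hG : HasJet G a' b' c') :
    HasJet (fun s => F s * G s) (a * a') (b * a' + a * b') (c * a' + 2 * b * b' + a * c') := by
  obtain ⟨F', h1, h2, h3, h4⟩ := hF
  obtain ⟨G', k1, k2, k3, k4⟩ := hG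
  refine ⟨fun s => F' s * G s + F s * G' s, ?_, by simp only [h2, k2], by simp only [h2, h3, k2, k3], ?_⟩
  · filter_upwards [h1, k1] with s hs ks using hs.fun_mul ks
  · refine ((h4.fun_mul k1.self_of_nhds).fun_add (h1.self_of_nhds.fun_mul k4)).congr_deriv ?_
    rw [h2, h3, k2, k3]
    ring

theorem const (a : ℝ) : HasJet (fun _ => a) a 0 0 :=
  ⟨fun _ => 0, Eventually.of_forall fun s => hasDerivAt_const s a, rfl, rfl, hasDerivAt_const _ _⟩

theorem affine (a b : ℝ) : HasJet (fun s => a + s * b) a b 0 := by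
  refine ⟨fun _ => b, Eventually.of_forall fun s => ?_, by simp, rfl, hasDerivAt_const _ _⟩
  exact (((hasDerivAt_id s).mul_const b).const_add a).congr_deriv (by simp)

theorem id : HasJet (fun s => s) 0 1 0 :=
  ⟨fun _ => 1, Eventually.of_forall hasDerivAt_id, rfl, rfl, hasDerivAt_const _ _⟩

theorem inv_affine {T : ℝ} (hT : T ≠ 0) (b : ℝ) :
    HasJet (fun s => (T + s * b)⁻¹) T⁻¹ (-b / T ^ 2) (2 * b ^ 2 / T ^ 3) := by
  have hd : ∀ s, HasDerivAt (fun s => T + s * b) b s := fun s =>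
    (((hasDerivAt_id s).mul_const b).const_add T).congr_deriv (by simp)
  have h0 : ∀ᶠ s in 𝓝 (0 : ℝ), T + s * b ≠ 0 :=
    (hd 0).continuousAt.eventually_ne (by simpa using hT)
  refine ⟨fun s => -b / (T + s * b) ^ 2, ?_, by simp, by simp, ?_⟩
  · filter_upwards [h0] with s hs using (hd s).fun_inv hs
  · have h1 := ((hd 0).fun_pow 2).fun_inv (by simpa using hT)
    have h2 := h1.const_mul (-b)
    refine (h2.congr_deriv ?_).congr_of_eventuallyEq (Eventually.of_forall fun s => ?_)
    · simp only [zero_mul, add_zero]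
      field_simp
      norm_num
      ring
    · simp only [div_eq_mul_inv]

theorem congr (h : HasJet F a b c) (hFG : G =ᶠ[𝓝 0] F) : HasJet G a b c := by
  obtain ⟨F', h1, h2, h3, h4⟩ := h
  refine ⟨F', ?_, by rw [hFG.self_of_nhds, h2], h3, h4⟩
  filter_upwards [h1, hFG.eventuallyEq_nhds] with s hs hs' using hs.congr_of_eventuallyEq hs'

theorem congr_jet (h : HasJet F a b c) (ha : a = a') (hb : b = b') (hc : c = c') :
    HasJet F a' b' c' := by
  subst ha hb hc
  exact h

end HasJet

/-! ### Weighted integrals along a variation -/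

/-- The integral of `m` against the `k`-th power of the weight `(1 + s² n)⁻¹`. -/
def weightedIntegral (k : ℕ) (n m : ℝ → ℝ) (s : ℝ) : ℝ :=
  ∫ t in (0 : ℝ)..1, ((1 + s ^ 2 * n t) ^ k)⁻¹ * m t

section weighted

variable {n m : ℝ → ℝ}

theorem aestronglyMeasurable_of_continuousOn (hn : ContinuousOn n (Icc 0 1)) :
    AEStronglyMeasurable n (volume.restrict (Set.uIoc 0 1)) := by
  rw [uIoc_of_le zero_le_one]
  exact (hn.mono Ioc_subset_Icc_self).aestronglyMeasurable measurableSet_Ioc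

/-- The parameter s enters only through a smooth weight with values in [0, 1], so mere integrability
of m suffices: near s the derivative of the integrand is dominated by 2k(|s| + 1)C|m|, where C
bounds n. -/
theorem hasDerivAt_weightedIntegral (hn : ContinuousOn n (Icc 0 1)) (hn0 : ∀ t, 0 ≤ n t)
    (hm : IntervalIntegrable m volume 0 1) (k : ℕ) (s : ℝ) :
    HasDerivAt (weightedIntegral k n m)
      (-2 * k * s * weightedIntegral (k + 1) n (fun t => n t * m t) s) s := by
  obtain ⟨C, hC⟩ := isCompact_Icc.exists_bound_of_continuousOn hn
  have hpos : ∀ s t, 1 ≤ 1 + s ^ 2 * n t := fun s t => by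
    have := mul_nonneg (sq_nonneg s) (hn0 t)
    linarith
  have hinv : ∀ (k : ℕ) s t, |((1 + s ^ 2 * n t) ^ k)⁻¹| ≤ 1 := fun k s t => by
    rw [abs_of_nonneg (inv_nonneg.2 (pow_nonneg (zero_le_one.trans (hpos s t)) k))]
    exact inv_le_one_of_one_le₀ (one_le_pow₀ (hpos s t))
  have hmeas : ∀ (k : ℕ) s, AEStronglyMeasurable (fun t => ((1 + s ^ 2 * n t) ^ k)⁻¹)
      (volume.restrict (Set.uIoc 0 1)) := by
    intro k s
    refine aestronglyMeasurable_of_continuousOn ?_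
    exact ((continuousOn_const.add (continuousOn_const.mul hn)).pow k).inv₀
      fun t _ => (pow_pos (zero_lt_one.trans_le (hpos s t)) k).ne'
  have hmm := (intervalIntegrable_iff.1 hm).aestronglyMeasurable
  have hnm := aestronglyMeasurable_of_continuousOn hn
  have key := intervalIntegral.hasDerivAt_integral_of_dominated_loc_of_deriv_le
    (F := fun s t => ((1 + s ^ 2 * n t) ^ k)⁻¹ * m t)
    (F' := fun s t => -2 * k * s * (((1 + s ^ 2 * n t) ^ (k + 1))⁻¹ * (n t * m t)))
    (μ := volume) (a := 0) (b := 1) (x₀ := s) (s := Metric.ball s 1)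
    (bound := fun t => 2 * k * (|s| + 1) * C * |m t|) (Metric.ball_mem_nhds s one_pos)
    (Eventually.of_forall fun s => (hmeas k s).mul hmm)
    (hm.mono_fun ((hmeas k s).mul hmm) (Eventually.of_forall fun t => ?_))
    (((hmeas (k + 1) s).mul (hnm.mul hmm)).const_mul _)
    (Eventually.of_forall fun t ht x hx => ?_) (hm.abs.const_mul _)
    (Eventually.of_forall fun t ht x hx => ?_)
  · refine key.2.congr_deriv ?_
    rw [intervalIntegral.integral_const_mul, weightedIntegral]
  · simp only [norm_mul]
    exact mul_le_of_le_one_left (norm_nonneg _) (hinv k s t)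
  · rw [uIoc_of_le zero_le_one] at ht
    have hCt := hC t (Ioc_subset_Icc_self ht)
    have hx' : |x| ≤ |s| + 1 := by
      rw [Metric.mem_ball, Real.dist_eq] at hx
      have := abs_sub_abs_le_abs_sub x s
      linarith
    rw [Real.norm_eq_abs] at hCt ⊢
    rw [abs_mul, abs_mul, abs_mul, abs_mul, abs_mul (n t)]
    have e1 : |(-2 : ℝ)| = 2 := by norm_num
    rw [e1, abs_of_nonneg (Nat.cast_nonneg k : (0 : ℝ) ≤ k)]
    calc 2 * k * |x| * (|((1 + x ^ 2 * n t) ^ (k + 1))⁻¹| * (|n t| * |m t|))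
        ≤ 2 * k * (|s| + 1) * (1 * (C * |m t|)) := by
          gcongr
          exact hinv (k + 1) x t
      _ = 2 * k * (|s| + 1) * C * |m t| := by ring
  · have hne : 1 + x ^ 2 * n t ≠ 0 := (zero_lt_one.trans_le (hpos x t)).ne'
    have h1 : HasDerivAt (fun x : ℝ => 1 + x ^ 2 * n t) (2 * x * n t) x :=
      (((hasDerivAt_pow 2 x).mul_const (n t)).const_add 1).congr_deriv (by simp)
    refine (((h1.fun_pow k).fun_inv (pow_ne_zero k hne)).mul_const (m t)).congr_deriv ?_
    rcases k with _ | k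
    · simp
    · simp only [Nat.add_sub_cancel]
      field_simp
      ring

/-- The derivative carries an explicit factor s; hence it vanishes at 0, and the second derivative
is the value of the remaining factor there. -/
theorem hasJet_weightedIntegral (hn : ContinuousOn n (Icc 0 1)) (hn0 : ∀ t, 0 ≤ n t)
    (hm : IntervalIntegrable m volume 0 1) (k : ℕ) :
    HasJet (weightedIntegral k n m) (∫ t in (0 : ℝ)..1, m t) 0
      (-2 * k * ∫ t in (0 : ℝ)..1, n t * m t) := by
  have hnm : IntervalIntegrable (fun t => n t * m t) volume 0 1 :=
    hm.continuousOn_mul (by rwa [uIcc_of_le zero_le_one])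
  refine ⟨_, Eventually.of_forall fun s => hasDerivAt_weightedIntegral hn hn0 hm k s, ?_, ?_, ?_⟩
  · simp [weightedIntegral]
  · simp
  · have h1 := ((hasDerivAt_id (0 : ℝ)).const_mul (-2 * (k : ℝ))).fun_mul
      (hasDerivAt_weightedIntegral hn hn0 hnm (k + 1) 0)
    refine h1.congr_deriv ?_
    simp [weightedIntegral]

theorem intervalIntegrable_weighted (hn : ContinuousOn n (Icc 0 1)) (hn0 : ∀ t, 0 ≤ n t)
    (hm : IntervalIntegrable m volume 0 1) (k : ℕ) (s : ℝ) :
    IntervalIntegrable (fun t => ((1 + s ^ 2 * n t) ^ k)⁻¹ * m t) volume 0 1 := by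
  refine hm.continuousOn_mul ?_
  rw [uIcc_of_le zero_le_one]
  refine ((continuousOn_const.add (continuousOn_const.mul hn)).pow k).inv₀ fun t _ => ?_
  have := mul_nonneg (sq_nonneg s) (hn0 t)
  have h1 : 0 < 1 + s ^ 2 * n t := by linarith
  exact (pow_pos h1 k).ne'

end weighted

/-! ### Sobolev functions on the unit interval -/

/-- On `[0, 1]` the function `f` is a primitive of the square integrable function `w`. -/
structure HasSobolevDeriv (f w : ℝ → ℝ) : Prop where
  memLp : MemLp w 2 (volume.restrict (Ioc (0 : ℝ) 1))
  eq_integral : ∀ t ∈ Icc (0 : ℝ) 1, f t = f 0 + ∫ s in (0 : ℝ)..t, w s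

theorem _root_.AbsolutelyContinuousOnInterval.congr {f g : ℝ → ℝ} {a b : ℝ}
    (hf : AbsolutelyContinuousOnInterval f a b) (h : ∀ t ∈ uIcc a b, g t = f t) :
    AbsolutelyContinuousOnInterval g a b := by
  rw [absolutelyContinuousOnInterval_iff] at hf ⊢
  intro ε hε
  obtain ⟨δ, hδ, H⟩ := hf ε hε
  refine ⟨δ, hδ, fun E hE hEδ => ?_⟩
  convert H E hE hEδ using 1
  refine Finset.sum_congr rfl fun i hi => ?_
  rw [h _ (hE.1 i hi).1, h _ (hE.1 i hi).2]

/-- The fundamental theorem of calculus for absolutely continuous functions. -/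
theorem integral_eq_zero_of_ae_hasDerivAt {F F' : ℝ → ℝ}
    (hF : AbsolutelyContinuousOnInterval F 0 1)
    (h : ∀ᵐ t, t ∈ Ioo (0 : ℝ) 1 → HasDerivAt F (F' t) t) (h01 : F 0 = F 1) :
    ∫ t in (0 : ℝ)..1, F' t = 0 := by
  have h1 := hF.integral_deriv_eq_sub
  rw [h01, sub_self] at h1
  refine Eq.trans ?_ h1
  refine intervalIntegral.integral_congr_ae ?_
  have hne : ∀ᵐ t : ℝ, t ≠ 1 := by simp [ae_iff]
  filter_upwards [h, hne] with t ht hne1 ht'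
  rw [uIoc_of_le zero_le_one] at ht'
  exact (ht ⟨ht'.1, lt_of_le_of_ne ht'.2 hne1⟩).deriv.symm

namespace HasSobolevDeriv

variable {f w g v : ℝ → ℝ}

theorem intervalIntegrable (h : HasSobolevDeriv f w) : IntervalIntegrable w volume 0 1 := by
  rw [intervalIntegrable_iff_integrableOn_Ioc_of_le zero_le_one]
  exact h.memLp.integrable (by norm_num)

theorem intervalIntegrable_mul (h : HasSobolevDeriv f w) (k : HasSobolevDeriv g v) :
    IntervalIntegrable (fun t => w t * v t) volume 0 1 := by
  rw [intervalIntegrable_iff_integrableOn_Ioc_of_le zero_le_one]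
  exact h.memLp.integrable_mul k.memLp

theorem intervalIntegrable_sq (h : HasSobolevDeriv f w) :
    IntervalIntegrable (fun t => w t ^ 2) volume 0 1 := by
  simpa only [sq] using h.intervalIntegrable_mul h

theorem absolutelyContinuous (h : HasSobolevDeriv f w) :
    AbsolutelyContinuousOnInterval f 0 1 := by
  have h1 : AbsolutelyContinuousOnInterval (fun _ : ℝ => f 0) 0 1 :=
    ContDiffOn.absolutelyContinuousOnInterval contDiffOn_const
  refine (h1.fun_add (h.intervalIntegrable.absolutelyContinuousOnInterval_intervalIntegral
    (c := 0) left_mem_uIcc)).congr fun t ht => ?_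
  rw [uIcc_of_le zero_le_one] at ht
  exact h.eq_integral t ht

theorem continuousOn (h : HasSobolevDeriv f w) : ContinuousOn f (Icc 0 1) := by
  simpa only [uIcc_of_le (zero_le_one (α := ℝ))] using h.absolutelyContinuous.continuousOn

theorem ae_hasDerivAt (h : HasSobolevDeriv f w) :
    ∀ᵐ t, t ∈ Ioo (0 : ℝ) 1 → HasDerivAt f (w t) t := by
  filter_upwards [h.intervalIntegrable.ae_hasDerivAt_integral] with t ht ht'
  have h1 := ht (by rw [uIcc_of_le zero_le_one]; exact Ioo_subset_Icc_self ht') 0 left_mem_uIcc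
  refine (h1.const_add (f 0)).congr_of_eventuallyEq ?_
  filter_upwards [Ioo_mem_nhds ht'.1 ht'.2] with s hs
  exact h.eq_integral s (Ioo_subset_Icc_self hs)

theorem const_mul (h : HasSobolevDeriv f w) (c : ℝ) :
    HasSobolevDeriv (fun t => c * f t) (fun t => c * w t) := by
  refine ⟨h.memLp.const_mul c, fun t ht => ?_⟩
  rw [intervalIntegral.integral_const_mul, h.eq_integral t ht, mul_add]

theorem sub_const (h : HasSobolevDeriv f w) (c : ℝ) :
    HasSobolevDeriv (fun t => f t - c) w := by
  refine ⟨h.memLp, fun t ht => ?_⟩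
  rw [h.eq_integral t ht]
  ring

end HasSobolevDeriv

theorem hasSobolevDeriv_apply {ζ w : ℝ → E3}
    (hw : MemLp w 2 (volume.restrict (Ioc (0 : ℝ) 1)))
    (hζ : ∀ t ∈ Icc (0 : ℝ) 1, ζ t = ζ 0 + ∫ s in (0 : ℝ)..t, w s) (i : Fin 3) :
    HasSobolevDeriv (fun t => ζ t i) (fun t => w t i) := by
  refine ⟨(EuclideanSpace.proj (𝕜 := ℝ) i).comp_memLp' hw, fun t ht => ?_⟩
  have h1 := (EuclideanSpace.proj (𝕜 := ℝ) i).intervalIntegral_comp_comm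
    (intervalIntegrable_of_memLp hw ht)
  have h2 := congrArg (fun v : E3 => v i) (hζ t ht)
  simp only [PiLp.add_apply] at h2
  rw [h2]
  congr 1
  exact h1.symm

/-- The quadratic estimate behind the index computation: the Poincaré inequality for the
oscillation of `y` about its mean, and the Cauchy--Schwarz inequality for the rest. -/
theorem le_integral_quadratic {y Y X : ℝ → ℝ} (hy : HasSobolevDeriv y Y)
    (hX : IntervalIntegrable X volume 0 1) (hX2 : IntervalIntegrable (fun t => X t ^ 2) volume 0 1)
    (hX0 : ∫ t in (0 : ℝ)..1, X t = 0) {K : ℝ} (hK1 : K ≤ 1) (a b : ℝ) :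
    (a * (∫ t in (0 : ℝ)..1, y t) + b) ^ 2 - K * (∫ t in (0 : ℝ)..1, y t) ^ 2 ≤
      ∫ t in (0 : ℝ)..1, (Y t ^ 2 - K * y t ^ 2 + (X t - a * y t - b) ^ 2) := by
  have hyc := hy.continuousOn
  have hyi : IntervalIntegrable y volume 0 1 := by
    refine ContinuousOn.intervalIntegrable ?_
    rwa [uIcc_of_le zero_le_one]
  set m := ∫ t in (0 : ℝ)..1, y t with hm
  have hyc' : ContinuousOn (fun t => (y t - m) ^ 2) (uIcc 0 1) := by
    rw [uIcc_of_le zero_le_one]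
    exact (hyc.sub continuousOn_const).pow 2
  have hη2 := hyc'.intervalIntegrable (μ := volume)
  -- A continuous function attains its mean, which supplies the zero required by the Poincaré
  -- inequality.
  obtain ⟨t₀, ht₀, hz⟩ : ∃ t₀ ∈ Icc (0 : ℝ) 1, y t₀ - m = 0 := by
    obtain ⟨c, hc, hc'⟩ := exists_eq_interval_average (a := 0) (b := 1) (f := y) zero_ne_one
      (by rwa [uIcc_of_le zero_le_one])
    rw [interval_average_eq, sub_zero, inv_one, one_smul, ← hm] at hc'
    refine ⟨c, ?_, sub_eq_zero.2 hc'⟩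
    rw [uIoo_of_le zero_le_one] at hc
    exact Ioo_subset_Icc_self hc
  have hη := (hy.sub_const m)
  have hP := integral_sq_le one_pos hη.intervalIntegrable hη.intervalIntegrable_sq hη2
    hη.eq_integral ht₀ hz
  rw [one_pow, one_mul] at hP
  have hη1 : IntervalIntegrable (fun t => y t - m) volume 0 1 := hyi.sub intervalIntegrable_const
  have hη0 : ∫ t in (0 : ℝ)..1, (y t - m) = 0 := by
    rw [intervalIntegral.integral_sub hyi intervalIntegrable_const, ← hm]
    simp
  -- With Z = X - a(y - m) the last square is (Z - (am + b))², and dropping Z² leaves (am + b)² -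
  -- 2(am + b)Z. The terms linear in X and y - m integrate to zero.
  have hpt : ∀ t ∈ Icc (0 : ℝ) 1, (Y t ^ 2 - K * (y t - m) ^ 2) + (-2 * K * m) * (y t - m)
      - K * m ^ 2 + ((-2 * (a * m + b)) * X t + 2 * (a * m + b) * a * (y t - m)
      + (a * m + b) ^ 2) ≤ Y t ^ 2 - K * y t ^ 2 + (X t - a * y t - b) ^ 2 := by
    intro t _
    nlinarith [sq_nonneg (X t - a * (y t - m))]
  have hYi := hη.intervalIntegrable_sq
  have hyc2 : IntervalIntegrable (fun t => y t ^ 2) volume 0 1 := by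
    refine ContinuousOn.intervalIntegrable ?_
    rw [uIcc_of_le zero_le_one]
    exact hyc.pow 2
  have hXy : IntervalIntegrable (fun t => X t * y t) volume 0 1 :=
    hX.mul_continuousOn (by rwa [uIcc_of_le zero_le_one])
  have hR : IntervalIntegrable (fun t => Y t ^ 2 - K * y t ^ 2 + (X t - a * y t - b) ^ 2)
      volume 0 1 := by
    have : (fun t => Y t ^ 2 - K * y t ^ 2 + (X t - a * y t - b) ^ 2) = fun t =>
        Y t ^ 2 - K * y t ^ 2 + (X t ^ 2 - 2 * a * (X t * y t) + a ^ 2 * y t ^ 2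
        - 2 * b * X t + 2 * a * b * y t + b ^ 2) := by
      funext t; ring
    rw [this]
    exact (hYi.sub (hyc2.const_mul _)).add (((((hX2.sub (hXy.const_mul _)).add
      (hyc2.const_mul _)).sub (hX.const_mul _)).add (hyi.const_mul _)).add intervalIntegrable_const)
  have i1 := hYi.sub (hη2.const_mul K)
  have i2 := i1.add (hη1.const_mul (-2 * K * m))
  have i3 := i2.sub (intervalIntegrable_const (c := K * m ^ 2))
  have j1 := (hX.const_mul (-2 * (a * m + b))).add (hη1.const_mul (2 * (a * m + b) * a))
  have j2 := j1.add (intervalIntegrable_const (c := (a * m + b) ^ 2))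
  refine le_trans ?_ (intervalIntegral.integral_mono_on zero_le_one (i3.add j2) hR hpt)
  rw [intervalIntegral.integral_add i3 j2, intervalIntegral.integral_sub i2
    intervalIntegrable_const, intervalIntegral.integral_add i1 (hη1.const_mul _),
    intervalIntegral.integral_sub hYi (hη2.const_mul K), intervalIntegral.integral_add j1
    intervalIntegrable_const, intervalIntegral.integral_add (hX.const_mul _) (hη1.const_mul _)]
  simp only [intervalIntegral.integral_const_mul, hη0, hX0, intervalIntegral.integral_const,
    sub_zero, smul_eq_mul, mul_zero, one_mul]
  have h0 : 0 ≤ ∫ t in (0 : ℝ)..1, (y t - m) ^ 2 :=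
    intervalIntegral.integral_nonneg zero_le_one fun t _ => sq_nonneg _
  nlinarith

/-! ### The action along a variation -/

theorem hasDerivAt_variation {q ζ : ℝ → E3} {q' w : E3} {t : ℝ} (s : ℝ) (hq : HasDerivAt q q' t)
    (hζ : HasDerivAt ζ w t) (h0 : q t + s • ζ t ≠ 0) :
    HasDerivAt (variation q ζ s) (‖q t + s • ζ t‖⁻¹ • (q' + s • w) -
      (‖q t + s • ζ t‖⁻¹ ^ 3 * ⟪q t + s • ζ t, q' + s • w⟫_ℝ) • (q t + s • ζ t)) t := by
  have hy : HasDerivAt (fun t => q t + s • ζ t) (q' + s • w) t := hq.fun_add (hζ.fun_const_smul s)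
  set a := ‖q t + s • ζ t‖ with ha
  have ha0 : a ≠ 0 := norm_ne_zero_iff.2 h0
  have hn : HasDerivAt (fun t => ‖q t + s • ζ t‖) (⟪q t + s • ζ t, q' + s • w⟫_ℝ / a) t := by
    have h1 := (hy.norm_sq.sqrt (pow_ne_zero 2 ha0))
    refine (h1.congr_of_eventuallyEq (Eventually.of_forall fun t => ?_)).congr_deriv ?_
    · exact (Real.sqrt_sq (norm_nonneg _)).symm
    · rw [Real.sqrt_sq (norm_nonneg _), ← ha]
      field_simp
  refine ((hn.fun_inv ha0).fun_smul hy).congr_deriv ?_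
  rw [← ha, sub_eq_add_neg, ← neg_smul]
  congr 2
  field_simp

/-- The Lagrangian and the one-form along a variation, in terms of the unnormalized curve. -/
theorem action_density {μ : ℝ} {q ζ : ℝ → E3} {q' w : E3} {t : ℝ} (s : ℝ) (hq : HasDerivAt q q' t)
    (hζ : HasDerivAt ζ w t) (hqq : ⟪q t, q t⟫_ℝ = 1) (hqζ : ⟪q t, ζ t⟫_ℝ = 0)
    (hqq' : ⟪q t, q'⟫_ℝ = 0) (hqw : ⟪q t, w⟫_ℝ + ⟪q', ζ t⟫_ℝ = 0) (c : ℝ) :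
    roundMetric.lagrangian (variation q ζ s t) (c • deriv (variation q ζ s) t) =
      1 / 2 * c ^ 2 * (((1 + s ^ 2 * ⟪ζ t, ζ t⟫_ℝ) ^ 1)⁻¹ * ⟪q' + s • w, q' + s • w⟫_ℝ -
        ((1 + s ^ 2 * ⟪ζ t, ζ t⟫_ℝ) ^ 2)⁻¹ * (s ^ 4 * ⟪ζ t, w⟫_ℝ ^ 2)) ∧
    (magneticPotential μ).form (variation q ζ s t) (deriv (variation q ζ s) t) =
      ((1 + s ^ 2 * ⟪ζ t, ζ t⟫_ℝ) ^ 2)⁻¹ * (μ * (q t + s • ζ t) 2 ^ 2 *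
        ((q t + s • ζ t) 1 * (q' + s • w) 0 - (q t + s • ζ t) 0 * (q' + s • w) 1)) := by
  have hyy : ⟪q t + s • ζ t, q t + s • ζ t⟫_ℝ = 1 + s ^ 2 * ⟪ζ t, ζ t⟫_ℝ := by
    rw [inner_add_left, inner_add_right, inner_add_right, inner_smul_left, inner_smul_right,
      inner_smul_left, inner_smul_right, real_inner_comm (q t) (ζ t), hqq, hqζ, conj_trivial]
    ring
  -- The lower order terms vanish by the sphere and tangency constraints, so normalization costs the
  -- kinetic energy only a term of order s⁴. The one-form vanishes on the radial correction and is
  -- homogeneous of degree four, whence the weight N⁻².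
  have hyy' : ⟪q t + s • ζ t, q' + s • w⟫_ℝ = s ^ 2 * ⟪ζ t, w⟫_ℝ := by
    rw [inner_add_left, inner_add_right, inner_add_right, inner_smul_left, inner_smul_right,
      inner_smul_left, inner_smul_right, real_inner_comm q' (ζ t), hqq', conj_trivial]
    linear_combination s * hqw
  have hN : 0 < 1 + s ^ 2 * ⟪ζ t, ζ t⟫_ℝ := by
    have := mul_nonneg (sq_nonneg s) (real_inner_self_nonneg (x := ζ t))
    linarith
  have h0 : q t + s • ζ t ≠ 0 := by
    intro h
    rw [h, inner_zero_left] at hyy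
    linarith
  have hd := (hasDerivAt_variation s hq hζ h0).deriv
  rw [hd, hyy']
  have hv : variation q ζ s t = ‖q t + s • ζ t‖⁻¹ • (q t + s • ζ t) := rfl
  rw [hv]
  generalize hN' : 1 + s ^ 2 * ⟪ζ t, ζ t⟫_ℝ = N at *
  have ha : ‖q t + s • ζ t‖⁻¹ ^ 2 * N = 1 := by
    rw [← hyy, real_inner_self_eq_norm_sq, inv_pow]
    exact inv_mul_cancel₀ (pow_ne_zero 2 (norm_ne_zero_iff.2 h0))
  generalize ‖q t + s • ζ t‖⁻¹ = a at *
  generalize q t + s • ζ t = y at *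
  generalize q' + s • w = y' at *
  have hN2 : N⁻¹ = a ^ 2 := by
    field_simp
    linear_combination -ha
  constructor
  · rw [lagrangian_eq]
    · rw [inner_smul_left, inner_smul_right, inner_sub_left, inner_sub_right, inner_sub_right]
      simp only [inner_smul_left, inner_smul_right, conj_trivial, real_inner_comm y y', hyy, hyy']
      rw [pow_one, ← inv_pow, hN2]
      linear_combination 1 / 2 * c ^ 2 * a ^ 4 * s ^ 4 * ⟪ζ t, w⟫_ℝ ^ 2 * ha
    · rw [inner_smul_left, inner_smul_right, inner_sub_right, inner_smul_right, inner_smul_right,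
        hyy, hyy', conj_trivial]
      linear_combination - c * a ^ 2 * s ^ 2 * ⟪ζ t, w⟫_ℝ * ha
  · rw [magneticPotential_apply, ← inv_pow, hN2]
    simp only [PiLp.smul_apply, PiLp.sub_apply, smul_eq_mul]
    ring

theorem HasJet.id_mul {F : ℝ → ℝ} {a b c : ℝ} (h : HasJet F a b c) :
    HasJet (fun s => s * F s) 0 a (2 * b) :=
  (HasJet.id.mul h).congr_jet (by ring) (by ring) (by ring)

theorem HasJet.const_mul {F : ℝ → ℝ} {a b c : ℝ} (d : ℝ) (h : HasJet F a b c) :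
    HasJet (fun s => d * F s) (d * a) (d * b) (d * c) :=
  ((HasJet.const d).mul h).congr_jet (by ring) (by ring) (by ring)

theorem hasDerivAt_of_hasSobolevDeriv {ζ w : ℝ → E3}
    (h : ∀ i, HasSobolevDeriv (fun t => ζ t i) (fun t => w t i)) :
    ∀ᵐ t, t ∈ Ioo (0 : ℝ) 1 → HasDerivAt ζ (w t) t := by
  filter_upwards [(h 0).ae_hasDerivAt, (h 1).ae_hasDerivAt, (h 2).ae_hasDerivAt]
    with t h0 h1 h2 ht
  rw [hasDerivAt_E3]
  intro i
  fin_cases i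
  exacts [h0 ht, h1 ht, h2 ht]

/-- The constraints on the velocity of a vector field along a curve on the sphere. -/
theorem inner_add_inner_eq_zero {q ζ : ℝ → E3} {q' w : E3} {t : ℝ} (hq : HasDerivAt q q' t)
    (hζ : HasDerivAt ζ w t) {c : ℝ} (h : ∀ t, ⟪q t, ζ t⟫_ℝ = c) :
    ⟪q t, w⟫_ℝ + ⟪q', ζ t⟫_ℝ = 0 := by
  have h1 := hq.inner ℝ hζ
  simp only [h] at h1
  exact h1.unique (hasDerivAt_const t c)

/-- The horizontal area form `x₁ x₀' - x₀ x₁'`. -/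
def areaForm (x x' : E3) : ℝ := x 1 * x' 0 - x 0 * x' 1

/-- The integrands are polynomials in s times powers of the weight (1 + s²|ζ|²)⁻¹, so the jet
follows from sums and products of the jets of weighted integrals. It holds for any C¹ loop on the
sphere and any Sobolev vector field along it. -/
theorem hasJet_action {μ T : ℝ} (hT : T ≠ 0) (b : ℝ) {q q' ζ w : ℝ → E3}
    (hq : ∀ t, HasDerivAt q (q' t) t) (hq'c : Continuous q') (hqq : ∀ t, ⟪q t, q t⟫_ℝ = 1)
    (hqζ : ∀ t, ⟪q t, ζ t⟫_ℝ = 0)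
    (hζw : ∀ i, HasSobolevDeriv (fun t => ζ t i) (fun t => w t i)) :
    ∃ a, HasJet
      (fun s => action roundMetric (magneticPotential μ) (1 / 2) (variation q ζ s) (T + s * b)) a
      (-b / (2 * T ^ 2) * (∫ t in (0 : ℝ)..1, ⟪q' t, q' t⟫_ℝ) +
        T⁻¹ * (∫ t in (0 : ℝ)..1, ⟪q' t, w t⟫_ℝ) + b / 2 +
        ∫ t in (0 : ℝ)..1, μ * (q t 2 ^ 2 * (areaForm (q t) (w t) + areaForm (ζ t) (q' t)) +
          2 * q t 2 * ζ t 2 * areaForm (q t) (q' t)))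
      (b ^ 2 / T ^ 3 * (∫ t in (0 : ℝ)..1, ⟪q' t, q' t⟫_ℝ) -
        2 * b / T ^ 2 * (∫ t in (0 : ℝ)..1, ⟪q' t, w t⟫_ℝ) +
        T⁻¹ * ((∫ t in (0 : ℝ)..1, ⟪w t, w t⟫_ℝ) -
          ∫ t in (0 : ℝ)..1, ⟪ζ t, ζ t⟫_ℝ * ⟪q' t, q' t⟫_ℝ) -
        4 * (∫ t in (0 : ℝ)..1, ⟪ζ t, ζ t⟫_ℝ * (μ * (q t 2 ^ 2 * areaForm (q t) (q' t)))) +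
        2 * ∫ t in (0 : ℝ)..1, μ * (q t 2 ^ 2 * areaForm (ζ t) (w t) +
          2 * q t 2 * ζ t 2 * (areaForm (q t) (w t) + areaForm (ζ t) (q' t)) +
          ζ t 2 ^ 2 * areaForm (q t) (q' t))) := by
  have hqc : Continuous q := continuous_iff_continuousAt.2 fun t => (hq t).continuousAt
  have cq : ∀ i, ContinuousOn (fun t => q t i) (uIcc 0 1) := fun i =>
    ((EuclideanSpace.proj (𝕜 := ℝ) i).continuous.comp hqc).continuousOn
  have cq' : ∀ i, ContinuousOn (fun t => q' t i) (uIcc 0 1) := fun i =>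
    ((EuclideanSpace.proj (𝕜 := ℝ) i).continuous.comp hq'c).continuousOn
  have cζ : ∀ i, ContinuousOn (fun t => ζ t i) (uIcc 0 1) := fun i => by
    rw [uIcc_of_le zero_le_one]; exact (hζw i).continuousOn
  have iw : ∀ i, IntervalIntegrable (fun t => w t i) volume 0 1 := fun i =>
    (hζw i).intervalIntegrable
  have iww : ∀ i j, IntervalIntegrable (fun t => w t i * w t j) volume 0 1 := fun i j =>
    (hζw i).intervalIntegrable_mul (hζw j)
  have cn : ContinuousOn (fun t => ⟪ζ t, ζ t⟫_ℝ) (Icc 0 1) := by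
    simp only [inner_eq]
    rw [uIcc_of_le zero_le_one] at cζ
    exact (((cζ 0).mul (cζ 0)).add ((cζ 1).mul (cζ 1))).add ((cζ 2).mul (cζ 2))
  have n0 : ∀ t, 0 ≤ ⟪ζ t, ζ t⟫_ℝ := fun t => real_inner_self_nonneg
  -- integrability of the coefficients
  have iA : IntervalIntegrable (fun t => ⟪q' t, q' t⟫_ℝ) volume 0 1 :=
    (hq'c.inner hq'c).intervalIntegrable 0 1
  have iB : IntervalIntegrable (fun t => ⟪q' t, w t⟫_ℝ) volume 0 1 := by
    simp only [inner_eq]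
    exact (((iw 0).continuousOn_mul (cq' 0)).add ((iw 1).continuousOn_mul (cq' 1))).add
      ((iw 2).continuousOn_mul (cq' 2))
  have iC : IntervalIntegrable (fun t => ⟪w t, w t⟫_ℝ) volume 0 1 := by
    simp only [inner_eq]
    exact ((iww 0 0).add (iww 1 1)).add (iww 2 2)
  have iD : IntervalIntegrable (fun t => ⟪ζ t, w t⟫_ℝ ^ 2) volume 0 1 := by
    have e : (fun t => ⟪ζ t, w t⟫_ℝ ^ 2) = fun t =>
        ∑ i, ∑ j, ζ t i * ζ t j * (w t i * w t j) := by
      funext t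
      simp only [inner_eq, Fin.sum_univ_three]
      ring
    rw [e]
    have h1 : ∀ i j, IntervalIntegrable (fun t => ζ t i * ζ t j * (w t i * w t j)) volume 0 1 :=
      fun i j => (iww i j).continuousOn_mul ((cζ i).mul (cζ j))
    simp only [Fin.sum_univ_three]
    exact (((h1 0 0).add (h1 0 1)).add (h1 0 2)).add (((h1 1 0).add (h1 1 1)).add (h1 1 2)) |>.add
      (((h1 2 0).add (h1 2 1)).add (h1 2 2))
  have c0 : ContinuousOn (fun t => areaForm (q t) (q' t)) (uIcc 0 1) :=
    ((cq 1).mul (cq' 0)).sub ((cq 0).mul (cq' 1))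
  have i1 : IntervalIntegrable (fun t => areaForm (q t) (w t) + areaForm (ζ t) (q' t))
      volume 0 1 := by
    refine IntervalIntegrable.add ?_ (ContinuousOn.intervalIntegrable
      (((cζ 1).mul (cq' 0)).sub ((cζ 0).mul (cq' 1))))
    exact ((iw 0).continuousOn_mul (cq 1)).sub ((iw 1).continuousOn_mul (cq 0))
  have i2 : IntervalIntegrable (fun t => areaForm (ζ t) (w t)) volume 0 1 :=
    ((iw 0).continuousOn_mul (cζ 1)).sub ((iw 1).continuousOn_mul (cζ 0))
  have c2 : ContinuousOn (fun t => 2 * q t 2 * ζ t 2) (uIcc 0 1) :=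
    (continuousOn_const.mul (cq 2)).mul (cζ 2)
  have iG0 : IntervalIntegrable (fun t => μ * (q t 2 ^ 2 * areaForm (q t) (q' t))) volume 0 1 :=
    (ContinuousOn.intervalIntegrable (((cq 2).pow 2).mul c0)).const_mul μ
  have iG1 : IntervalIntegrable (fun t => μ * (q t 2 ^ 2 * (areaForm (q t) (w t) +
      areaForm (ζ t) (q' t)) + 2 * q t 2 * ζ t 2 * areaForm (q t) (q' t))) volume 0 1 :=
    ((i1.continuousOn_mul ((cq 2).pow 2)).add
      (ContinuousOn.intervalIntegrable (c2.mul c0))).const_mul μ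
  have iG2 : IntervalIntegrable (fun t => μ * (q t 2 ^ 2 * areaForm (ζ t) (w t) +
      2 * q t 2 * ζ t 2 * (areaForm (q t) (w t) + areaForm (ζ t) (q' t)) +
      ζ t 2 ^ 2 * areaForm (q t) (q' t))) volume 0 1 :=
    (((i2.continuousOn_mul ((cq 2).pow 2)).add (i1.continuousOn_mul c2)).add
      (ContinuousOn.intervalIntegrable (((cζ 2).pow 2).mul c0))).const_mul μ
  have iG3 : IntervalIntegrable (fun t => μ * (2 * q t 2 * ζ t 2 * areaForm (ζ t) (w t) +
      ζ t 2 ^ 2 * (areaForm (q t) (w t) + areaForm (ζ t) (q' t)))) volume 0 1 :=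
    ((i2.continuousOn_mul c2).add (i1.continuousOn_mul ((cζ 2).pow 2))).const_mul μ
  have iG4 : IntervalIntegrable (fun t => μ * (ζ t 2 ^ 2 * areaForm (ζ t) (w t))) volume 0 1 :=
    (i2.continuousOn_mul ((cζ 2).pow 2)).const_mul μ
  -- the jet of the expansion
  have J := fun (k : ℕ) {m : ℝ → ℝ} (hm : IntervalIntegrable m volume 0 1) =>
    hasJet_weightedIntegral cn n0 hm k
  -- The kinetic and the magnetic part in Horner form in s. Terms beyond order s² do not affect the
  -- jet, but are needed for equality with the action.
  have jE := (J 1 iA).add (((J 1 iB).const_mul 2).add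
    ((J 1 iC).add ((J 2 iD).id_mul.id_mul.const_mul (-1))).id_mul).id_mul
  have jG := (J 2 iG0).add ((J 2 iG1).add ((J 2 iG2).add ((J 2 iG3).add
    (J 2 iG4).id_mul).id_mul).id_mul).id_mul
  have jS := ((((HasJet.inv_affine hT b).mul jE).const_mul (1 / 2)).add
    ((HasJet.affine T b).const_mul (1 / 2))).add jG
  refine ⟨_, (jS.congr ?_).congr_jet rfl ?_ ?_⟩
  · have hT' : ∀ᶠ s in 𝓝 (0 : ℝ), T + s * b ≠ 0 := by
      refine ContinuousAt.eventually_ne (by fun_prop) (by simpa using hT)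
    filter_upwards [hT'] with s hs
    have I := fun (k : ℕ) {m : ℝ → ℝ} (hm : IntervalIntegrable m volume 0 1) =>
      intervalIntegrable_weighted cn n0 hm k s
    have hne : ∀ᵐ t : ℝ, t ≠ 1 := by simp [ae_iff]
    -- The weak derivative is a pointwise derivative almost everywhere in the open interval; the
    -- endpoint 1 is a null set.
    have hae : ∀ᵐ t : ℝ, t ∈ uIoc (0 : ℝ) 1 →
        HasDerivAt ζ (w t) t := by
      filter_upwards [hasDerivAt_of_hasSobolevDeriv hζw, hne] with t h1 h2 ht
      rw [uIoc_of_le zero_le_one] at ht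
      exact h1 ⟨ht.1, lt_of_le_of_ne ht.2 h2⟩
    have hden : ∀ t, HasDerivAt ζ (w t) t → _ := fun t ht =>
      action_density (μ := μ) s (hq t) ht (hqq t) (hqζ t)
        (by have h := inner_add_inner_eq_zero (hq t) (hq t) hqq
            linarith [real_inner_comm (q t) (q' t)])
        (inner_add_inner_eq_zero (hq t) ht hqζ) (T + s * b)⁻¹
    have eL := intervalIntegral.integral_congr_ae (hae.mono fun t h ht =>
      congrArg (· + (1 / 2 : ℝ)) (hden t (h ht)).1)
    have eG := intervalIntegral.integral_congr_ae (hae.mono fun t h ht => (hden t (h ht)).2)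
    rw [action, eL, eG]
    have hE : ∀ t, ⟪q' t + s • w t, q' t + s • w t⟫_ℝ =
        ⟪q' t, q' t⟫_ℝ + s * (2 * ⟪q' t, w t⟫_ℝ + s * ⟪w t, w t⟫_ℝ) := fun t => by
      simp only [inner_add_left, inner_add_right, inner_smul_left, inner_smul_right, conj_trivial,
        real_inner_comm (q' t) (w t)]
      ring
    have kE := (((I 2 iD).const_mul s).const_mul s).const_mul (-1)
    have kE' := ((I 1 iC).add kE).const_mul s
    have kE'' := (((I 1 iB).const_mul 2).add kE').const_mul s
    have e1 := intervalIntegral.integral_add (((I 1 iA).add kE'').const_mul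
      (1 / 2 * (T + s * b)⁻¹ ^ 2)) (intervalIntegrable_const (c := (1 / 2 : ℝ)) (μ := volume))
    rw [intervalIntegral.integral_const_mul, intervalIntegral.integral_add (I 1 iA) kE'',
      intervalIntegral.integral_const_mul, intervalIntegral.integral_add ((I 1 iB).const_mul 2) kE',
      intervalIntegral.integral_const_mul, intervalIntegral.integral_const_mul,
      intervalIntegral.integral_add (I 1 iC) kE, intervalIntegral.integral_const_mul,
      intervalIntegral.integral_const_mul, intervalIntegral.integral_const_mul,
      intervalIntegral.integral_const, sub_zero, one_smul] at e1
    have kG3 := (I 2 iG4).const_mul s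
    have kG2 := ((I 2 iG3).add kG3).const_mul s
    have kG1 := ((I 2 iG2).add kG2).const_mul s
    have kG0 := ((I 2 iG1).add kG1).const_mul s
    have e2 := intervalIntegral.integral_add (I 2 iG0) kG0
    rw [intervalIntegral.integral_const_mul, intervalIntegral.integral_add (I 2 iG1) kG1,
      intervalIntegral.integral_const_mul, intervalIntegral.integral_add (I 2 iG2) kG2,
      intervalIntegral.integral_const_mul, intervalIntegral.integral_add (I 2 iG3) kG3,
      intervalIntegral.integral_const_mul] at e2
    simp only [weightedIntegral]
    rw [← e2, mul_comm (T + s * b)⁻¹]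
    have e3 : ∀ {x y z v : ℝ}, x = 1 / 2 * (T + s * b)⁻¹ ^ 2 * v + 1 / 2 → y = z →
        (T + s * b) * x + y = 1 / 2 * (v * (T + s * b)⁻¹) + 1 / 2 * (T + s * b) + z := by
      intro x y z v hx hy
      rw [hx, hy]
      field_simp
    refine e3 (Eq.trans ?_ e1) ?_
    · refine intervalIntegral.integral_congr fun t _ => ?_
      simp only [hE]
      ring
    · refine intervalIntegral.integral_congr fun t _ => ?_
      simp only [areaForm, PiLp.add_apply, PiLp.smul_apply, smul_eq_mul]
      ring
  · simp only [add_zero]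
    field_simp
    ring
  · simp only [mul_zero, add_zero, zero_add]
    push_cast
    generalize (∫ t in (0 : ℝ)..1, ⟪ζ t, ζ t⟫_ℝ * (μ * (q t 2 ^ 2 * areaForm (q t) (q' t)))) = I
    field_simp
    ring

/-! ### The second variation at a circle of latitude -/

/-- The circle of latitude of radius `r` and height `u`. -/
def circleLoop (r u t : ℝ) : E3 :=
  !₂[r * Real.cos (2 * Real.pi * t), r * Real.sin (2 * Real.pi * t), u]

/-- The velocity of the circle of latitude of radius `r`. -/
def circleVelocity (r t : ℝ) : E3 :=
  !₂[-(2 * Real.pi * r * Real.sin (2 * Real.pi * t)),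
    2 * Real.pi * r * Real.cos (2 * Real.pi * t), 0]

/-- The longitudinal component of a vector field along a circle of latitude. -/
def longitudinal (ζ : ℝ → E3) (t : ℝ) : ℝ :=
  -Real.sin (2 * Real.pi * t) * ζ t 0 + Real.cos (2 * Real.pi * t) * ζ t 1

/-- The latitudinal component of a vector field along a circle of latitude of radius `r`. -/
def latitudinal (r : ℝ) (ζ : ℝ → E3) (t : ℝ) : ℝ := ζ t 2 / r

/-- The derivative of the longitudinal component of a vector field with weak derivative `w`. -/
def longitudinalDeriv (r u : ℝ) (ζ w : ℝ → E3) (t : ℝ) : ℝ :=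
  longitudinal w t + 2 * Real.pi * u * latitudinal r ζ t

theorem baseLoop_circleOrbit {r : ℝ} (hr : 0 < r) (u : ℝ) :
    baseLoop (circleOrbit r u (1 / r)) (2 * Real.pi * r) = circleLoop r u := by
  funext t
  have e : 1 / r * (2 * Real.pi * r * t) = 2 * Real.pi * t := by field_simp
  simp only [baseLoop, circleOrbit, toPhase_apply, e]
  refine E3_ext ?_ ?_ ?_ <;> simp [circleLoop, rotPair, basePoint, mul_comm]

theorem hasDerivAt_trig (t : ℝ) :
    HasDerivAt (fun t => Real.cos (2 * Real.pi * t))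
      (-(2 * Real.pi * Real.sin (2 * Real.pi * t))) t ∧
    HasDerivAt (fun t => Real.sin (2 * Real.pi * t))
      (2 * Real.pi * Real.cos (2 * Real.pi * t)) t := by
  have h : HasDerivAt (fun t : ℝ => 2 * Real.pi * t) (2 * Real.pi) t := by
    simpa using (hasDerivAt_id t).const_mul (2 * Real.pi)
  exact ⟨h.cos.congr_deriv (by ring), h.sin.congr_deriv (by ring)⟩

theorem hasDerivAt_circleLoop (r u t : ℝ) :
    HasDerivAt (circleLoop r u) (circleVelocity r t) t := by
  obtain ⟨h1, h2⟩ := hasDerivAt_trig t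
  rw [hasDerivAt_E3]
  intro i
  fin_cases i
  · exact (h1.const_mul r).congr_deriv (by simp [circleVelocity]; ring)
  · exact (h2.const_mul r).congr_deriv (by simp [circleVelocity]; ring)
  · exact (hasDerivAt_const t u).congr_deriv (by simp [circleVelocity])

section frame

variable {r u : ℝ} {ζ w : ℝ → E3}

/-- The orthonormal frame is (-sin, cos, 0) and (-u cos, -u sin, r); tangency to the sphere recovers
the horizontal radial component from the height. -/
theorem frame_apply (hr : r ≠ 0) (hζ : ∀ t, ⟪circleLoop r u t, ζ t⟫_ℝ = 0) (t : ℝ) :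
    ζ t 0 = -Real.sin (2 * Real.pi * t) * longitudinal ζ t -
      u * Real.cos (2 * Real.pi * t) * latitudinal r ζ t ∧
    ζ t 1 = Real.cos (2 * Real.pi * t) * longitudinal ζ t -
      u * Real.sin (2 * Real.pi * t) * latitudinal r ζ t ∧
    ζ t 2 = r * latitudinal r ζ t := by
  have h := hζ t
  have hcs := Real.sin_sq_add_cos_sq (2 * Real.pi * t)
  simp only [inner_eq, circleLoop] at h
  simp at h
  have h' : Real.cos (2 * Real.pi * t) * ζ t 0 + Real.sin (2 * Real.pi * t) * ζ t 1 +
      u * (ζ t 2 / r) = 0 := by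
    field_simp
    linear_combination h
  simp only [longitudinal, latitudinal]
  refine ⟨?_, ?_, ?_⟩
  · linear_combination Real.cos (2 * Real.pi * t) * h' - ζ t 0 * hcs
  · linear_combination Real.sin (2 * Real.pi * t) * h' - ζ t 1 * hcs
  · field_simp

/-- The derivative w is not tangent; its normal part comes from differentiating ⟪q, ζ⟫ = 0, which
adds 2π times the longitudinal component to the horizontal radial direction. -/
theorem frame_deriv (hr : r ≠ 0) (hζ : ∀ t, ⟪circleLoop r u t, ζ t⟫_ℝ = 0) {t : ℝ}
    (hw : HasDerivAt ζ (w t) t) :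
    w t 0 = -Real.sin (2 * Real.pi * t) * longitudinal w t - Real.cos (2 * Real.pi * t) *
      (u * latitudinal r w t + 2 * Real.pi * longitudinal ζ t) ∧
    w t 1 = Real.cos (2 * Real.pi * t) * longitudinal w t - Real.sin (2 * Real.pi * t) *
      (u * latitudinal r w t + 2 * Real.pi * longitudinal ζ t) ∧
    w t 2 = r * latitudinal r w t := by
  have h := inner_add_inner_eq_zero (hasDerivAt_circleLoop r u t) hw hζ
  have hcs := Real.sin_sq_add_cos_sq (2 * Real.pi * t)
  simp only [inner_eq, circleLoop, circleVelocity] at h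
  simp at h
  have h' : Real.cos (2 * Real.pi * t) * w t 0 + Real.sin (2 * Real.pi * t) * w t 1 +
      (u * (w t 2 / r) + 2 * Real.pi * longitudinal ζ t) = 0 := by
    simp only [longitudinal]
    field_simp
    linear_combination h
  simp only [latitudinal]
  rw [eq_neg_of_add_eq_zero_right h']
  simp only [longitudinal]
  refine ⟨?_, ?_, ?_⟩
  · linear_combination - w t 0 * hcs
  · linear_combination - w t 1 * hcs
  · field_simp

end frame

section continuity

theorem continuous_cos_turn : Continuous fun t : ℝ => Real.cos (2 * Real.pi * t) := by fun_prop

theorem continuous_sin_turn : Continuous fun t : ℝ => Real.sin (2 * Real.pi * t) := by fun_prop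

variable {r : ℝ} (u : ℝ) {ζ w : ℝ → E3}

theorem hasSobolevDeriv_latitudinal
    (h : ∀ i, HasSobolevDeriv (fun t => ζ t i) (fun t => w t i)) :
    HasSobolevDeriv (latitudinal r ζ) (latitudinal r w) := by
  have e : ∀ ξ : ℝ → E3, latitudinal r ξ = fun t => r⁻¹ * ξ t 2 := fun ξ =>
    funext fun t => div_eq_inv_mul _ _
  rw [e, e]
  exact (h 2).const_mul r⁻¹

theorem continuousOn_longitudinal
    (h : ∀ i, HasSobolevDeriv (fun t => ζ t i) (fun t => w t i)) :
    ContinuousOn (longitudinal ζ) (Icc 0 1) :=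
  (continuous_sin_turn.neg.continuousOn.mul (h 0).continuousOn).add
    (continuous_cos_turn.continuousOn.mul (h 1).continuousOn)

theorem absolutelyContinuous_longitudinal
    (h : ∀ i, HasSobolevDeriv (fun t => ζ t i) (fun t => w t i)) :
    AbsolutelyContinuousOnInterval (longitudinal ζ) 0 1 := by
  have hs : AbsolutelyContinuousOnInterval (fun t => -Real.sin (2 * Real.pi * t)) 0 1 :=
    ContDiffOn.absolutelyContinuousOnInterval (by fun_prop)
  have hc : AbsolutelyContinuousOnInterval (fun t => Real.cos (2 * Real.pi * t)) 0 1 :=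
    ContDiffOn.absolutelyContinuousOnInterval (by fun_prop)
  exact (hs.fun_mul (h 0).absolutelyContinuous).fun_add (hc.fun_mul (h 1).absolutelyContinuous)

theorem hasDerivAt_longitudinal (hr : r ≠ 0) {u : ℝ}
    (hζ : ∀ t, ⟪circleLoop r u t, ζ t⟫_ℝ = 0) {t : ℝ} (hw : HasDerivAt ζ (w t) t) :
    HasDerivAt (longitudinal ζ) (longitudinalDeriv r u ζ w t) t := by
  obtain ⟨h1, h2⟩ := hasDerivAt_trig t
  have h3 := hasDerivAt_E3.1 hw
  refine ((h2.fun_neg.fun_mul (h3 0)).fun_add (h1.fun_mul (h3 1))).congr_deriv ?_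
  have h := hζ t
  simp only [inner_eq, circleLoop] at h
  simp at h
  simp only [longitudinalDeriv, longitudinal, latitudinal]
  field_simp
  linear_combination -(2 * Real.pi) * h

theorem intervalIntegrable_longitudinalDeriv
    (h : ∀ i, HasSobolevDeriv (fun t => ζ t i) (fun t => w t i)) :
    IntervalIntegrable (longitudinalDeriv r u ζ w) volume 0 1 ∧
    IntervalIntegrable (fun t => longitudinalDeriv r u ζ w t ^ 2) volume 0 1 := by
  have hy : ContinuousOn (fun t => 2 * Real.pi * u * latitudinal r ζ t) (uIcc 0 1) := by
    rw [uIcc_of_le zero_le_one]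
    exact continuousOn_const.mul (hasSobolevDeriv_latitudinal h).continuousOn
  have i1 : IntervalIntegrable (longitudinal w) volume 0 1 :=
    ((h 0).intervalIntegrable.continuousOn_mul continuous_sin_turn.neg.continuousOn).add
      ((h 1).intervalIntegrable.continuousOn_mul continuous_cos_turn.continuousOn)
  have i2 : IntervalIntegrable (fun t => longitudinal w t ^ 2) volume 0 1 := by
    have e : (fun t => longitudinal w t ^ 2) = fun t =>
        Real.sin (2 * Real.pi * t) ^ 2 * (w t 0 * w t 0) +
        -2 * Real.sin (2 * Real.pi * t) * Real.cos (2 * Real.pi * t) * (w t 0 * w t 1) +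
        Real.cos (2 * Real.pi * t) ^ 2 * (w t 1 * w t 1) := by
      funext t
      simp only [longitudinal]
      ring
    rw [e]
    refine ((((h 0).intervalIntegrable_mul (h 0)).continuousOn_mul
      (continuous_sin_turn.pow 2).continuousOn).add
      (((h 0).intervalIntegrable_mul (h 1)).continuousOn_mul (Continuous.continuousOn ?_))).add
      (((h 1).intervalIntegrable_mul (h 1)).continuousOn_mul
      (continuous_cos_turn.pow 2).continuousOn)
    fun_prop
  refine ⟨i1.add hy.intervalIntegrable, ?_⟩
  have e : (fun t => longitudinalDeriv r u ζ w t ^ 2) = fun t => longitudinal w t ^ 2 +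
      2 * (2 * Real.pi * u * latitudinal r ζ t * longitudinal w t) +
      (2 * Real.pi * u * latitudinal r ζ t) ^ 2 := by
    funext t
    simp only [longitudinalDeriv]
    ring
  rw [e]
  exact (i2.add ((i1.continuousOn_mul hy).const_mul 2)).add (hy.pow 2).intervalIntegrable

/-- Both integrands are derivatives of periodic absolutely continuous functions, x and xy. The first
kills the terms linear in X; the second trades ∫ xY for -∫ Xy in the second variation. -/
theorem integral_longitudinalDeriv (hr : r ≠ 0) {u : ℝ}
    (hζ : ∀ t, ⟪circleLoop r u t, ζ t⟫_ℝ = 0) (h01 : ζ 0 = ζ 1)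
    (h : ∀ i, HasSobolevDeriv (fun t => ζ t i) (fun t => w t i)) :
    (∫ t in (0 : ℝ)..1, longitudinalDeriv r u ζ w t) = 0 ∧
    (∫ t in (0 : ℝ)..1, (longitudinal ζ t * latitudinal r w t +
      longitudinalDeriv r u ζ w t * latitudinal r ζ t)) = 0 := by
  have hx01 : longitudinal ζ 0 = longitudinal ζ 1 := by simp [longitudinal, h01]
  have hy := hasSobolevDeriv_latitudinal (r := r) h
  have hae := hasDerivAt_of_hasSobolevDeriv h
  constructor
  · refine integral_eq_zero_of_ae_hasDerivAt (absolutelyContinuous_longitudinal h) ?_ hx01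
    filter_upwards [hae] with t ht ht' using hasDerivAt_longitudinal hr hζ (ht ht')
  · refine integral_eq_zero_of_ae_hasDerivAt
      (F := fun t => longitudinal ζ t * latitudinal r ζ t)
      ((absolutelyContinuous_longitudinal h).fun_mul hy.absolutelyContinuous) ?_ ?_
    · filter_upwards [hae, hy.ae_hasDerivAt] with t ht hty ht'
      refine ((hasDerivAt_longitudinal hr hζ (ht ht')).fun_mul (hty ht')).congr_deriv ?_
      ring
    · simp only [hx01, latitudinal, h01]

end continuity

section jet

variable {μ r u : ℝ} {ζ w : ℝ → E3}

/-- The ingredients of the second variation in the frame along a circle of latitude. -/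
theorem frame_identities (hr : r ≠ 0) (hru : r ^ 2 + u ^ 2 = 1)
    (hζ : ∀ t, ⟪circleLoop r u t, ζ t⟫_ℝ = 0) {q' : E3} {t x y X Y : ℝ}
    (hq' : q' = circleVelocity r t)
    (hx : longitudinal ζ t = x) (hy : latitudinal r ζ t = y)
    (hX : longitudinalDeriv r u ζ w t = X) (hY : latitudinal r w t = Y) :
    ⟪q', q'⟫_ℝ = (2 * Real.pi * r) ^ 2 ∧
    ⟪ζ t, ζ t⟫_ℝ = x ^ 2 + y ^ 2 ∧
    ζ t 2 = r * y ∧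
    areaForm (circleLoop r u t) q' = -2 * Real.pi * r ^ 2 ∧
    (HasDerivAt ζ (w t) t →
      ⟪q', w t⟫_ℝ = 2 * Real.pi * r * (X - 2 * Real.pi * u * y) ∧
      ⟪w t, w t⟫_ℝ = (X - 2 * Real.pi * u * y) ^ 2 + (u * Y + 2 * Real.pi * x) ^ 2 +
        r ^ 2 * Y ^ 2 ∧
      areaForm (circleLoop r u t) (w t) + areaForm (ζ t) q' = -r * X + 4 * Real.pi * r * u * y ∧
      areaForm (ζ t) (w t) = u * y * X - 2 * Real.pi * u ^ 2 * y ^ 2 - 2 * Real.pi * x ^ 2 -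
        u * x * Y) := by
  have hcs := Real.sin_sq_add_cos_sq (2 * Real.pi * t)
  obtain ⟨z0, z1, z2⟩ := frame_apply hr hζ t
  have hq0 : q' 0 = -(2 * Real.pi * r * Real.sin (2 * Real.pi * t)) := by simp [hq', circleVelocity]
  have hq1 : q' 1 = 2 * Real.pi * r * Real.cos (2 * Real.pi * t) := by simp [hq', circleVelocity]
  have hq2 : q' 2 = 0 := by simp [hq', circleVelocity]
  have c0 : circleLoop r u t 0 = r * Real.cos (2 * Real.pi * t) := by simp [circleLoop]
  have c1 : circleLoop r u t 1 = r * Real.sin (2 * Real.pi * t) := by simp [circleLoop]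
  have hX' : longitudinal w t = X - 2 * Real.pi * u * y := by
    rw [← hX, ← hy, longitudinalDeriv]
    ring
  rw [hx, hy] at z0 z1
  rw [hy] at z2
  simp only [inner_eq, areaForm, hq0, hq1, hq2, c0, c1]
  refine ⟨?_, ?_, z2, ?_, fun hw => ?_⟩
  · linear_combination (2 * Real.pi * r) ^ 2 * hcs
  · rw [z0, z1, z2]
    linear_combination (u ^ 2 * y ^ 2 + x ^ 2) * hcs + y ^ 2 * hru
  · linear_combination (-2 * Real.pi * r ^ 2) * hcs
  · obtain ⟨w0, w1, w2⟩ := frame_deriv hr hζ hw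
    rw [hX', hY, hx] at w0 w1
    rw [hY] at w2
    rw [w0, w1, w2, z0, z1]
    refine ⟨?_, ?_, ?_, ?_⟩
    · linear_combination (2 * Real.pi * r * (X - 2 * Real.pi * u * y)) * hcs
    · linear_combination ((X - 2 * Real.pi * u * y) ^ 2 + (u * Y + 2 * Real.pi * x) ^ 2) * hcs
    · linear_combination (-r * (X - 2 * Real.pi * u * y) + 2 * Real.pi * r * u * y) * hcs
    · linear_combination (u * y * (X - 2 * Real.pi * u * y) - x * (u * Y + 2 * Real.pi * x)) * hcs

/-- The expansion of the free time action along a variation of a circle of latitude. -/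
theorem hasJet_action_circleLoop (hr : 0 < r) (hru : r ^ 2 + u ^ 2 = 1)
    (hμ : 2 * μ * (2 * u ^ 2 - 1) * r = 1) (hζ : ∀ t, ⟪circleLoop r u t, ζ t⟫_ℝ = 0)
    (h01 : ζ 0 = ζ 1) (h : ∀ i, HasSobolevDeriv (fun t => ζ t i) (fun t => w t i)) (b : ℝ) :
    ∃ a, HasJet (fun s => action roundMetric (magneticPotential μ) (1 / 2)
        (variation (circleLoop r u) ζ s) (2 * Real.pi * r + s * b)) a 0
      ((2 * Real.pi * r)⁻¹ * ∫ t in (0 : ℝ)..1, (latitudinal r w t ^ 2 -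
        (normalFrequency μ r u (1 / r) * (2 * Real.pi * r) ^ 2) * latitudinal r ζ t ^ 2 +
        (longitudinalDeriv r u ζ w t - 2 * Real.pi * u * latitudinal r ζ t - b) ^ 2)) := by
  have hr0 : r ≠ 0 := hr.ne'
  have hpi := Real.pi_pos.ne'
  have hT : 2 * Real.pi * r ≠ 0 := by positivity
  have hqq : ∀ t, ⟪circleLoop r u t, circleLoop r u t⟫_ℝ = 1 := fun t => by
    rw [inner_eq]
    simp only [circleLoop]
    simp
    linear_combination r ^ 2 * Real.sin_sq_add_cos_sq (2 * Real.pi * t) + hru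
  have hq'c : Continuous (circleVelocity r) := by
    refine (PiLp.continuous_toLp 2 _).comp (continuous_pi fun i => ?_)
    fin_cases i <;> simp <;> fun_prop
  obtain ⟨a, J⟩ := hasJet_action (μ := μ) hT b (hasDerivAt_circleLoop r u) hq'c hqq hζ h
  have F := fun t => frame_identities (w := w) (t := t) hr0 hru hζ rfl rfl rfl rfl rfl
  have hu : ∀ t, circleLoop r u t 2 = u := fun t => by simp [circleLoop]
  have hne : ∀ᵐ t : ℝ, t ≠ 1 := by simp [ae_iff]
  have hae : ∀ᵐ t : ℝ, t ∈ uIoc (0 : ℝ) 1 → HasDerivAt ζ (w t) t := by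
    filter_upwards [hasDerivAt_of_hasSobolevDeriv h, hne] with t h1 h2 ht
    rw [uIoc_of_le zero_le_one] at ht
    exact h1 ⟨ht.1, lt_of_le_of_ne ht.2 h2⟩
  obtain ⟨iX, iXX⟩ := intervalIntegrable_longitudinalDeriv (r := r) u h
  obtain ⟨hX0, hxy⟩ := integral_longitudinalDeriv hr0 hζ h01 h
  have hy := hasSobolevDeriv_latitudinal (r := r) h
  have cy := hy.continuousOn
  have cx := continuousOn_longitudinal h
  rw [← uIcc_of_le zero_le_one] at cx cy
  have iY := hy.intervalIntegrable
  have iYY := hy.intervalIntegrable_sq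
  simp only [(F _).1, (F _).2.1, (F _).2.2.1, (F _).2.2.2.1, hu] at J
  have eB := intervalIntegral.integral_congr_ae (hae.mono fun t ht h' =>
    ((F t).2.2.2.2 (ht h')).1)
  have eC := intervalIntegral.integral_congr_ae (hae.mono fun t ht h' =>
    ((F t).2.2.2.2 (ht h')).2.1)
  have eG1 : ∀ α : ℝ → ℝ, (∫ t in (0 : ℝ)..1, μ * (u ^ 2 * (areaForm (circleLoop r u t) (w t) +
      areaForm (ζ t) (circleVelocity r t)) + α t)) = ∫ t in (0 : ℝ)..1, μ * (u ^ 2 * (-r *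
      longitudinalDeriv r u ζ w t + 4 * Real.pi * r * u * latitudinal r ζ t) + α t) :=
    fun α => intervalIntegral.integral_congr_ae (hae.mono fun t ht h' => by
      simp only [((F t).2.2.2.2 (ht h')).2.2.1])
  have eG2 := intervalIntegral.integral_congr_ae (hae.mono fun t ht h' => by
    have h1 := ((F t).2.2.2.2 (ht h')).2.2
    exact congrArg₂ (fun p q => μ * (u ^ 2 * q + 2 * u * (r * latitudinal r ζ t) * p +
      (r * latitudinal r ζ t) ^ 2 * (-2 * Real.pi * r ^ 2))) h1.1 h1.2)
  rw [eB, eC, eG1, eG2] at J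
  generalize hXd : longitudinalDeriv r u ζ w = X at *
  generalize hyd : latitudinal r ζ = y at *
  generalize hYd : latitudinal r w = Y at *
  generalize hxd : longitudinal ζ = x at *
  have iXy := iX.mul_continuousOn cy
  have iyy : IntervalIntegrable (fun t => y t ^ 2) volume 0 1 := (cy.pow 2).intervalIntegrable
  have ixY := iY.continuousOn_mul cx
  have ixx : IntervalIntegrable (fun t => x t ^ 2) volume 0 1 := (cx.pow 2).intervalIntegrable
  have iy := cy.intervalIntegrable (μ := volume)
  -- All integrals in the jet are combinations of these moments, so the comparison of the two forms
  -- of the second variation becomes polynomial algebra.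
  have comb : ∀ c₁ c₂ c₃ c₄ c₅ c₆ c₇ c₈ c₉ : ℝ, (∫ t in (0 : ℝ)..1, (c₁ * X t ^ 2 +
      c₂ * (X t * y t) + c₃ * y t ^ 2 + c₄ * Y t ^ 2 + c₅ * (x t * Y t) + c₆ * x t ^ 2 +
      c₇ * X t + c₈ * y t + c₉)) = c₁ * (∫ t in (0 : ℝ)..1, X t ^ 2) +
      c₂ * (∫ t in (0 : ℝ)..1, X t * y t) + c₃ * (∫ t in (0 : ℝ)..1, y t ^ 2) +
      c₄ * (∫ t in (0 : ℝ)..1, Y t ^ 2) + c₅ * (∫ t in (0 : ℝ)..1, x t * Y t) +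
      c₆ * (∫ t in (0 : ℝ)..1, x t ^ 2) + c₇ * (∫ t in (0 : ℝ)..1, X t) +
      c₈ * (∫ t in (0 : ℝ)..1, y t) + c₉ := by
    intro c₁ c₂ c₃ c₄ c₅ c₆ c₇ c₈ c₉
    have k1 := iXX.const_mul c₁
    have k2 := k1.add (iXy.const_mul c₂)
    have k3 := k2.add (iyy.const_mul c₃)
    have k4 := k3.add (iYY.const_mul c₄)
    have k5 := k4.add (ixY.const_mul c₅)
    have k6 := k5.add (ixx.const_mul c₆)
    have k7 := k6.add (iX.const_mul c₇)
    have k8 := k7.add (iy.const_mul c₈)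
    rw [intervalIntegral.integral_add k8 intervalIntegrable_const,
      intervalIntegral.integral_add k7 (iy.const_mul c₈),
      intervalIntegral.integral_add k6 (iX.const_mul c₇),
      intervalIntegral.integral_add k5 (ixx.const_mul c₆),
      intervalIntegral.integral_add k4 (ixY.const_mul c₅),
      intervalIntegral.integral_add k3 (iYY.const_mul c₄),
      intervalIntegral.integral_add k2 (iyy.const_mul c₃),
      intervalIntegral.integral_add k1 (iXy.const_mul c₂)]
    simp only [intervalIntegral.integral_const_mul, intervalIntegral.integral_const, sub_zero,
      one_smul]
  have hxy' : (∫ t in (0 : ℝ)..1, x t * Y t) + (∫ t in (0 : ℝ)..1, X t * y t) = 0 := by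
    rw [← intervalIntegral.integral_add ixY iXy]
    exact hxy
  have kA : (∫ t in (0 : ℝ)..1, (2 * Real.pi * r) ^ 2) = _ :=
    (intervalIntegral.integral_congr fun t _ => by ring).trans
      (comb 0 0 0 0 0 0 0 0 ((2 * Real.pi * r) ^ 2))
  have kB : (∫ t in (0 : ℝ)..1, 2 * Real.pi * r * (X t - 2 * Real.pi * u * y t)) = _ :=
    (intervalIntegral.integral_congr fun t _ => by ring).trans
      (comb 0 0 0 0 0 0 (2 * Real.pi * r) (-4 * Real.pi ^ 2 * r * u) 0)
  have kG1 : (∫ t in (0 : ℝ)..1, μ * (u ^ 2 * (-r * X t +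
      4 * Real.pi * r * u * y t) + 2 * u * (r * y t) * (-2 * Real.pi * r ^ 2))) = _ :=
    (intervalIntegral.integral_congr fun t _ => by ring).trans
      (comb 0 0 0 0 0 0 (-μ * u ^ 2 * r)
        (4 * Real.pi * μ * u ^ 3 * r - 4 * Real.pi * μ * u * r ^ 3) 0)
  have kC : (∫ t in (0 : ℝ)..1, ((X t - 2 * Real.pi * u * y t) ^ 2 +
      (u * Y t + 2 * Real.pi * x t) ^ 2 + r ^ 2 * Y t ^ 2)) = _ :=
    (intervalIntegral.integral_congr fun t _ => by ring).trans
      (comb 1 (-4 * Real.pi * u) (4 * Real.pi ^ 2 * u ^ 2) (u ^ 2 + r ^ 2) (4 * Real.pi * u)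
        (4 * Real.pi ^ 2) 0 0 0)
  have kn : (∫ t in (0 : ℝ)..1, (x t ^ 2 + y t ^ 2) * (2 * Real.pi * r) ^ 2) = _ :=
    (intervalIntegral.integral_congr fun t _ => by ring).trans
      (comb 0 0 ((2 * Real.pi * r) ^ 2) 0 0 ((2 * Real.pi * r) ^ 2) 0 0 0)
  have kG0 : (∫ t in (0 : ℝ)..1, (x t ^ 2 + y t ^ 2) *
      (μ * (u ^ 2 * (-2 * Real.pi * r ^ 2)))) = _ :=
    (intervalIntegral.integral_congr fun t _ => by ring).trans
      (comb 0 0 (-2 * Real.pi * μ * u ^ 2 * r ^ 2) 0 0 (-2 * Real.pi * μ * u ^ 2 * r ^ 2) 0 0 0)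
  have kG2 : (∫ t in (0 : ℝ)..1, μ * (u ^ 2 * (u * y t * X t - 2 * Real.pi * u ^ 2 * y t ^ 2 -
      2 * Real.pi * x t ^ 2 - u * x t * Y t) + 2 * u * (r * y t) * (-r * X t +
      4 * Real.pi * r * u * y t) + (r * y t) ^ 2 * (-2 * Real.pi * r ^ 2))) = _ :=
    (intervalIntegral.integral_congr fun t _ => by ring).trans
      (comb 0 (μ * (u ^ 3 - 2 * u * r ^ 2)) (μ * (-2 * Real.pi * u ^ 4 + 8 * Real.pi * u ^ 2 * r ^ 2 -
        2 * Real.pi * r ^ 4)) 0 (-μ * u ^ 3) (-2 * Real.pi * μ * u ^ 2) 0 0 0)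
  have kQ : (∫ t in (0 : ℝ)..1, (Y t ^ 2 - normalFrequency μ r u (1 / r) * (2 * Real.pi * r) ^ 2 *
      y t ^ 2 + (X t - 2 * Real.pi * u * y t - b) ^ 2)) = _ :=
    (intervalIntegral.integral_congr fun t _ => by ring).trans
      (comb 1 (-4 * Real.pi * u) (4 * Real.pi ^ 2 * u ^ 2 -
        normalFrequency μ r u (1 / r) * (2 * Real.pi * r) ^ 2) 1 0 0 (-2 * b)
        (4 * Real.pi * u * b) (b ^ 2))
  rw [kA, kB, kG1, kC, kn, kG0, kG2] at J
  rw [kQ]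
  simp only [hX0, zero_mul, mul_zero, zero_add, add_zero] at J ⊢
  have hτ := inv_mul_cancel₀ hT
  have e1 : -b / (2 * (2 * Real.pi * r) ^ 2) * (2 * Real.pi * r) ^ 2 = -b / 2 := by field_simp
  have e2 : b ^ 2 / (2 * Real.pi * r) ^ 3 * (2 * Real.pi * r) ^ 2 = (2 * Real.pi * r)⁻¹ * b ^ 2 := by
    field_simp
  have e3 : 2 * b / (2 * Real.pi * r) ^ 2 = 2 * b * (2 * Real.pi * r)⁻¹ ^ 2 := by field_simp
  rw [e1, e2, e3] at J
  generalize (2 * Real.pi * r)⁻¹ = τ at *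
  refine ⟨a, J.congr_jet rfl ?_ ?_⟩
  -- First order: the terms in b cancel because the speed is one, and the kinetic and magnetic
  -- contributions of the mean latitude cancel by the orbit equation `hμ`.
  · generalize (∫ t in (0 : ℝ)..1, y t) = I at *
    linear_combination 2 * Real.pi * u * I * (hμ - 2 * μ * r * hru - hτ)
  · have hκ : normalFrequency μ r u (1 / r) * (2 * Real.pi * r) ^ 2 = 4 * Real.pi ^ 2 *
        (r ^ 2 - 12 * μ * u ^ 2 * r ^ 3 + 2 * μ * r ^ 3 + u ^ 2) := by
      rw [normalFrequency, fieldStrength]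
      field_simp
      linear_combination 4 * u ^ 2 * (2 * μ * (2 * u ^ 2 - 1) * r + 1) * hμ
    rw [hκ]
    generalize (∫ t in (0 : ℝ)..1, y t) = I at *
    generalize (∫ t in (0 : ℝ)..1, y t ^ 2) = Iyy at *
    generalize (∫ t in (0 : ℝ)..1, Y t ^ 2) = IYY at *
    generalize (∫ t in (0 : ℝ)..1, x t ^ 2) = Ixx at *
    generalize (∫ t in (0 : ℝ)..1, X t ^ 2) = IXX at *
    generalize (∫ t in (0 : ℝ)..1, x t * Y t) = IxY at *
    generalize (∫ t in (0 : ℝ)..1, X t * y t) = IXy at *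
    linear_combination τ * (Ixx * (4 * Real.pi ^ 2) *
        ((-1 + 4 * μ * u ^ 2 * r) * hru - u ^ 2 * hμ) + IYY * hru +
      (4 * Real.pi * u - 4 * Real.pi * r * μ * u ^ 3) * hxy' +
      IXy * (4 * Real.pi * u) * (hμ - 2 * r * μ * hru) +
      Iyy * (4 * Real.pi ^ 2) * (-2 * μ * r * (r ^ 2 - u ^ 2) * hru - u ^ 2 * hμ)) +
      (4 * Real.pi * u * b * I * τ + 4 * (-2 * Real.pi * μ * u ^ 2 * r ^ 2) * (Iyy + Ixx) -
      2 * (μ * (u ^ 3 - 2 * u * r ^ 2) * IXy + μ * (-2 * Real.pi * u ^ 4 +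
      8 * Real.pi * u ^ 2 * r ^ 2 - 2 * Real.pi * r ^ 4) * Iyy - μ * u ^ 3 * IxY -
      2 * Real.pi * μ * u ^ 2 * Ixx)) * hτ

end jet

/-! ### Morse indices -/

section negativeIndex

variable {F : Type} [AddCommGroup F] [Module ℝ F] {V : Submodule ℝ F} {Q : F → ℝ}

theorem negativeIndex_eq_zero (h : ∀ v ∈ V, 0 ≤ Q v) : negativeIndex V Q = 0 := by
  refine le_antisymm (iSup₂_le fun W hWV => iSup_le fun hW => ?_) bot_le
  have : W = ⊥ := (Submodule.eq_bot_iff W).2 fun x hx => by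
    by_contra hne
    exact absurd (hW x hx hne) (not_lt.2 (h x (hWV hx)))
  subst this
  simp

/-- A negative definite subspace meets the kernel of L trivially, so L embeds it in ℝ. -/
theorem negativeIndex_le_one (L : V →ₗ[ℝ] ℝ) (h : ∀ v : V, L v = 0 → 0 ≤ Q v) :
    negativeIndex V Q ≤ 1 := by
  refine iSup₂_le fun W hWV => iSup_le fun hW => ?_
  have hinj : Function.Injective (L ∘ₗ Submodule.inclusion hWV) := by
    rw [← LinearMap.ker_eq_bot, LinearMap.ker_eq_bot']
    intro x hx
    by_contra hne
    exact absurd (hW x x.2 fun h0 => hne (Subtype.ext h0))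
      (not_lt.2 (h (Submodule.inclusion hWV x) hx))
  have h1 := LinearMap.rank_le_of_injective _ hinj
  rw [Module.rank_self] at h1
  simpa using Cardinal.toENat.monotone' h1

theorem one_le_negativeIndex {v : F} (hv : v ≠ 0) (hvV : v ∈ V)
    (h : ∀ c : ℝ, c ≠ 0 → Q (c • v) < 0) : 1 ≤ negativeIndex V Q := by
  have hW : Submodule.span ℝ {v} ≤ V := (Submodule.span_singleton_le_iff_mem _ _).2 hvV
  have hQ : ∀ w ∈ Submodule.span ℝ {v}, w ≠ 0 → Q w < 0 := by
    intro w hw hne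
    obtain ⟨c, rfl⟩ := Submodule.mem_span_singleton.1 hw
    exact h c fun hc => hne (by rw [hc, zero_smul])
  refine le_trans ?_ (le_iSup₂_of_le (Submodule.span ℝ {v}) hW (le_iSup_of_le hQ le_rfl))
  have h1 : Module.rank ℝ (Submodule.span ℝ {v}) = 1 := by
    rw [rank_submodule_eq_one_iff]
    exact ⟨v, Submodule.mem_span_singleton_self v, hv, le_rfl⟩
  rw [h1]
  simp

end negativeIndex

section circle

variable {μ r u : ℝ}

theorem exists_weakDeriv {q ζ : ℝ → E3} (hζ : ζ ∈ loopTangent q) :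
    (∀ t, ⟪q t, ζ t⟫_ℝ = 0) ∧ ζ 0 = ζ 1 ∧
      ∃ w : ℝ → E3, ∀ i, HasSobolevDeriv (fun t => ζ t i) (fun t => w t i) := by
  obtain ⟨⟨hper, w, hw, hζw⟩, ht⟩ := hζ
  refine ⟨ht, ?_, w, hasSobolevDeriv_apply hw hζw⟩
  have := hper 0
  rw [zero_add] at this
  exact this.symm

/-- The mean of the latitudinal component, as a linear functional on vector fields along a loop. -/
def meanLatitude (r : ℝ) (q : ℝ → E3) : loopTangent q →ₗ[ℝ] ℝ where
  toFun ζ := ∫ t in (0 : ℝ)..1, latitudinal r ζ t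
  map_add' ζ η := by
    have hi : ∀ ζ : loopTangent q, IntervalIntegrable (latitudinal r ζ) volume 0 1 := fun ζ => by
      obtain ⟨-, -, w, hw⟩ := exists_weakDeriv ζ.2
      refine ContinuousOn.intervalIntegrable ?_
      rw [uIcc_of_le zero_le_one]
      exact (hasSobolevDeriv_latitudinal hw).continuousOn
    rw [← intervalIntegral.integral_add (hi ζ) (hi η)]
    refine intervalIntegral.integral_congr fun t _ => ?_
    simp [latitudinal, add_div]
  map_smul' c ζ := by
    rw [RingHom.id_apply, smul_eq_mul, ← intervalIntegral.integral_const_mul]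
    refine intervalIntegral.integral_congr fun t _ => ?_
    simp [latitudinal, mul_div_assoc]

theorem isCriticalPoint_circleLoop (hr : 0 < r) (hru : r ^ 2 + u ^ 2 = 1)
    (hμ : 2 * μ * (2 * u ^ 2 - 1) * r = 1) :
    IsCriticalPoint roundMetric (magneticPotential μ) (1 / 2) (circleLoop r u)
      (2 * Real.pi * r) := by
  intro ζ hζ b
  obtain ⟨h1, h2, w, hw⟩ := exists_weakDeriv hζ
  obtain ⟨a, J⟩ := hasJet_action_circleLoop hr hru hμ h1 h2 hw b
  exact J.hasDerivAt

theorem freeHessian_circleLoop (hr : 0 < r) (hru : r ^ 2 + u ^ 2 = 1)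
    (hμ : 2 * μ * (2 * u ^ 2 - 1) * r = 1) {ζ w : ℝ → E3}
    (hζ : ∀ t, ⟪circleLoop r u t, ζ t⟫_ℝ = 0) (h01 : ζ 0 = ζ 1)
    (h : ∀ i, HasSobolevDeriv (fun t => ζ t i) (fun t => w t i)) (b : ℝ) :
    freeHessian roundMetric (magneticPotential μ) (1 / 2) (circleLoop r u) (2 * Real.pi * r)
      (ζ, b) = (2 * Real.pi * r)⁻¹ * ∫ t in (0 : ℝ)..1, (latitudinal r w t ^ 2 -
        (normalFrequency μ r u (1 / r) * (2 * Real.pi * r) ^ 2) * latitudinal r ζ t ^ 2 +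
        (longitudinalDeriv r u ζ w t - 2 * Real.pi * u * latitudinal r ζ t - b) ^ 2) := by
  obtain ⟨a, J⟩ := hasJet_action_circleLoop hr hru hμ hζ h01 h b
  exact J.iteratedDeriv_two

theorem fixedHessian_eq {g : SphereMetric} {ψ : SphereOneForm} {k T : ℝ} {q ζ : ℝ → E3} :
    fixedHessian g ψ k q T ζ = freeHessian g ψ k q T (ζ, 0) := by
  simp only [fixedHessian, freeHessian, mul_zero, add_zero]

/-- Reduces both index computations to a quadratic form in two real variables, the mean latitude and
the period variation. -/
theorem le_freeHessian (hr : 0 < r) (hru : r ^ 2 + u ^ 2 = 1)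
    (hμ : 2 * μ * (2 * u ^ 2 - 1) * r = 1)
    (hκ : normalFrequency μ r u (1 / r) * (2 * Real.pi * r) ^ 2 < 1)
    (ζ : loopTangent (circleLoop r u)) (b : ℝ) :
    (2 * Real.pi * r)⁻¹ * ((2 * Real.pi * u * meanLatitude r _ ζ + b) ^ 2 -
      normalFrequency μ r u (1 / r) * (2 * Real.pi * r) ^ 2 * meanLatitude r _ ζ ^ 2) ≤
    freeHessian roundMetric (magneticPotential μ) (1 / 2) (circleLoop r u) (2 * Real.pi * r)
      (ζ, b) := by
  obtain ⟨h1, h2, w, hw⟩ := exists_weakDeriv ζ.2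
  rw [freeHessian_circleLoop hr hru hμ h1 h2 hw]
  obtain ⟨iX, iXX⟩ := intervalIntegrable_longitudinalDeriv (r := r) u hw
  have := le_integral_quadratic (hasSobolevDeriv_latitudinal (r := r) hw) iX iXX
    (integral_longitudinalDeriv hr.ne' h1 h2 hw).1 hκ.le (2 * Real.pi * u) b
  exact mul_le_mul_of_nonneg_left this (by positivity)

/-- Because T = 2πr, the lower bound with b = 0 is T⁻¹(2πm)²(u² - r²κ). -/
theorem fixedIndex_circleLoop (hr : 0 < r) (hru : r ^ 2 + u ^ 2 = 1)
    (hμ : 2 * μ * (2 * u ^ 2 - 1) * r = 1)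
    (hκ : normalFrequency μ r u (1 / r) * (2 * Real.pi * r) ^ 2 < 1)
    (hκu : r ^ 2 * normalFrequency μ r u (1 / r) ≤ u ^ 2) :
    fixedIndex roundMetric (magneticPotential μ) (1 / 2) (circleLoop r u)
      (2 * Real.pi * r) = 0 := by
  refine negativeIndex_eq_zero fun ζ hζ => ?_
  rw [fixedHessian_eq]
  refine le_trans ?_ (le_freeHessian hr hru hμ hκ ⟨ζ, hζ⟩ 0)
  generalize meanLatitude r (circleLoop r u) ⟨ζ, hζ⟩ = m
  refine mul_nonneg (by positivity) ?_
  have h1 : 0 ≤ (2 * Real.pi * m) ^ 2 * (u ^ 2 - r ^ 2 * normalFrequency μ r u (1 / r)) :=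
    mul_nonneg (sq_nonneg _) (sub_nonneg.2 hκu)
  linarith

/-- The latitudinal unit vector field along a circle of latitude. -/
def northField (r u t : ℝ) : E3 :=
  !₂[-u * Real.cos (2 * Real.pi * t), -u * Real.sin (2 * Real.pi * t), r]

/-- The derivative of the latitudinal unit vector field. -/
def northFieldDeriv (u t : ℝ) : E3 :=
  !₂[u * (2 * Real.pi * Real.sin (2 * Real.pi * t)),
    -u * (2 * Real.pi * Real.cos (2 * Real.pi * t)), 0]

theorem northField_mem_loopTangent : northField r u ∈ loopTangent (circleLoop r u) ∧
    ∀ i, HasSobolevDeriv (fun t => northField r u t i) (fun t => northFieldDeriv u t i) := by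
  have hd : ∀ t, HasDerivAt (northField r u) (northFieldDeriv u t) t := fun t => by
    obtain ⟨h1, h2⟩ := hasDerivAt_trig t
    rw [hasDerivAt_E3]
    intro i
    fin_cases i
    · exact (h1.const_mul (-u)).congr_deriv (by simp [northFieldDeriv])
    · exact (h2.const_mul (-u)).congr_deriv (by simp [northFieldDeriv])
    · exact (hasDerivAt_const t r).congr_deriv (by simp [northFieldDeriv])
  have hc : Continuous (northFieldDeriv u) := by
    refine (PiLp.continuous_toLp 2 _).comp (continuous_pi fun i => ?_)
    fin_cases i <;> simp <;> fun_prop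
  have hL : MemLp (northFieldDeriv u) 2 (volume.restrict (Ioc (0 : ℝ) 1)) := by
    obtain ⟨C, hC⟩ := isCompact_Icc.exists_bound_of_continuousOn (s := Icc (0 : ℝ) 1)
      hc.continuousOn
    refine MemLp.of_bound hc.aestronglyMeasurable C ?_
    filter_upwards [ae_restrict_mem measurableSet_Ioc] with t ht
    exact hC t (Ioc_subset_Icc_self ht)
  have hI : ∀ t ∈ Icc (0 : ℝ) 1, northField r u t = northField r u 0 +
      ∫ s in (0 : ℝ)..t, northFieldDeriv u s := fun t _ => by
    rw [intervalIntegral.integral_eq_sub_of_hasDerivAt (fun s _ => hd s)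
      (hc.intervalIntegrable 0 t)]
    abel
  refine ⟨⟨⟨fun t => ?_, _, hL, hI⟩, fun t => ?_⟩, hasSobolevDeriv_apply hL hI⟩
  · simp only [northField, mul_add, mul_one, Real.cos_add_two_pi, Real.sin_add_two_pi]
  · change ⟪_, _⟫_ℝ = 0
    rw [inner_eq]
    simp only [circleLoop, northField]
    simp
    linear_combination - r * u * Real.sin_sq_add_cos_sq (2 * Real.pi * t)

theorem freeIndex_circleLoop (hr : 0 < r) (hru : r ^ 2 + u ^ 2 = 1)
    (hμ : 2 * μ * (2 * u ^ 2 - 1) * r = 1) (hκ₀ : 0 < normalFrequency μ r u (1 / r))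
    (hκ : normalFrequency μ r u (1 / r) * (2 * Real.pi * r) ^ 2 < 1) :
    freeIndex roundMetric (magneticPotential μ) (1 / 2) (circleLoop r u)
      (2 * Real.pi * r) = 1 := by
  obtain ⟨hN, hNw⟩ := northField_mem_loopTangent (r := r) (u := u)
  -- Upper bound: the Hessian is nonnegative where the mean latitude vanishes. Lower bound: on the
  -- latitudinal unit field the choice b = -2πu annihilates the completed square and leaves -κT²
  -- times a positive factor.
  refine le_antisymm (negativeIndex_le_one
    { toFun := fun v => meanLatitude r _ ⟨v.1.1, v.2.1⟩
      map_add' := fun v v' => (meanLatitude r _).map_add ⟨v.1.1, v.2.1⟩ ⟨v'.1.1, v'.2.1⟩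
      map_smul' := fun c v => (meanLatitude r _).map_smul c ⟨v.1.1, v.2.1⟩ } fun v hv => ?_)
    (one_le_negativeIndex (v := (northField r u, -(2 * Real.pi * u))) ?_ ⟨hN, trivial⟩
      fun c hc => ?_)
  · refine le_trans ?_ (le_freeHessian hr hru hμ hκ ⟨v.1.1, v.2.1⟩ v.1.2)
    change meanLatitude r _ ⟨v.1.1, v.2.1⟩ = 0 at hv
    rw [hv]
    have := hr.le
    simp only [mul_zero, zero_add, ne_eq, OfNat.ofNat_ne_zero, not_false_eq_true, zero_pow,
      sub_zero]
    positivity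
  · intro h
    have h1 := congrArg (fun v : (ℝ → E3) × ℝ => v.1 0 2) h
    simp [northField] at h1
    exact hr.ne' h1
  · have hcN := (loopTangent (circleLoop r u)).smul_mem c hN
    obtain ⟨h1, h2, -⟩ := exists_weakDeriv hcN
    have hw : ∀ i, HasSobolevDeriv (fun t => (c • northField r u) t i)
        (fun t => (c • northFieldDeriv u) t i) := fun i => (hNw i).const_mul c
    change freeHessian _ _ _ _ _ (c • northField r u, c * -(2 * Real.pi * u)) < 0
    rw [freeHessian_circleLoop hr hru hμ h1 h2 hw]
    have e : ∀ t, latitudinal r (c • northFieldDeriv u) t ^ 2 -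
        (normalFrequency μ r u (1 / r) * (2 * Real.pi * r) ^ 2) *
        latitudinal r (c • northField r u) t ^ 2 +
        (longitudinalDeriv r u (c • northField r u) (c • northFieldDeriv u) t -
        2 * Real.pi * u * latitudinal r (c • northField r u) t - c * -(2 * Real.pi * u)) ^ 2 =
        -(normalFrequency μ r u (1 / r) * (2 * Real.pi * r * c) ^ 2) := fun t => by
      have a1 : latitudinal r (c • northFieldDeriv u) t = 0 := by
        simp [latitudinal, northFieldDeriv]
      have a2 : latitudinal r (c • northField r u) t = c := by
        simp [latitudinal, northField, hr.ne']
      have a3 : longitudinal (c • northFieldDeriv u) t = -(2 * Real.pi * u * c) := by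
        simp [longitudinal, northFieldDeriv]
        linear_combination (-(2 * Real.pi * u * c)) * Real.sin_sq_add_cos_sq (2 * Real.pi * t)
      rw [longitudinalDeriv, a1, a2, a3]
      ring
    simp only [e, intervalIntegral.integral_const, sub_zero, one_smul]
    have hc2 : 0 < c ^ 2 := by positivity
    have : 0 < (2 * Real.pi * r)⁻¹ * (normalFrequency μ r u (1 / r) * (2 * Real.pi * r * c) ^ 2) := by
      positivity
    rw [mul_neg]
    linarith

end circle

/-! ### Orbit cylinders about the two orbits -/

theorem contDiffOn_sqrt_two_mul {ε : ℝ} (hε : ε ≤ 1 / 2) :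
    ContDiffOn ℝ ∞ (fun e => √(2 * e)) (Ioo (1 / 2 - ε) (1 / 2 + ε)) := by
  refine ContDiffOn.sqrt (by fun_prop) fun e he => ?_
  have := he.1
  exact (by linarith : 0 < 2 * e).ne'

/-- The equator, run through in the negative direction, belongs to the cylinder of equators. -/
theorem nonempty_orbitCylinder_equator (μ : ℝ) :
    Nonempty (OrbitCylinder roundMetric (magneticPotential μ) (1 / 2) (2 * Real.pi)
      (circleOrbit 1 0 (-1))) := by
  have hpos : ∀ e ∈ Ioo (1 / 2 - 1 / 2 : ℝ) (1 / 2 + 1 / 2), 0 < 2 * e := fun e he => by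
    have := he.1
    linarith
  refine nonempty_orbitCylinder (ρ := fun _ => 1) (υ := fun _ => 0) (w := fun e => -√(2 * e))
    (ε := 1 / 2) (by norm_num) (Or.inr rfl) contDiffOn_const contDiffOn_const
    (contDiffOn_sqrt_two_mul le_rfl).neg (fun e he => ?_)
    (fun e he => ⟨by norm_num, by simp [fieldStrength]⟩) (fun e he => ?_) rfl rfl ?_ ?_
  · have := Real.sqrt_pos.2 (hpos e he)
    linarith
  · rw [neg_sq, Real.sq_sqrt (hpos e he).le]
    ring
  · norm_num
  · norm_num

/-- The circles of latitude near one of radius `r < 6 ^ (-1/2)` form an orbit cylinder. -/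
theorem nonempty_orbitCylinder_latitude {μ r u : ℝ} (hr : 0 < r) (hu : 0 < u)
    (hr6 : r ^ 2 < 1 / 6) (hru : r ^ 2 + u ^ 2 = 1) (hμ : 2 * μ * (2 * u ^ 2 - 1) * r = 1) :
    Nonempty (OrbitCylinder roundMetric (magneticPotential μ) (1 / 2) (2 * Real.pi * r)
      (circleOrbit r u (1 / r))) := by
  -- The energy relation 2μρ(1 - 2ρ²) = √(2e) is a cubic. With ρ = s sin θ and s² = 2/3 the triple
  -- angle formula turns it into sin 3θ = A√(2e), A = 3/(2μs), which is inverted smoothly by the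
  -- arcsine.
  set s : ℝ := √(2 / 3) with hs
  have hs0 : 0 < s := Real.sqrt_pos.2 (by norm_num)
  have hs2 : s ^ 2 = 2 / 3 := Real.sq_sqrt (by norm_num)
  have hμ0 : 0 < μ := by
    have h1 : 0 < 2 * (2 * u ^ 2 - 1) * r := mul_pos (by linarith) hr
    by_contra hneg
    nlinarith
  set θ₀ := Real.arcsin (r / s) with hθ₀
  have hrs : r / s < 1 / 2 := by
    rw [div_lt_iff₀ hs0]
    nlinarith
  have hrs0 : 0 < r / s := div_pos hr hs0
  have hsin : Real.sin θ₀ = r / s := Real.sin_arcsin (by linarith) (by linarith)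
  have hθpos : 0 < θ₀ := Real.arcsin_pos.2 hrs0
  -- The condition r² < 1/6 says that 3θ₀ < π/2, so that r lies on the principal branch of the
  -- arcsine.
  have hθ6 : θ₀ < Real.pi / 6 := by
    rw [hθ₀, Real.arcsin_lt_iff_lt_sin' ⟨by linarith [Real.pi_pos], by linarith [Real.pi_pos]⟩,
      Real.sin_pi_div_six]
    exact hrs
  set A := 3 / (2 * μ * s) with hA
  have hA0 : 0 < A := by positivity
  have hsin3 : Real.sin (3 * θ₀) = A := by
    rw [Real.sin_three_mul, hsin, hA]
    field_simp
    rw [hs2]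
    linear_combination 2 * hμ - 8 * μ * r * hru
  have hA1 : A < 1 := by
    rw [← hsin3, ← Real.sin_pi_div_two]
    exact Real.sin_lt_sin_of_lt_of_le_pi_div_two (by linarith [Real.pi_pos]) le_rfl (by linarith)
  have harc : Real.arcsin A = 3 * θ₀ := by
    rw [← hsin3]
    exact Real.arcsin_sin (by linarith [Real.pi_pos]) (by linarith)
  have hA2 : A ^ 2 < 1 := by nlinarith
  -- The first bound keeps e positive, the second keeps A√(2e) < 1, where the arcsine is smooth.
  set ε := min (1 / 2) (1 / (2 * A ^ 2) - 1 / 2) with hε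
  have hε0 : 0 < ε := by
    refine lt_min (by norm_num) ?_
    have : 1 < 1 / A ^ 2 := by rwa [lt_div_iff₀ (by positivity), one_mul]
    have h2 : 1 / (2 * A ^ 2) = 1 / 2 * (1 / A ^ 2) := by field_simp
    linarith
  have hI : ∀ e ∈ Ioo (1 / 2 - ε) (1 / 2 + ε), 0 < A * √(2 * e) ∧ A * √(2 * e) < 1 ∧ 0 < 2 * e := by
    intro e he
    have h1 : 0 < 2 * e := by linarith [he.1, min_le_left (1 / 2 : ℝ) (1 / (2 * A ^ 2) - 1 / 2)]
    have h2 : e < 1 / (2 * A ^ 2) := by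
      linarith [he.2, min_le_right (1 / 2 : ℝ) (1 / (2 * A ^ 2) - 1 / 2)]
    have h3 := mul_pos hA0 (Real.sqrt_pos.2 h1)
    refine ⟨h3, ?_, h1⟩
    rw [← abs_of_pos h3, ← sq_lt_one_iff_abs_lt_one, mul_pow, Real.sq_sqrt h1.le]
    rw [lt_div_iff₀ (by positivity)] at h2
    linarith
  set θ : ℝ → ℝ := fun e => Real.arcsin (A * √(2 * e)) / 3 with hθ
  set ρ : ℝ → ℝ := fun e => s * Real.sin (θ e) with hρ
  have hρs : ContDiffOn ℝ ∞ ρ (Ioo (1 / 2 - ε) (1 / 2 + ε)) := by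
    refine contDiffOn_const.mul (Real.contDiff_sin.comp_contDiffOn (ContDiffOn.div_const ?_ 3))
    intro e he
    obtain ⟨h1, h2, -⟩ := hI e he
    exact ContDiffAt.comp_contDiffWithinAt (g := Real.arcsin) (f := fun e => A * √(2 * e)) e
      (Real.contDiffAt_arcsin (by linarith) h2.ne)
      ((contDiffOn_const.mul (contDiffOn_sqrt_two_mul (min_le_left _ _))) e he)
  have hρsq : ∀ e, ρ e ^ 2 ≤ 2 / 3 := fun e => by
    rw [hρ]
    simp only [mul_pow, hs2]
    nlinarith [Real.sin_sq_le_one (θ e)]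
  have hρpos : ∀ e ∈ Ioo (1 / 2 - ε) (1 / 2 + ε), 0 < ρ e := fun e he => by
    obtain ⟨h1, h2, -⟩ := hI e he
    have h3 := Real.arcsin_pos.2 h1
    have h4 := Real.arcsin_le_pi_div_two (A * √(2 * e))
    refine mul_pos hs0 (Real.sin_pos_of_pos_of_lt_pi ?_ ?_)
    · simp only [hθ]; linarith
    · simp only [hθ]; linarith [Real.pi_pos]
  have hkey : ∀ e ∈ Ioo (1 / 2 - ε) (1 / 2 + ε),
      ρ e * (2 * μ * (1 - 2 * ρ e ^ 2)) = √(2 * e) := fun e he => by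
    obtain ⟨h1, h2, -⟩ := hI e he
    have h3 : Real.sin (3 * θ e) = A * √(2 * e) := by
      rw [hθ, mul_div_cancel₀ _ (by norm_num : (3 : ℝ) ≠ 0)]
      exact Real.sin_arcsin (by linarith) h2.le
    rw [Real.sin_three_mul] at h3
    have h4 : A * (2 * μ * s) = 3 := by rw [hA]; field_simp
    simp only [hρ]
    linear_combination (2 / 3 * μ * s) * h3 + √(2 * e) / 3 * h4 -
      4 * μ * s * Real.sin (θ e) ^ 3 * hs2
  have hρc : ρ (1 / 2) = r := by
    simp only [hρ, hθ]
    norm_num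
    rw [harc, mul_div_cancel_left₀ _ (by norm_num : (3 : ℝ) ≠ 0), hsin]
    field_simp
  have h1ρ : ∀ e, 0 < 1 - ρ e ^ 2 := fun e => by linarith [hρsq e]
  refine nonempty_orbitCylinder (σ := 1) (ρ := ρ) (υ := fun e => √(1 - ρ e ^ 2))
    (w := fun e => 2 * μ * (1 - 2 * ρ e ^ 2)) hε0 (Or.inl rfl) hρs
    ((contDiffOn_const.sub (hρs.pow 2)).sqrt fun e _ => (h1ρ e).ne')
    (contDiffOn_const.mul (contDiffOn_const.sub (contDiffOn_const.mul (hρs.pow 2))))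
    (fun e he => ?_) (fun e he => ⟨?_, ?_⟩) (fun e he => ?_) hρc ?_ ?_ ?_
  · rw [one_mul]
    refine pos_of_mul_pos_right ?_ (hρpos e he).le
    rw [hkey e he]
    exact Real.sqrt_pos.2 (hI e he).2.2
  · rw [Real.sq_sqrt (h1ρ e).le]
    ring
  · rw [fieldStrength, Real.sq_sqrt (h1ρ e).le]
    ring
  · rw [← mul_pow, hkey e he, Real.sq_sqrt (hI e he).2.2.le]
  · rw [hρc]
    have : 1 - r ^ 2 = u ^ 2 := by linarith
    rw [this, Real.sqrt_sq hu.le]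
  · rw [hρc]
    field_simp
    linear_combination hμ - 4 * μ * r * hru
  · field_simp

theorem hasCorrectionTerm_of_deriv {g : SphereMetric} {ψ : SphereOneForm} {k T : ℝ}
    {y : ℝ → Phase} {χ : SignType} (hχ : χ ≠ 0) (hne : Nonempty (OrbitCylinder g ψ k T y))
    (h : ∀ O : OrbitCylinder g ψ k T y, SignType.sign (-deriv O.period k) = χ) :
    HasCorrectionTerm g ψ k T y χ := by
  refine ⟨hne, fun O => ⟨fun h0 => hχ ?_, h O⟩⟩
  rw [← h O, h0, neg_zero, sign_zero]

end MagneticSphere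

end

/-! ### The choice of constants and the conclusion -/

theorem mainTheorem6 :
    ∃ (g : SphereMetric) (ψ : SphereOneForm),
      maneCriticalValue g ψ < ((1 / 2 : ℝ) : EReal) ∧
      (∃ (T : ℝ) (y : ℝ → Phase),
        IsClosedOrbit g ψ (1 / 2) T y ∧
        StronglyNondegenerate g ψ T y ∧
        HasCorrectionTerm g ψ (1 / 2) T y (-1) ∧
        (∀ O : OrbitCylinder g ψ (1 / 2) T y, 0 < deriv O.period (1 / 2)) ∧
        IsCriticalPoint g ψ (1 / 2) (baseLoop y T) T ∧
        fixedIndex g ψ (1 / 2) (baseLoop y T) T ≠ ⊤ ∧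
        freeIndex g ψ (1 / 2) (baseLoop y T) T = fixedIndex g ψ (1 / 2) (baseLoop y T) T + 1) ∧
      (∃ (T : ℝ) (z : ℝ → Phase),
        IsClosedOrbit g ψ (1 / 2) T z ∧
        StronglyNondegenerate g ψ T z ∧
        HasCorrectionTerm g ψ (1 / 2) T z 1) := by
  -- This is the value for which the circle of radius r = 11/27 has unit speed: 2μr(1 - 2r²) = 1.
  obtain ⟨μ, hμ⟩ : ∃ μ : ℝ, μ = 19683 / 10714 := ⟨_, rfl⟩
  refine ⟨roundMetric, magneticPotential μ, maneCriticalValue_lt (by rw [hμ]; norm_num), ?_, ?_⟩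
  -- The radius is a rational just below 1/√6, where κ vanishes; hence κ is positive and so small
  -- that κT² < 1.
  · obtain ⟨r, hr⟩ : ∃ r : ℝ, r = 11 / 27 := ⟨_, rfl⟩
    obtain ⟨u, hu, hu2⟩ : ∃ u : ℝ, 0 < u ∧ u ^ 2 = 608 / 729 :=
      ⟨√(608 / 729), Real.sqrt_pos.2 (by norm_num), Real.sq_sqrt (by norm_num)⟩
    have hr0 : 0 < r := by rw [hr]; norm_num
    have hru : r ^ 2 + u ^ 2 = 1 := by rw [hr, hu2]; norm_num
    have hμru : 2 * μ * (2 * u ^ 2 - 1) * r = 1 := by rw [hμ, hr, hu2]; norm_num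
    have hκ : normalFrequency μ r u (1 / r) = 1824 / 58927 := by
      rw [normalFrequency, fieldStrength, mul_pow, mul_pow, hu2, hμ, hr]
      norm_num
    have hcirc : IsMagneticCircle μ r u (1 / r) := by
      refine ⟨hru, ?_⟩
      rw [fieldStrength]
      field_simp
      linear_combination hμru
    have hs : r ^ 2 * (1 / r) ^ 2 = 1 := by field_simp
    have hT : 0 < 2 * Real.pi * r := by positivity
    have hΩT : Real.cos (1 / r * (2 * Real.pi * r)) = 1 := by
      rw [show 1 / r * (2 * Real.pi * r) = 2 * Real.pi by field_simp, Real.cos_two_pi]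
    have hκ₀ : 0 < normalFrequency μ r u (1 / r) := by rw [hκ]; norm_num
    have hκT : normalFrequency μ r u (1 / r) * (2 * Real.pi * r) ^ 2 < 1 := by
      rw [hκ, hr]
      nlinarith [Real.pi_pos, Real.pi_lt_d2]
    have hκu : r ^ 2 * normalFrequency μ r u (1 / r) < u ^ 2 := by
      rw [hκ, hr, hu2]
      norm_num
    have hder : ∀ O : OrbitCylinder roundMetric (magneticPotential μ) (1 / 2) (2 * Real.pi * r)
        (circleOrbit r u (1 / r)), 0 < deriv O.period (1 / 2) := fun O => by
      have h := O.deriv_period_eq hcirc hs hT hΩT hκ₀.ne' hκT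
      refine pos_of_mul_pos_right ?_ (mul_pos (pow_pos hr0 2) hκ₀).le
      rw [h]
      exact mul_pos hT (sub_pos.2 hκu)
    refine ⟨2 * Real.pi * r, circleOrbit r u (1 / r),
      isClosedOrbit_circleOrbit hcirc hT hΩT (by rw [hs]; norm_num),
      stronglyNondegenerate_circleOrbit hcirc hs hT hΩT hκ₀.ne' hκT hκu.ne,
      hasCorrectionTerm_of_deriv (by decide) (nonempty_orbitCylinder_latitude hr0 hu
        (by rw [hr]; norm_num) hru hμru) fun O => sign_neg (neg_lt_zero.2 (hder O)), hder, ?_⟩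
    rw [baseLoop_circleOrbit hr0, fixedIndex_circleLoop hr0 hru hμru hκT hκu.le,
      freeIndex_circleLoop hr0 hru hμru hκ₀ hκT]
    exact ⟨isCriticalPoint_circleLoop hr0 hru hμru, ENat.zero_ne_top, (zero_add 1).symm⟩
  -- The equator is traversed in the negative direction, for which κ = 1 - 2μ is negative and the
  -- bound κT² < 1 is automatic; the positive direction has κ = 1 + 2μ, for which that bound fails.
  · have hcirc : IsMagneticCircle μ 1 0 (-1) := ⟨by norm_num, by simp [fieldStrength]⟩
    have hs : (1 : ℝ) ^ 2 * (-1) ^ 2 = 1 := by norm_num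
    have hT : 0 < 2 * Real.pi := by positivity
    have hΩT : Real.cos (-1 * (2 * Real.pi)) = 1 := by
      rw [neg_one_mul, Real.cos_neg, Real.cos_two_pi]
    have hκ : normalFrequency μ 1 0 (-1) < 0 := by
      rw [normalFrequency, fieldStrength, hμ]
      norm_num
    have hκT : normalFrequency μ 1 0 (-1) * (2 * Real.pi) ^ 2 < 1 :=
      (mul_neg_of_neg_of_pos hκ (pow_pos hT 2)).trans one_pos
    refine ⟨2 * Real.pi, circleOrbit 1 0 (-1),
      isClosedOrbit_circleOrbit hcirc hT hΩT (by norm_num),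
      stronglyNondegenerate_circleOrbit hcirc hs hT hΩT hκ.ne hκT (by simpa using hκ.ne),
      hasCorrectionTerm_of_deriv (by decide) (nonempty_orbitCylinder_equator μ) fun O => ?_⟩
    have h := O.deriv_period_eq hcirc hs hT hΩT hκ.ne hκT
    -- With r = 1 and u = 0 the factor κ cancels, and -T' = 2π remains.
    have h' : normalFrequency μ 1 0 (-1) * (-deriv O.period (1 / 2)) =
        normalFrequency μ 1 0 (-1) * (2 * Real.pi) := by linear_combination -h
    rw [mul_left_cancel₀ hκ.ne h']
    exact sign_pos hT
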